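/- **Setting.** Let $N=n+r$ and write $w=(u,v)\in\mathbb R^n\times\mathbb R^r$. Consider $w_t+F(w)_x=Q(w)$, $Q(w)=(0,q(w))$, with $F\in C^2(\mathbb R^N;\mathbb R^N)$ and $q\in C^2(\mathbb R^N;\mathbb R^r)$. Let $\mathcal U\subset\mathbb R^n$, $\mathcal V\subset\mathbb R^r$ be open and $v^*\in C^1(\mathcal U;\mathbb R^r)$ be such that, for $(u,v)\in\mathcal U\times\mathcal V$, $q(u,v)=0$ if and only if $v=v^*(u)$, and such that for $u\in\mathcal U$ all eigenvalues of $\mathrm d_vq(u,v^*(u))$ have negative real part. Let $\mathcal W\subset\mathcal U\times\mathcal V$ be an open set on which $\mathrm dF$ has $N$ distinct real eigenvalues, and let $\mathcal U^*\subset\mathcal U$ be an open set over which the graph of $v^*$ lies in $\mathcal W$. Put $f^*(u)=f(u,v^*(u))$, where $f$ is the $u$-component of $F$. With $\mathrm dF=\begin{pmatrix}A_{11}&A_{12}\\A_{21}&A_{22}\end{pmatrix}$ and $\mathrm dQ=\begin{pmatrix}0&0\\q_1&q_2\end{pmatrix}$ evaluated at $(u,v^*(u))$, let $$b_0(u)=-A_{12}q_2^{-1}\bigl(c+q_2^{-1}q_1a\bigr),\quad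 a=A_{11}-A_{12}q_2^{-1}q_1,\quad c=A_{21}-A_{22}q_2^{-1}q_1 .$$ For a real square matrix $M$ let $\mathrm{Re}\,M=\tfrac12(M+M^{T})$. **Assumptions on the relaxed system** (on $\mathcal U^*$). * **B1.** There is a $C^1$ map $a_0$ into the symmetric positive definite matrices such that $a_0\,\mathrm df^*$ is symmetric and $\mathrm{Re}\,(a_0b_0)\ge0$. * **B2.** There is a $C^1$ map $k$ into the real skew-symmetric matrices such that $\mathrm{Re}\,(k\,\mathrm df^*+a_0b_0)>0$. * **B3.** There is $c_0>0$ such that $\mathrm df^*(u)$ has a simple real eigenvalue $\alpha_0(u)$ with $|\alpha_0(u)|<c_0$, while all its other eigenvalues have absolute value $\ge2c_0$; and $\eta(u):=\mathrm d\alpha_0(u)\cdot r_0(u)\neq0$, where $r_0(u)$ is a unit eigenvector for $\alpha_0(u)$. **Profiles.** A relaxation shock is a $C^2$ function $W=(U,V):\mathbb R\to\mathbb R^N$ with $F(W)'=Q(W)$ and limits $W(\pm\infty)=W_\pm=(u_\pm,v^*(u_\pm))$, $W_+\ne W_-$. Let $\varepsilon=|W_+-W_-|$. It satisfies **C** with constant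 $C_1>0$ if for all $x\in\mathbb R$ $$|W'(x)|\le C_1\varepsilon^2,\qquad |W''(x)|\le C_1\varepsilon|W'(x)|,\qquad \Bigl|\tfrac{U'(x)}{|U'(x)|}+\mathrm{sgn}\bigl(\eta(U(x))\bigr)\,r_0(U(x))\Bigr|\le C_1\varepsilon^2 .$$ **Proposition (Goodman estimate).** Assume B1, B2, B3. Let $K\subset\{(u,v)\in\mathcal W: u\in\mathcal U^*\}$ be compact and let $C_1>0$. Then there are $\varepsilon_0>0$ and $C>0$ such that the following holds for every relaxation shock $W$ with values in $K$ that satisfies C with constant $C_1$ and has $\varepsilon\le\varepsilon_0$, every $\lambda\in\mathbb C\setminus\{0\}$ with $\mathrm{Re}\,\lambda\ge0$, and every $w=(u,v)\in H^1(\mathbb R;\mathbb C^N)$ solving $$\lambda w+(\mathrm dF(W)w)'-\mathrm dQ(W)w=0 .$$ The improper integral $z(x)=\int_{-\infty}^xu(y)\,dy$ converges for every $x$, $z\in L^2$, and $$\mathrm{Re}\,\lambda\,|z|_{L^2}^2+\int_{\mathbb R}|z|^2\,|W'|\,dx\;\le\;C\bigl(\varepsilon|u|_{L^2}^2+\varepsilon|\Pi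 w|_{L^2}^2+\varepsilon^{-1}|w'|_{L^2}^2\bigr),\qquad \Pi:=\mathrm dQ(W_+)+\mathrm dQ(W_-).$$ -/

import Mathlib

open MeasureTheory Filter Topology

noncomputable section

namespace RelaxationShock

/-- States `w = (u, v) ∈ ℝⁿ × ℝʳ` with the Euclidean norm. -/
abbrev State (n r : ℕ) : Type := EuclideanSpace ℝ (Fin n ⊕ Fin r)

/-- Complex perturbations `w = (u, v) ∈ ℂⁿ × ℂʳ` with the Euclidean norm. -/
abbrev CState (n r : ℕ) : Type := EuclideanSpace ℂ (Fin n ⊕ Fin r)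

/-- The state `(u, v)`. -/
def mkState {n r : ℕ} (u : EuclideanSpace ℝ (Fin n)) (v : EuclideanSpace ℝ (Fin r)) :
    State n r :=
  WithLp.toLp 2 (Sum.elim u v)

/-- The component `u` of `w = (u, v)`, for real or complex states. -/
def uPart {𝕜 : Type*} {n r : ℕ} (w : EuclideanSpace 𝕜 (Fin n ⊕ Fin r)) :
    EuclideanSpace 𝕜 (Fin n) :=
  WithLp.toLp 2 fun i => w (Sum.inl i)

/-- The component `v` of `w = (u, v)`, for real or complex states. -/
def vPart {𝕜 : Type*} {n r : ℕ} (w : EuclideanSpace 𝕜 (Fin n ⊕ Fin r)) :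
    EuclideanSpace 𝕜 (Fin r) :=
  WithLp.toLp 2 fun i => w (Sum.inr i)

/-- The Jacobian matrix of `G` at `x`. -/
def jacobian {ι κ : Type*} [Fintype ι] [DecidableEq ι] [Fintype κ]
    (G : EuclideanSpace ℝ ι → EuclideanSpace ℝ κ) (x : EuclideanSpace ℝ ι) : Matrix κ ι ℝ :=
  Matrix.of fun i j => fderiv ℝ G x (EuclideanSpace.single j 1) i

/-- A real matrix acting on a complex vector. -/
def cmul {ι κ : Type*} [Fintype ι] (A : Matrix κ ι ℝ) (w : EuclideanSpace ℂ ι) :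
    EuclideanSpace ℂ κ :=
  WithLp.toLp 2 ((A.map Complex.ofReal).mulVec w.ofLp)

variable {n r : ℕ}

/-- The source term `Q(w) = (0, q(w))`. -/
def source (q : State n r → EuclideanSpace ℝ (Fin r)) (w : State n r) : State n r :=
  mkState 0 (q w)

/-- The relaxed flux `f^*(u) = f(u, v^*(u))`, where `f` is the `u`-component of `F`. -/
def relaxedFlux (F : State n r → State n r)
    (vstar : EuclideanSpace ℝ (Fin n) → EuclideanSpace ℝ (Fin r))
    (u : EuclideanSpace ℝ (Fin n)) : EuclideanSpace ℝ (Fin n) :=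
  uPart (F (mkState u (vstar u)))

/-- The Chapman--Enskog viscosity `-A₁₂ q₂⁻¹ (c + q₂⁻¹ q₁ a)` at the state `w`, where
`dF = (A₁₁ A₁₂; A₂₁ A₂₂)`, `dQ = (0 0; q₁ q₂)`, `a = A₁₁ - A₁₂ q₂⁻¹ q₁`,
`c = A₂₁ - A₂₂ q₂⁻¹ q₁`. -/
def viscosityAt (F : State n r → State n r) (q : State n r → EuclideanSpace ℝ (Fin r))
    (w : State n r) : Matrix (Fin n) (Fin n) ℝ :=
  let A := jacobian F w
  let q₁ := (jacobian (source q) w).toBlocks₂₁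
  let q₂ := (jacobian (source q) w).toBlocks₂₂
  let a := A.toBlocks₁₁ - A.toBlocks₁₂ * q₂⁻¹ * q₁;
  let c := A.toBlocks₂₁ - A.toBlocks₂₂ * q₂⁻¹ * q₁;
  -(A.toBlocks₁₂ * q₂⁻¹ * (c + q₂⁻¹ * q₁ * a))

/-- The Chapman--Enskog viscosity `b₀(u)` of the relaxed system, i.e. at the equilibrium
`(u, v^*(u))`. -/
def viscosity (F : State n r → State n r) (q : State n r → EuclideanSpace ℝ (Fin r))
    (vstar : EuclideanSpace ℝ (Fin n) → EuclideanSpace ℝ (Fin r))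
    (u : EuclideanSpace ℝ (Fin n)) : Matrix (Fin n) (Fin n) ℝ :=
  viscosityAt F q (mkState u (vstar u))

/-- The standing assumptions on the relaxation system `w_t + F(w)_x = (0, q(w))`: strict
hyperbolicity on the set `W` of states under consideration, the equilibrium manifold
`q = 0 ↔ v = v^*(u)` in `U × V`, stability of `d_v q` there, and `Us` is a set of
conserved densities over which the equilibrium manifold stays in `W`. -/
structure IsRelaxationSystem (F : State n r → State n r)
    (q : State n r → EuclideanSpace ℝ (Fin r))
    (vstar : EuclideanSpace ℝ (Fin n) → EuclideanSpace ℝ (Fin r))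
    (U : Set (EuclideanSpace ℝ (Fin n))) (V : Set (EuclideanSpace ℝ (Fin r)))
    (W : Set (State n r)) (Us : Set (EuclideanSpace ℝ (Fin n))) : Prop where
  contDiff_F : ContDiff ℝ 2 F
  contDiff_q : ContDiff ℝ 2 q
  isOpen_U : IsOpen U
  isOpen_V : IsOpen V
  contDiffOn_vstar : ContDiffOn ℝ 1 vstar U
  equilibrium_iff : ∀ u ∈ U, ∀ v ∈ V, q (mkState u v) = 0 ↔ v = vstar u
  stable : ∀ u ∈ U, ∀ μ : ℂ,
    (((jacobian (source q) (mkState u (vstar u))).toBlocks₂₂).map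
      Complex.ofReal).charpoly.IsRoot μ → μ.re < 0
  isOpen_W : IsOpen W
  W_subset : ∀ w ∈ W, uPart w ∈ U ∧ vPart w ∈ V
  hyperbolic : ∀ w ∈ W, Set.ncard {μ : ℝ | (jacobian F w).charpoly.IsRoot μ} = n + r
  isOpen_Us : IsOpen Us
  Us_subset : Us ⊆ U
  graph_subset : ∀ u ∈ Us, mkState u (vstar u) ∈ W

/-- `a₀` is a positive definite symmetrizer of the relaxed system on `Us`, and
`Re (a₀ b₀) ≥ 0`. -/
structure AssumptionB1 (F : State n r → State n r)
    (q : State n r → EuclideanSpace ℝ (Fin r))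
    (vstar : EuclideanSpace ℝ (Fin n) → EuclideanSpace ℝ (Fin r))
    (Us : Set (EuclideanSpace ℝ (Fin n)))
    (a₀ : EuclideanSpace ℝ (Fin n) → Matrix (Fin n) (Fin n) ℝ) : Prop where
  contDiffOn : ∀ i j, ContDiffOn ℝ 1 (fun u => a₀ u i j) Us
  posDef : ∀ u ∈ Us, (a₀ u).PosDef
  isSymm : ∀ u ∈ Us, (a₀ u * jacobian (relaxedFlux F vstar) u).IsSymm
  nonneg : ∀ u ∈ Us, ∀ x : Fin n → ℝ,
    0 ≤ x ⬝ᵥ (a₀ u * viscosity F q vstar u).mulVec x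

/-- The reduced Shizuta--Kawashima condition: `k` is skew-symmetric and
`Re (k df^* + a₀ b₀) > 0` on `Us`. -/
structure AssumptionB2 (F : State n r → State n r)
    (q : State n r → EuclideanSpace ℝ (Fin r))
    (vstar : EuclideanSpace ℝ (Fin n) → EuclideanSpace ℝ (Fin r))
    (Us : Set (EuclideanSpace ℝ (Fin n)))
    (a₀ k : EuclideanSpace ℝ (Fin n) → Matrix (Fin n) (Fin n) ℝ) : Prop where
  contDiffOn : ∀ i j, ContDiffOn ℝ 1 (fun u => k u i j) Us
  skew : ∀ u ∈ Us, (k u).transpose = -k u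
  pos : ∀ u ∈ Us, ∀ x : Fin n → ℝ, x ≠ 0 →
    0 < x ⬝ᵥ (k u * jacobian (relaxedFlux F vstar) u
      + a₀ u * viscosity F q vstar u).mulVec x

/-- `η(u) = dα₀(u) · r₀(u)`. -/
def gnl (α₀ : EuclideanSpace ℝ (Fin n) → ℝ)
    (r₀ : EuclideanSpace ℝ (Fin n) → EuclideanSpace ℝ (Fin n))
    (u : EuclideanSpace ℝ (Fin n)) : ℝ :=
  fderiv ℝ α₀ u (r₀ u)

/-- Simplicity and genuine nonlinearity of the principal equilibrium characteristic: `α₀(u)`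
is a simple eigenvalue of `df^*(u)` with unit eigenvector `r₀(u)`, `|α₀(u)| < c₀`, every
other eigenvalue is at least `2 c₀` in absolute value, and `η ≠ 0` on `Us`. -/
structure AssumptionB3 (F : State n r → State n r)
    (vstar : EuclideanSpace ℝ (Fin n) → EuclideanSpace ℝ (Fin r))
    (Us : Set (EuclideanSpace ℝ (Fin n))) (c₀ : ℝ)
    (α₀ : EuclideanSpace ℝ (Fin n) → ℝ)
    (r₀ : EuclideanSpace ℝ (Fin n) → EuclideanSpace ℝ (Fin n)) : Prop where
  c₀_pos : 0 < c₀
  simple : ∀ u ∈ Us, (jacobian (relaxedFlux F vstar) u).charpoly.rootMultiplicity (α₀ u) = 1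
  abs_lt : ∀ u ∈ Us, |α₀ u| < c₀
  others : ∀ u ∈ Us, ∀ μ : ℂ,
    ((jacobian (relaxedFlux F vstar) u).map Complex.ofReal).charpoly.IsRoot μ →
      μ ≠ (α₀ u : ℂ) → 2 * c₀ ≤ ‖μ‖
  eigenvector : ∀ u ∈ Us,
    (jacobian (relaxedFlux F vstar) u).mulVec (r₀ u).ofLp = (α₀ u • r₀ u).ofLp
  unit : ∀ u ∈ Us, ‖r₀ u‖ = 1
  genuinelyNonlinear : ∀ u ∈ Us, gnl α₀ r₀ u ≠ 0

/-- `W` is a (smooth, stationary) relaxation shock profile with values in `K`, joining the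
distinct equilibria `Wm` (at `-∞`) and `Wp` (at `+∞`). -/
structure IsRelaxationShock (F : State n r → State n r)
    (q : State n r → EuclideanSpace ℝ (Fin r))
    (vstar : EuclideanSpace ℝ (Fin n) → EuclideanSpace ℝ (Fin r))
    (K : Set (State n r)) (W : ℝ → State n r) (Wm Wp : State n r) : Prop where
  contDiff : ContDiff ℝ 2 W
  mem : ∀ x, W x ∈ K
  profile : ∀ x, deriv (fun y => F (W y)) x = source q (W x)
  tendsto_atBot : Tendsto W atBot (𝓝 Wm)
  tendsto_atTop : Tendsto W atTop (𝓝 Wp)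
  equilibrium_m : vPart Wm = vstar (uPart Wm)
  equilibrium_p : vPart Wp = vstar (uPart Wp)
  ne : Wm ≠ Wp

/-- The assumption on the shape of the profile, with constant `C`; here `U = uPart ∘ W`
is the conserved part of the profile, and `η`, `r₀` are evaluated at `U x`. -/
structure AssumptionC (α₀ : EuclideanSpace ℝ (Fin n) → ℝ)
    (r₀ : EuclideanSpace ℝ (Fin n) → EuclideanSpace ℝ (Fin n))
    (C : ℝ) (W : ℝ → State n r) (Wm Wp : State n r) : Prop where
  deriv_le : ∀ x, ‖deriv W x‖ ≤ C * ‖Wp - Wm‖ ^ 2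
  deriv2_le : ∀ x, ‖deriv (deriv W) x‖ ≤ C * ‖Wp - Wm‖ * ‖deriv W x‖
  direction : ∀ x,
    ‖‖uPart (deriv W x)‖⁻¹ • uPart (deriv W x)
        + Real.sign (gnl α₀ r₀ (uPart (W x))) • r₀ (uPart (W x))‖ ≤ C * ‖Wp - Wm‖ ^ 2

/-- The Sobolev space `H¹(ℝ)`, through absolutely continuous representatives: `w` and its
almost everywhere derivative are square integrable, and `w` is the integral of the latter. -/
structure MemH1 (w : ℝ → CState n r) : Prop where
  memLp : MemLp w 2 volume
  memLp_deriv : MemLp (deriv w) 2 volume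
  integral_deriv : ∀ a b : ℝ, ∫ x in a..b, deriv w x = w b - w a

/-- The resolvent equation `λ w + (dF(W) w)' - dQ(W) w = 0`, almost everywhere. -/
def SolvesResolvent (F : State n r → State n r)
    (q : State n r → EuclideanSpace ℝ (Fin r)) (W : ℝ → State n r) (l : ℂ)
    (w : ℝ → CState n r) : Prop :=
  ∀ᵐ x : ℝ, l • w x + deriv (fun y => cmul (jacobian F (W y)) (w y)) x
    - cmul (jacobian (source q) (W x)) (w x) = 0

/-- `z(x) = ∫_{-∞}^x u(y) dy` for every `x`, as a convergent improper integral. -/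
def IsIntegratedFromBot (u z : ℝ → EuclideanSpace ℂ (Fin n)) : Prop :=
  ∀ x, Tendsto (fun R : ℝ => ∫ y in R..x, u y) atBot (𝓝 (z x))

end RelaxationShock

end

noncomputable section

namespace RelaxationShock

open Matrix ComplexConjugate AbsolutelyContinuousOnInterval

set_option linter.unusedSectionVars false

/-! ### Real matrices acting on complex vectors -/

section Algebra

variable {ι κ μ : Type*} [Fintype ι] [Fintype κ] [Fintype μ]

/-! Write `A = dF(W)`, `J = dQ(W)`. The `u`-rows of `J` vanish, so the `u`-component of the
resolvent equation integrates to `l • z + (A w)_u = 0`. This defines `z` as a multiple of `(A w)_u`;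
it inherits decay and square integrability from `w` (`IsEnergyWeight.exists_primitive`).

Let `g = q₁ u + q₂ v`. Then `w = (u, -q₂⁻¹ q₁ u) + (0, q₂⁻¹ g)` (`cmul_splitting`), and `g` solves
`l g - q₂ g = -(q₁, q₂)(A w)'`. Hence `g = l q₂⁻¹ g + (q₂⁻¹ q₁, 1)(A w)'`. Substituting this for the
`g`-part of `(A w)_u` and applying a weight `S` gives `l S z + S a u + S (ã - a) u + l S A₁₂ q₂⁻² g
+ H (A w)' = 0`, where `H = S A₁₂ q₂⁻¹ (q₂⁻¹ q₁, 1)`, `a = df^*(U)`, and `ã` is the relaxed Jacobian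
at `W` itself. Pair with `z`, take real parts and use `z' = u`. Up to the derivative of `h = Re⟨z, S
a z⟩/2 + Re⟨z, H A w⟩`, the term `S a u` leaves `-Re⟨z, (S a)' z⟩/2`, and `H (A w)'` leaves `-Re⟨u,
H A w⟩`. The `u`-part of the latter is the form of `S b`, with `b` the Chapman-Enskog viscosity
(`viscosityAt_eq`). By B1 it is nonnegative up to `O(ε)`. This is `energy_inequality`.

Goodman's point is to choose `S` with `-(S a)' ≥ c |W'|`. Take `S = a₀ - θ a₀ a`, with `θ` a
multiple of the arc length of `U`. Along the shock `U'` is nearly `|U'| ξ`, where `ξ = -sgn(η) r₀`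
and `α₀` decreases in the direction `ξ`. On the kernel of `a` the form `-d(a₀ a)[ξ]` is therefore
positive, because there `α₀ = 0` and the kernel is spanned by `r₀`. Off the kernel, `θ' a₀ a²`
supplies a large multiple of `|a y|²`. These combine by compactness (`exists_compression`,
`coercive_dcurve`). Since `α₀(U)` is strictly monotone and varies by `O(ε)`, the total length of `U`
is `O(ε)` (`exists_variation_bound`), so `θ = O(ε)` and `S` stays close to `a₀`.

The remaining terms are absorbed pointwise (`exists_absorption`). Stability of `q₂` gives `|g|(1 +
|l|) ≤ C |(q₁, q₂)(A w)'|`, whence `|g| ≤ C (|w'| + ε |u|)`; every term in `g` then costs at most `ε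
|u|² + ε⁻¹ |w'|²`. Coefficients frozen at `(U, v^*(U))` rather than at `W` produce errors `O(|W'|)`,
because the profile equation gives `|q(W)| ≤ C |W'|` (`exists_profile_bound`). Integration over the
line removes `h'` (`exists_energy_estimate`). The `Πw` term on the right of the theorem is not
needed for this bound and is added at the end. -/

/-- The sum of the absolute values of the entries of a matrix. -/
def entrySum (A : Matrix κ ι ℝ) : ℝ := ∑ i, ∑ j, |A i j|

lemma entrySum_nonneg (A : Matrix κ ι ℝ) : 0 ≤ entrySum A :=
  Finset.sum_nonneg fun _ _ => Finset.sum_nonneg fun _ _ => abs_nonneg _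

lemma entrySum_le {A : Matrix κ ι ℝ} {C : ℝ} (h : ∀ i j, |A i j| ≤ C) :
    entrySum A ≤ Fintype.card κ * (Fintype.card ι * C) := by
  unfold entrySum
  calc _ ≤ ∑ _i : κ, ∑ _j : ι, C := by gcongr; exact h _ _
    _ = _ := by simp

lemma entrySum_add_le (A B : Matrix κ ι ℝ) : entrySum (A + B) ≤ entrySum A + entrySum B := by
  unfold entrySum
  simp only [← Finset.sum_add_distrib]
  gcongr
  exact abs_add_le _ _

lemma entrySum_neg (A : Matrix κ ι ℝ) : entrySum (-A) = entrySum A := by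
  simp [entrySum]

lemma entrySum_sub_le (A B : Matrix κ ι ℝ) : entrySum (A - B) ≤ entrySum A + entrySum B := by
  rw [sub_eq_add_neg, ← entrySum_neg B]
  exact entrySum_add_le _ _

lemma entrySum_smul (c : ℝ) (A : Matrix κ ι ℝ) : entrySum (c • A) = |c| * entrySum A := by
  simp [entrySum, abs_mul, Finset.mul_sum]

lemma entrySum_mul_le (A : Matrix κ ι ℝ) (B : Matrix ι μ ℝ) :
    entrySum (A * B) ≤ entrySum A * entrySum B := by
  have h : ∀ j, ∑ k, |B j k| ≤ entrySum B := fun j =>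
    Finset.single_le_sum (f := fun i' => ∑ j', |B i' j'|)
      (fun _ _ => Finset.sum_nonneg fun _ _ => abs_nonneg _) (Finset.mem_univ j)
  calc entrySum (A * B) ≤ ∑ i, ∑ k, ∑ j, |A i j| * |B j k| := by
        unfold entrySum
        gcongr with i _ k _
        rw [Matrix.mul_apply]
        refine (Finset.abs_sum_le_sum_abs _ _).trans (le_of_eq ?_)
        simp [abs_mul]
    _ = ∑ i, ∑ j, |A i j| * ∑ k, |B j k| := by
        refine Finset.sum_congr rfl fun i _ => ?_
        rw [Finset.sum_comm]
        simp [Finset.mul_sum]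
    _ ≤ ∑ i, ∑ j, |A i j| * entrySum B := by
        gcongr with i _ j _
        exact h j
    _ = _ := by simp [entrySum, Finset.sum_mul]

lemma cmul_apply (A : Matrix κ ι ℝ) (w : EuclideanSpace ℂ ι) (i : κ) :
    cmul A w i = ∑ j, (A i j : ℂ) * w j := rfl

lemma cmul_add (A : Matrix κ ι ℝ) (w w' : EuclideanSpace ℂ ι) :
    cmul A (w + w') = cmul A w + cmul A w' := by
  ext i; simp [cmul_apply, mul_add, Finset.sum_add_distrib]

lemma cmul_smul (A : Matrix κ ι ℝ) (c : ℂ) (w : EuclideanSpace ℂ ι) :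
    cmul A (c • w) = c • cmul A w := by
  ext i; simp [cmul_apply, Finset.mul_sum, mul_left_comm]

lemma cmul_neg (A : Matrix κ ι ℝ) (w : EuclideanSpace ℂ ι) : cmul A (-w) = -cmul A w := by
  ext i; simp [cmul_apply]

lemma cmul_sub (A : Matrix κ ι ℝ) (w w' : EuclideanSpace ℂ ι) :
    cmul A (w - w') = cmul A w - cmul A w' := by
  rw [sub_eq_add_neg, cmul_add, cmul_neg, sub_eq_add_neg]

lemma add_cmul (A B : Matrix κ ι ℝ) (w : EuclideanSpace ℂ ι) :
    cmul (A + B) w = cmul A w + cmul B w := by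
  ext i; simp [cmul_apply, add_mul, Finset.sum_add_distrib]

lemma neg_cmul (A : Matrix κ ι ℝ) (w : EuclideanSpace ℂ ι) : cmul (-A) w = -cmul A w := by
  ext i; simp [cmul_apply]

lemma sub_cmul (A B : Matrix κ ι ℝ) (w : EuclideanSpace ℂ ι) :
    cmul (A - B) w = cmul A w - cmul B w := by
  rw [sub_eq_add_neg, add_cmul, neg_cmul, sub_eq_add_neg]

lemma zero_cmul (w : EuclideanSpace ℂ ι) : cmul (0 : Matrix κ ι ℝ) w = 0 := by
  ext i; simp [cmul_apply]

lemma cmul_cmul (A : Matrix κ ι ℝ) (B : Matrix ι μ ℝ) (w : EuclideanSpace ℂ μ) :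
    cmul A (cmul B w) = cmul (A * B) w := by
  ext i
  simp only [cmul_apply, Matrix.mul_apply, Finset.mul_sum, Complex.ofReal_sum, Finset.sum_mul,
    Complex.ofReal_mul]
  rw [Finset.sum_comm]
  simp [mul_assoc]

lemma one_cmul [DecidableEq ι] (w : EuclideanSpace ℂ ι) : cmul (1 : Matrix ι ι ℝ) w = w := by
  ext i
  simp only [cmul_apply]
  rw [Finset.sum_eq_single i] <;> simp +contextual [eq_comm]

/-- Each row is bounded by its absolute row sum, and the Euclidean norm is at most the sum of the
moduli. Thus `entrySum` dominates the operator norm; being submultiplicative and entrywise, it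
serves as the only matrix norm for all coefficient bounds. -/
lemma norm_cmul_le (A : Matrix κ ι ℝ) (w : EuclideanSpace ℂ ι) :
    ‖cmul A w‖ ≤ entrySum A * ‖w‖ := by
  have h1 : ∀ i, ‖cmul A w i‖ ≤ (∑ j, |A i j|) * ‖w‖ := fun i => by
    rw [cmul_apply, Finset.sum_mul]
    refine (norm_sum_le _ _).trans (Finset.sum_le_sum fun j _ => ?_)
    rw [norm_mul, Complex.norm_real, Real.norm_eq_abs]
    gcongr
    exact PiLp.norm_apply_le w j
  calc ‖cmul A w‖ ≤ ∑ i, ‖cmul A w i‖ := by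
        have h0 : 0 ≤ ∑ i, ‖cmul A w i‖ := Finset.sum_nonneg fun _ _ => norm_nonneg _
        rw [EuclideanSpace.norm_eq]
        refine Real.sqrt_le_iff.2 ⟨h0, ?_⟩
        rw [sq (∑ i, ‖cmul A w i‖), Finset.sum_mul]
        gcongr with i _
        rw [sq]
        gcongr
        exact Finset.single_le_sum (f := fun i => ‖cmul A w i‖)
          (fun _ _ => norm_nonneg _) (Finset.mem_univ i)
    _ ≤ ∑ i, (∑ j, |A i j|) * ‖w‖ := Finset.sum_le_sum fun i _ => h1 i
    _ = _ := by rw [entrySum, Finset.sum_mul]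

lemma inner_cmul_transpose (A : Matrix κ ι ℝ) (z : EuclideanSpace ℂ κ) (w : EuclideanSpace ℂ ι) :
    inner ℂ z (cmul A w) = inner ℂ (cmul Aᵀ z) w := by
  simp only [PiLp.inner_apply, cmul_apply, RCLike.inner_apply, Finset.sum_mul, map_sum,
    Finset.mul_sum, map_mul, Complex.conj_ofReal, Matrix.transpose_apply]
  rw [Finset.sum_comm]
  refine Finset.sum_congr rfl fun j _ => Finset.sum_congr rfl fun i _ => ?_
  ring

/-- The real part of a complex vector. -/
def reVec (w : EuclideanSpace ℂ ι) : ι → ℝ := fun i => (w i).re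

/-- The imaginary part of a complex vector. -/
def imVec (w : EuclideanSpace ℂ ι) : ι → ℝ := fun i => (w i).im

/-- For real `S` the cross terms between real and imaginary parts are purely imaginary. Symmetry of
`S` plays no role, so coercivity of real, possibly nonsymmetric, forms passes to complex vectors. -/
lemma re_inner_cmul (S : Matrix ι ι ℝ) (z : EuclideanSpace ℂ ι) :
    (inner ℂ z (cmul S z)).re =
      reVec z ⬝ᵥ S *ᵥ reVec z + imVec z ⬝ᵥ S *ᵥ imVec z := by
  simp only [PiLp.inner_apply, cmul_apply, RCLike.inner_apply, Finset.sum_mul,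
    Complex.re_sum, dotProduct, Matrix.mulVec, Finset.mul_sum, reVec, imVec]
  rw [← Finset.sum_add_distrib]
  refine Finset.sum_congr rfl fun i _ => ?_
  rw [← Finset.sum_add_distrib]
  refine Finset.sum_congr rfl fun j _ => ?_
  simp
  ring

lemma norm_sq_eq_reVec_imVec (z : EuclideanSpace ℂ ι) :
    ‖z‖ ^ 2 = reVec z ⬝ᵥ reVec z + imVec z ⬝ᵥ imVec z := by
  rw [EuclideanSpace.norm_sq_eq]
  simp only [dotProduct, reVec, imVec, ← Finset.sum_add_distrib]
  refine Finset.sum_congr rfl fun i _ => ?_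
  rw [← Complex.normSq_eq_norm_sq, Complex.normSq_apply]

/-- A lower bound of a real quadratic form holds for its Hermitian extension. -/
lemma le_re_inner_cmul {S : Matrix ι ι ℝ} {c : ℝ}
    (h : ∀ y : ι → ℝ, c * (y ⬝ᵥ y) ≤ y ⬝ᵥ S *ᵥ y) (z : EuclideanSpace ℂ ι) :
    c * ‖z‖ ^ 2 ≤ (inner ℂ z (cmul S z)).re := by
  rw [re_inner_cmul, norm_sq_eq_reVec_imVec, mul_add]
  exact add_le_add (h _) (h _)

lemma re_inner_cmul_comm {S : Matrix ι ι ℝ} (hS : S.IsSymm) (z w : EuclideanSpace ℂ ι) :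
    (inner ℂ w (cmul S z)).re = (inner ℂ z (cmul S w)).re := by
  rw [inner_cmul_transpose, hS.eq, ← inner_conj_symm, Complex.conj_re]

lemma abs_dotProduct_mulVec_le (A : Matrix ι ι ℝ) (y : ι → ℝ) :
    |y ⬝ᵥ A *ᵥ y| ≤ entrySum A * (y ⬝ᵥ y) := by
  have hy : ∀ i j, |y i * y j| ≤ y ⬝ᵥ y := fun i j => by
    have hi : ∀ i, y i * y i ≤ y ⬝ᵥ y := fun i =>
      Finset.single_le_sum (f := fun i => y i * y i) (fun _ _ => mul_self_nonneg _)
        (Finset.mem_univ i)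
    rw [abs_le]
    constructor <;> nlinarith [hi i, hi j, sq_nonneg (y i + y j), sq_nonneg (y i - y j)]
  have h : y ⬝ᵥ A *ᵥ y = ∑ i, ∑ j, A i j * (y i * y j) := by
    simp only [dotProduct, Matrix.mulVec, Finset.mul_sum]
    exact Finset.sum_congr rfl fun i _ => Finset.sum_congr rfl fun j _ => by ring
  rw [h, entrySum, Finset.sum_mul]
  refine (Finset.abs_sum_le_sum_abs _ _).trans (Finset.sum_le_sum fun i _ => ?_)
  rw [Finset.sum_mul]
  refine (Finset.abs_sum_le_sum_abs _ _).trans (Finset.sum_le_sum fun j _ => ?_)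
  rw [abs_mul]
  gcongr
  exact hy i j

end Algebra

/-! ### Blocks -/

section Blocks

variable {n r : ℕ} {μ : Type*} [Fintype μ]

lemma ext_parts {𝕜 : Type*} {w w' : EuclideanSpace 𝕜 (Fin n ⊕ Fin r)}
    (h1 : uPart w = uPart w') (h2 : vPart w = vPart w') : w = w' := by
  ext i
  rcases i with i | i
  · exact congrArg (fun x : EuclideanSpace 𝕜 (Fin n) => x i) h1
  · exact congrArg (fun x : EuclideanSpace 𝕜 (Fin r) => x i) h2

lemma uPart_cmul (A : Matrix (Fin n ⊕ Fin r) μ ℝ) (w : EuclideanSpace ℂ μ) :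
    uPart (cmul A w) = cmul A.toRows₁ w := rfl

lemma vPart_cmul (A : Matrix (Fin n ⊕ Fin r) μ ℝ) (w : EuclideanSpace ℂ μ) :
    vPart (cmul A w) = cmul A.toRows₂ w := rfl

lemma cmul_fromCols {κ : Type*} (B₁ : Matrix κ (Fin n) ℝ) (B₂ : Matrix κ (Fin r) ℝ)
    (w : CState n r) : cmul (fromCols B₁ B₂) w = cmul B₁ (uPart w) + cmul B₂ (vPart w) := by
  ext i
  simp [cmul_apply, Fintype.sum_sum_type, uPart, vPart]

lemma uPart_add {𝕜 : Type*} [RCLike 𝕜] (w w' : EuclideanSpace 𝕜 (Fin n ⊕ Fin r)) :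
    uPart (w + w') = uPart w + uPart w' := rfl

lemma vPart_add {𝕜 : Type*} [RCLike 𝕜] (w w' : EuclideanSpace 𝕜 (Fin n ⊕ Fin r)) :
    vPart (w + w') = vPart w + vPart w' := rfl

lemma norm_sq_parts {𝕜 : Type*} [RCLike 𝕜] (w : EuclideanSpace 𝕜 (Fin n ⊕ Fin r)) :
    ‖w‖ ^ 2 = ‖uPart w‖ ^ 2 + ‖vPart w‖ ^ 2 := by
  simp [EuclideanSpace.norm_sq_eq, Fintype.sum_sum_type, uPart, vPart]

lemma norm_uPart_le {𝕜 : Type*} [RCLike 𝕜] (w : EuclideanSpace 𝕜 (Fin n ⊕ Fin r)) :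
    ‖uPart w‖ ≤ ‖w‖ :=
  le_of_sq_le_sq (by rw [norm_sq_parts w]; nlinarith [sq_nonneg ‖vPart w‖]) (norm_nonneg _)

lemma norm_vPart_le {𝕜 : Type*} [RCLike 𝕜] (w : EuclideanSpace 𝕜 (Fin n ⊕ Fin r)) :
    ‖vPart w‖ ≤ ‖w‖ :=
  le_of_sq_le_sq (by rw [norm_sq_parts w]; nlinarith [sq_nonneg ‖uPart w‖]) (norm_nonneg _)

lemma norm_le_parts {𝕜 : Type*} [RCLike 𝕜] (w : EuclideanSpace 𝕜 (Fin n ⊕ Fin r)) :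
    ‖w‖ ≤ ‖uPart w‖ + ‖vPart w‖ := by
  refine le_of_sq_le_sq ?_ (by positivity)
  rw [norm_sq_parts w]
  nlinarith [mul_nonneg (norm_nonneg (uPart w)) (norm_nonneg (vPart w))]

/-- The tangent map `u ↦ (u, -q₂⁻¹ q₁ u)` of the equilibrium manifold. -/
abbrev tangentMat (q₁ : Matrix (Fin r) (Fin n) ℝ) (qi : Matrix (Fin r) (Fin r) ℝ) :
    Matrix (Fin n ⊕ Fin r) (Fin n) ℝ := fromRows 1 (-(qi * q₁))

/-- The inclusion of the `v`-component, composed with a matrix. -/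
abbrev inclMat (n : ℕ) (B : Matrix (Fin r) (Fin r) ℝ) : Matrix (Fin n ⊕ Fin r) (Fin r) ℝ :=
  fromRows 0 B

/-- The conormal map `(u, v) ↦ q₂⁻¹ q₁ u + v` of the equilibrium manifold. -/
abbrev conormalMat (q₁ : Matrix (Fin r) (Fin n) ℝ) (qi : Matrix (Fin r) (Fin r) ℝ) :
    Matrix (Fin r) (Fin n ⊕ Fin r) ℝ := fromCols (qi * q₁) 1

/-- Splitting of a state into its equilibrium part and the part seen by the source. -/
lemma cmul_splitting {q₁ : Matrix (Fin r) (Fin n) ℝ} {q₂ qi : Matrix (Fin r) (Fin r) ℝ}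
    (hq : qi * q₂ = 1) (w : CState n r) :
    w = cmul (tangentMat q₁ qi) (uPart w)
      + cmul (inclMat n qi) (cmul (fromCols q₁ q₂) w) := by
  apply ext_parts
  · rw [uPart_add, uPart_cmul, uPart_cmul, toRows₁_fromRows, toRows₁_fromRows, one_cmul,
      zero_cmul, add_zero]
  · rw [vPart_add, vPart_cmul, vPart_cmul, toRows₂_fromRows, toRows₂_fromRows, cmul_fromCols,
      cmul_add, cmul_cmul, cmul_cmul, hq, one_cmul, neg_cmul]
    abel

end Blocks

/-! ### Pointwise energy inequality -/

section Pointwise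

variable {n r : ℕ}

/-- The source density `g = q₁ u + q₂ v` solves a resolvent equation for `q₂`. -/
lemma source_resolvent {J : Matrix (Fin n ⊕ Fin r) (Fin n ⊕ Fin r) ℝ}
    {q₁ : Matrix (Fin r) (Fin n) ℝ} {q₂ : Matrix (Fin r) (Fin r) ℝ}
    (hJ₁ : J.toRows₁ = 0) (hJ₂ : J.toRows₂ = fromCols q₁ q₂) {l : ℂ} {w y' : CState n r}
    (h : l • w + y' - cmul J w = 0) :
    l • cmul (fromCols q₁ q₂) w - cmul q₂ (cmul (fromCols q₁ q₂) w)
      = -cmul (fromCols q₁ q₂) y' := by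
  have h2 : l • w = cmul J w - y' := by rw [← sub_eq_zero, ← h]; abel
  rw [← cmul_smul, h2, cmul_sub, cmul_fromCols q₁ q₂ (cmul J w), uPart_cmul, vPart_cmul, hJ₁, hJ₂,
    zero_cmul, cmul_fromCols q₁ q₂ w]
  have h3 : cmul q₁ (0 : EuclideanSpace ℂ (Fin n)) = 0 := by
    ext i; simp [cmul_apply]
  rw [h3]
  abel

/-- Apply `q₂⁻¹` to the resolvent equation of `g`. The source density is traded for `l q₂⁻¹ g`,
which pairs with `l z`, and a derivative, which produces the viscosity after integration by parts.
-/
lemma source_expansion {J : Matrix (Fin n ⊕ Fin r) (Fin n ⊕ Fin r) ℝ}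
    {q₁ : Matrix (Fin r) (Fin n) ℝ} {q₂ qi : Matrix (Fin r) (Fin r) ℝ} (hq : qi * q₂ = 1)
    (hJ₁ : J.toRows₁ = 0) (hJ₂ : J.toRows₂ = fromCols q₁ q₂) {l : ℂ} {w y' : CState n r}
    (h : l • w + y' - cmul J w = 0) (B : Matrix (Fin n) (Fin r) ℝ) :
    cmul B (cmul (fromCols q₁ q₂) w) = l • cmul (B * qi) (cmul (fromCols q₁ q₂) w)
      + cmul (B * (conormalMat q₁ qi)) y' := by
  have h1 := source_resolvent hJ₁ hJ₂ h
  obtain ⟨g, hg⟩ : ∃ g, g = cmul (fromCols q₁ q₂) w := ⟨_, rfl⟩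
  rw [← hg] at h1 ⊢
  have h2 : l • cmul qi g - g = -(cmul (qi * q₁) (uPart y') + vPart y') := by
    have := congrArg (cmul qi) h1
    rwa [cmul_sub, cmul_smul, cmul_cmul, hq, one_cmul, cmul_neg, cmul_fromCols, cmul_add,
      cmul_cmul, cmul_cmul, hq, one_cmul] at this
  have h3 : g = l • cmul qi g + cmul (conormalMat q₁ qi) y' := by
    rw [cmul_fromCols, one_cmul, ← neg_neg (cmul (qi * q₁) (uPart y') + vPart y'), ← h2]
    abel
  conv_lhs => rw [h3]
  rw [cmul_add, cmul_smul, cmul_cmul, cmul_cmul]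

/-- The pointwise form of the energy estimate, before absorbing errors. -/
lemma energy_inequality {A J : Matrix (Fin n ⊕ Fin r) (Fin n ⊕ Fin r) ℝ}
    {q₁ : Matrix (Fin r) (Fin n) ℝ} {q₂ qi : Matrix (Fin r) (Fin r) ℝ} (hq : qi * q₂ = 1)
    (hJ₁ : J.toRows₁ = 0) (hJ₂ : J.toRows₂ = fromCols q₁ q₂)
    {S : Matrix (Fin n) (Fin n) ℝ} (hS : S.IsSymm) {a P' : Matrix (Fin n) (Fin n) ℝ} {H H' : Matrix (Fin n) (Fin n ⊕ Fin r) ℝ}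
    (hH : H = S * (A.toBlocks₁₂ * qi * (conormalMat q₁ qi))) {κ : ℝ}
    (hκ : ∀ y : Fin n → ℝ, -κ * (y ⬝ᵥ y) ≤
      y ⬝ᵥ (-(H * A * (tangentMat q₁ qi))) *ᵥ y)
    {l : ℂ} (hl : 0 ≤ l.re) {z : EuclideanSpace ℂ (Fin n)} {w y' : CState n r}
    (h : l • w + y' - cmul J w = 0) (hz : l • z + uPart (cmul A w) = 0) :
    l.re * (inner ℂ z (cmul S z)).re - (inner ℂ z (cmul P' z)).re / 2
      + ((inner ℂ z (cmul (S * a) (uPart w))).re + (inner ℂ z (cmul P' z)).re / 2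
        + (inner ℂ (uPart w) (cmul H (cmul A w))).re + (inner ℂ z (cmul H' (cmul A w))).re
        + (inner ℂ z (cmul H y')).re)
      ≤ entrySum (S * (A.toRows₁ * (tangentMat q₁ qi) - a)) * (‖z‖ * ‖uPart w‖)
        + 2 * entrySum (S * (A.toBlocks₁₂ * qi * qi)) * (l.re * ‖z‖ * ‖cmul J.toRows₂ w‖)
        + entrySum A.toRows₁ * entrySum (S * (A.toBlocks₁₂ * qi * qi))
          * (‖w‖ * ‖cmul J.toRows₂ w‖)
        + κ * ‖uPart w‖ ^ 2
        + entrySum (H * A * (inclMat n qi)) * (‖uPart w‖ * ‖cmul J.toRows₂ w‖)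
        + entrySum H' * entrySum A * (‖z‖ * ‖w‖) := by
  rw [hJ₂]
  obtain ⟨g, hg⟩ : ∃ g, g = cmul (fromCols q₁ q₂) w := ⟨_, rfl⟩
  obtain ⟨u, hu⟩ : ∃ u, u = uPart w := ⟨_, rfl⟩
  have hw := cmul_splitting (q₁ := q₁) hq w
  rw [← hu, ← hg] at hw
  rw [← hu, ← hg]
  have hAι : A.toRows₁ * (inclMat n qi) = A.toBlocks₁₂ * qi := by
    ext i j
    simp only [Matrix.mul_apply, Fintype.sum_sum_type, toBlocks₁₂, toRows₁_apply,
      fromRows_apply_inl, fromRows_apply_inr, Matrix.zero_apply, mul_zero, Finset.sum_const_zero,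
      zero_add, of_apply]
  have hy1 : uPart (cmul A w) = cmul (A.toRows₁ * (tangentMat q₁ qi)) u
      + cmul (A.toBlocks₁₂ * qi) g := by
    rw [uPart_cmul]
    conv_lhs => rw [hw]
    rw [cmul_add, cmul_cmul, cmul_cmul, hAι]
  have hexp := source_expansion hq hJ₁ hJ₂ h (A.toBlocks₁₂ * qi)
  rw [← hg] at hexp
  -- The integrated equation after applying the weight `S` and expanding the source part.
  have hSeq : l • cmul S z + cmul (S * (A.toRows₁ * (tangentMat q₁ qi))) u
      + (l • cmul (S * (A.toBlocks₁₂ * qi * qi)) g + cmul H y') = 0 := by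
    have := congrArg (cmul S) hz
    rw [hy1, hexp, cmul_add, cmul_add, cmul_add, cmul_smul, cmul_smul, cmul_cmul, cmul_cmul,
      cmul_cmul, ← hH] at this
    have h0 : cmul S (0 : EuclideanSpace ℂ (Fin n)) = 0 := by ext i; simp [cmul_apply]
    rw [h0] at this
    rw [← this]; abel
  have hI := congrArg (fun x => (inner ℂ z x).re) hSeq
  simp only [inner_add_right, inner_smul_right, Complex.add_re, inner_zero_right,
    Complex.zero_re] at hI
  have hSz : (l * inner ℂ z (cmul S z)).re = l.re * (inner ℂ z (cmul S z)).re
      - l.im * (inner ℂ z (cmul S z)).im := Complex.mul_re _ _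
  -- Writing `l = 2 Re l - conj l` and `conj l ⟨z, x⟩ = ⟨l z, x⟩ = -⟨(A w)_u, x⟩` removes `Im l`,
  -- which is not controlled by the left-hand side.
  have hflip : ∀ x : EuclideanSpace ℂ (Fin n), (l * inner ℂ z x).re =
      2 * l.re * (inner ℂ z x).re + (inner ℂ (uPart (cmul A w)) x).re := fun x => by
    have h1 : uPart (cmul A w) = -(l • z) := by
      rw [← sub_eq_zero, ← hz]; abel
    rw [h1, inner_neg_left, inner_smul_left]
    simp
    ring
  have hdiff : cmul (S * (A.toRows₁ * (tangentMat q₁ qi))) u = cmul (S * a) u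
      + cmul (S * (A.toRows₁ * (tangentMat q₁ qi) - a)) u := by
    rw [← add_cmul]; congr 1; rw [Matrix.mul_sub]; abel
  have hHy : cmul H (cmul A w) = cmul (H * A * (tangentMat q₁ qi)) u
      + cmul (H * A * (inclMat n qi)) g := by
    conv_lhs => rw [hw]
    rw [cmul_add, cmul_add, cmul_cmul, cmul_cmul, cmul_cmul, cmul_cmul, Matrix.mul_assoc,
      Matrix.mul_assoc]
  -- Here `-H A (1, -q₂⁻¹ q₁)` plays the role of `S b`: this is the viscous term, nonnegative up to
  -- the error `κ`.
  have hκu := le_re_inner_cmul hκ u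
  rw [neg_cmul, inner_neg_right, Complex.neg_re] at hκu
  have hSreal : (inner ℂ z (cmul S z)).im = 0 := by
    have h1 : inner ℂ z (cmul S z) = conj (inner ℂ z (cmul S z)) := by
      conv_lhs => rw [inner_cmul_transpose, hS.eq]
      rw [inner_conj_symm]
    exact Complex.conj_eq_iff_im.1 h1.symm
  have bnd : ∀ {ι κ : Type} [Fintype ι] [Fintype κ] (B : Matrix κ ι ℝ) (x : EuclideanSpace ℂ κ)
      (y : EuclideanSpace ℂ ι), |(inner ℂ x (cmul B y)).re| ≤ entrySum B * (‖x‖ * ‖y‖) :=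
    fun B x y => (Complex.abs_re_le_norm _).trans <| (norm_inner_le_norm _ _).trans <| by
      calc _ ≤ ‖x‖ * (entrySum B * ‖y‖) := by gcongr; exact norm_cmul_le _ _
        _ = _ := by ring
  have b1 := neg_le_of_abs_le (bnd (S * (A.toRows₁ * (tangentMat q₁ qi) - a)) z u)
  have b2 := neg_le_of_abs_le (bnd (S * (A.toBlocks₁₂ * qi * qi)) z g)
  have b3 := neg_le_of_abs_le (bnd (S * (A.toBlocks₁₂ * qi * qi)) (uPart (cmul A w)) g)
  have b4 := le_of_abs_le (bnd (H * A * (inclMat n qi)) u g)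
  have b5 := le_of_abs_le (bnd H' z (cmul A w))
  have b2' := mul_le_mul_of_nonneg_left b2 (mul_nonneg zero_le_two hl)
  have b3' : entrySum (S * (A.toBlocks₁₂ * qi * qi)) * (‖uPart (cmul A w)‖ * ‖g‖)
      ≤ entrySum A.toRows₁ * entrySum (S * (A.toBlocks₁₂ * qi * qi)) * (‖w‖ * ‖g‖) := by
    calc _ ≤ entrySum (S * (A.toBlocks₁₂ * qi * qi)) * (entrySum A.toRows₁ * ‖w‖ * ‖g‖) := by
          gcongr
          · exact entrySum_nonneg _
          · rw [uPart_cmul]; exact norm_cmul_le _ _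
      _ = _ := by ring
  have b5' : entrySum H' * (‖z‖ * ‖cmul A w‖) ≤ entrySum H' * entrySum A * (‖z‖ * ‖w‖) := by
    calc _ ≤ entrySum H' * (‖z‖ * (entrySum A * ‖w‖)) := by
          gcongr
          · exact entrySum_nonneg _
          · exact norm_cmul_le _ _
      _ = _ := by ring
  rw [hdiff, hSz, hSreal, hflip] at hI
  simp only [inner_add_right, Complex.add_re] at hI
  rw [hHy, inner_add_right, Complex.add_re]
  linarith

set_option maxHeartbeats 1000000 in
/-- Absorption of the error terms of the pointwise energy estimate. -/
lemma exists_absorption {C c : ℝ} (hC : 1 ≤ C) (hc : 0 < c) :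
    ∃ ε₁ : ℝ, 0 < ε₁ ∧ ε₁ ≤ 1 ∧ ∃ K : ℝ, 0 < K ∧ ∀ ε : ℝ, 0 < ε → ε ≤ ε₁ →
      ∀ Λ Z U G X Y p D : ℝ, 0 ≤ Λ → 0 ≤ Z → 0 ≤ U → 0 ≤ G → 0 ≤ X → 0 ≤ Y → 0 ≤ p →
        c * (Λ * Z ^ 2 + p * Z ^ 2) + D ≤
          C * (p * (Z * U) + Λ * Z * G + X * G + ε * U ^ 2 + U * G + p * (Z * X)) →
        G * (1 + Λ) ≤ C * (Y + p * X) → X ≤ C * (U + G) → p ≤ C * ε ^ 2 →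
        c / 2 * (Λ * Z ^ 2 + p * Z ^ 2) + D ≤ K * (ε * U ^ 2 + ε⁻¹ * Y ^ 2) := by
  set C4 := 3 * C ^ 4 with hC4
  -- The threshold makes `C² p ≤ 1/2`, which closes the circular bounds on `X` and `G`. The six
  -- summands of `K` are the Young constants of the six error terms, in the order in which these
  -- occur in the hypothesis.
  refine ⟨1 / (2 * C ^ 3), by positivity, ?_, 2 * C ^ 2 / c * C + C ^ 2 / (2 * c) * (2 * C4 ^ 2)
    + C / 2 * (8 * C ^ 4 + 2 * C4 ^ 2) + C + C / 2 * (1 + 2 * C4 ^ 2)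
    + 2 * C ^ 2 / c * (8 * C ^ 5), by positivity, ?_⟩
  · rw [div_le_one (by positivity)]
    nlinarith [one_le_pow₀ hC (n := 3)]
  intro ε hε hε1 Λ Z U G X Y p D hΛ hZ hU hG hX hY hp h hGY hXU hpε
  have hC0 : 0 < C := by linarith
  have hC3 : (1 : ℝ) ≤ C ^ 3 := one_le_pow₀ hC
  have hε3 : C ^ 3 * ε ≤ 1 / 2 := by
    calc C ^ 3 * ε ≤ C ^ 3 * (1 / (2 * C ^ 3)) := by gcongr
      _ = 1 / 2 := by field_simp
  have hεle : ε ≤ 1 := by nlinarith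
  have hεsq : ε ^ 2 ≤ ε := by nlinarith
  have hG1 : G ≤ C * (Y + p * X) := le_trans (by nlinarith) hGY
  -- The bound `X ≤ C (U + G)` involves `G`, which is bounded through `p X` again; the smallness of
  -- `p` closes the loop.
  have hCpX : C ^ 2 * (p * X) ≤ X / 2 := by
    calc C ^ 2 * (p * X) ≤ C ^ 2 * (C * ε ^ 2 * X) := by gcongr
      _ = C ^ 3 * ε * (ε * X) := by ring
      _ ≤ 1 / 2 * (1 * X) := by gcongr
      _ = X / 2 := by ring
  have hX1 : X ≤ 2 * C * U + 2 * C ^ 2 * Y := by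
    have : C * G ≤ C ^ 2 * Y + C ^ 2 * (p * X) := by
      calc C * G ≤ C * (C * (Y + p * X)) := by gcongr
        _ = _ := by ring
    linarith
  have hX2 : X ≤ 2 * C ^ 2 * (U + Y) := by
    have : C * U ≤ C ^ 2 * U := by gcongr; nlinarith
    linarith
  -- Decisive size of the source density: `G` is at most a constant times `Y + ε U`. Its square
  -- therefore survives division by `ε`.
  have hGX : C * (Y + p * X) ≤ C4 * (Y + ε * U) := by
    have h1 : p * X ≤ C * ε * (2 * C ^ 2 * (U + Y)) := by
      calc p * X ≤ (C * ε ^ 2) * (2 * C ^ 2 * (U + Y)) := by gcongr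
        _ ≤ (C * ε) * (2 * C ^ 2 * (U + Y)) := by gcongr
    have h2 : C * (Y + p * X) ≤ C * Y + 2 * C ^ 4 * (ε * U) + 2 * C ^ 4 * (ε * Y) := by
      calc _ ≤ C * (Y + C * ε * (2 * C ^ 2 * (U + Y))) := by gcongr
        _ = _ := by ring
    have h3 : C * Y ≤ C ^ 4 * Y := by
      gcongr
      calc C = C ^ 1 := by ring
        _ ≤ C ^ 4 := pow_le_pow_right₀ hC (by norm_num)
    have h5 : 2 * C ^ 4 * (ε * Y) ≤ 2 * C ^ 4 * (1 * Y) := by gcongr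
    have h6 : 0 ≤ C ^ 4 * (ε * U) := by positivity
    rw [hC4]; linarith
  set T := ε * U ^ 2 + ε⁻¹ * Y ^ 2 with hT
  have hεε : ε ≤ ε⁻¹ := hεle.trans ((one_le_inv₀ hε).2 hεle)
  have hεU : ε * U ^ 2 ≤ T := by rw [hT]; have : 0 ≤ ε⁻¹ * Y ^ 2 := by positivity
                                 linarith
  set Q := C4 * (Y + ε * U) with hQ
  have hQ0 : 0 ≤ Q := by positivity
  have hGQ : G ≤ Q := hG1.trans hGX
  have hGQ2 : G * (1 + Λ) ≤ Q := hGY.trans hGX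
  have hQT : ε⁻¹ * Q ^ 2 ≤ 2 * C4 ^ 2 * T := by
    have h1 : Q ^ 2 ≤ C4 ^ 2 * (2 * Y ^ 2 + 2 * (ε * U) ^ 2) := by
      rw [hQ, mul_pow]; gcongr; linarith [sq_nonneg (Y - ε * U)]
    calc ε⁻¹ * Q ^ 2 ≤ ε⁻¹ * (C4 ^ 2 * (2 * Y ^ 2 + 2 * (ε * U) ^ 2)) := by gcongr
      _ = 2 * C4 ^ 2 * T := by rw [hT]; field_simp; ring
  have hQ1 : Q ^ 2 ≤ 2 * C4 ^ 2 * T := by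
    refine le_trans ?_ hQT
    have := (one_le_inv₀ hε).2 hεle
    exact le_mul_of_one_le_left (sq_nonneg Q) this
  have hXT : ε * X ^ 2 ≤ 8 * C ^ 4 * T := by
    have h1 : X ^ 2 ≤ (2 * C ^ 2 * (U + Y)) ^ 2 := by gcongr
    have h2 : (U + Y) ^ 2 ≤ 2 * (U ^ 2 + Y ^ 2) := by
      have := sq_nonneg (U - Y)
      linarith
    calc ε * X ^ 2 ≤ ε * (2 * C ^ 2 * (U + Y)) ^ 2 := by gcongr
      _ = 4 * C ^ 4 * ε * (U + Y) ^ 2 := by ring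
      _ ≤ 4 * C ^ 4 * ε * (2 * (U ^ 2 + Y ^ 2)) := by gcongr
      _ = 8 * C ^ 4 * (ε * U ^ 2 + ε * Y ^ 2) := by ring
      _ ≤ 8 * C ^ 4 * T := by rw [hT]; gcongr
  have hpε' : p ≤ C * ε := hpε.trans (by gcongr)
  have hGT : ε⁻¹ * G ^ 2 ≤ 2 * C4 ^ 2 * T := le_trans (by gcongr) hQT
  have young : ∀ s x y : ℝ, 0 < s → x * y ≤ s * x ^ 2 + y ^ 2 / (4 * s) := fun s x y hs => by
    have : 0 ≤ (2 * s * x - y) ^ 2 / (4 * s) := by positivity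
    have e : (2 * s * x - y) ^ 2 / (4 * s) = s * x ^ 2 - x * y + y ^ 2 / (4 * s) := by
      field_simp; ring
    linarith
  have yε : ∀ x y : ℝ, x * y ≤ (ε * x ^ 2 + ε⁻¹ * y ^ 2) / 2 := fun x y => by
    have := young (ε / 2) x y (by positivity)
    have e : y ^ 2 / (4 * (ε / 2)) = ε⁻¹ * y ^ 2 / 2 := by field_simp; ring
    linarith
  have t1 : C * (p * (Z * U)) ≤ c / 8 * (p * Z ^ 2) + 2 * C ^ 2 / c * (C * T) := by
    have h1 := young (c / (8 * C)) Z U (by positivity)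
    have h2 : p * U ^ 2 ≤ C * T := by
      calc p * U ^ 2 ≤ C * ε * U ^ 2 := by gcongr
        _ = C * (ε * U ^ 2) := by ring
        _ ≤ C * T := by gcongr
    calc C * (p * (Z * U)) ≤ C * (p * (c / (8 * C) * Z ^ 2 + U ^ 2 / (4 * (c / (8 * C))))) := by
          gcongr
      _ = c / 8 * (p * Z ^ 2) + 2 * C ^ 2 / c * (p * U ^ 2) := by field_simp; ring
      _ ≤ _ := by gcongr
  have t6 : C * (p * (Z * X)) ≤ c / 8 * (p * Z ^ 2) + 2 * C ^ 2 / c * (8 * C ^ 5 * T) := by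
    have h1 := young (c / (8 * C)) Z X (by positivity)
    have h2 : p * X ^ 2 ≤ 8 * C ^ 5 * T := by
      calc p * X ^ 2 ≤ C * ε * X ^ 2 := by gcongr
        _ = C * (ε * X ^ 2) := by ring
        _ ≤ C * (8 * C ^ 4 * T) := by gcongr
        _ = _ := by ring
    calc C * (p * (Z * X)) ≤ C * (p * (c / (8 * C) * Z ^ 2 + X ^ 2 / (4 * (c / (8 * C))))) := by
          gcongr
      _ = c / 8 * (p * Z ^ 2) + 2 * C ^ 2 / c * (p * X ^ 2) := by field_simp; ring
      _ ≤ _ := by gcongr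
  -- The factor `1 + Λ` in the bound for `G` is needed here: `Λ G² ≤ (G (1 + Λ))²`, uniformly in
  -- `Λ`.
  have t2 : C * (Λ * Z * G) ≤ c / 2 * (Λ * Z ^ 2) + C ^ 2 / (2 * c) * (2 * C4 ^ 2 * T) := by
    have h1 := young (c / (2 * C)) Z G (by positivity)
    have h2 : Λ * G ^ 2 ≤ 2 * C4 ^ 2 * T := by
      refine le_trans ?_ hQ1
      have e : (G * (1 + Λ)) ^ 2 = Λ * G ^ 2 + (G ^ 2 + Λ * G ^ 2 + (Λ * G) ^ 2) := by ring
      have e' : 0 ≤ G ^ 2 + Λ * G ^ 2 + (Λ * G) ^ 2 := by positivity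
      have e2 : (G * (1 + Λ)) ^ 2 ≤ Q ^ 2 := by gcongr
      linarith
    calc C * (Λ * Z * G) = C * (Λ * (Z * G)) := by ring
      _ ≤ C * (Λ * (c / (2 * C) * Z ^ 2 + G ^ 2 / (4 * (c / (2 * C))))) := by gcongr
      _ = c / 2 * (Λ * Z ^ 2) + C ^ 2 / (2 * c) * (Λ * G ^ 2) := by field_simp; ring
      _ ≤ _ := by gcongr
  have t3 : C * (X * G) ≤ C / 2 * (8 * C ^ 4 + 2 * C4 ^ 2) * T := by
    calc C * (X * G) ≤ C * ((8 * C ^ 4 * T + 2 * C4 ^ 2 * T) / 2) := by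
          gcongr; linarith [yε X G]
      _ = _ := by ring
  have t5 : C * (U * G) ≤ C / 2 * (1 + 2 * C4 ^ 2) * T := by
    calc C * (U * G) ≤ C * ((T + 2 * C4 ^ 2 * T) / 2) := by
          gcongr; linarith [yε U G]
      _ = _ := by ring
  have t4 : C * (ε * U ^ 2) ≤ C * T := by gcongr
  have hpZ : 0 ≤ c * (p * Z ^ 2) := by positivity
  linarith

end Pointwise

/-! ### Locally absolutely continuous functions -/

section AbsCont

variable {E : Type*} [NormedAddCommGroup E]

/-- Absolute continuity on every bounded interval. -/
def LocAC (f : ℝ → E) : Prop := ∀ a b, AbsolutelyContinuousOnInterval f a b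

lemma LocAC.continuous {f : ℝ → E} (hf : LocAC f) : Continuous f := by
  rw [continuous_iff_continuousAt]
  intro x
  have h := (hf (x - 1) (x + 1)).continuousOn
  rw [Set.uIcc_of_le (by linarith)] at h
  exact h.continuousAt (Icc_mem_nhds (by linarith) (by linarith))

lemma LocAC.add {f g : ℝ → E} (hf : LocAC f) (hg : LocAC g) : LocAC (fun x => f x + g x) :=
  fun a b => (hf a b).fun_add (hg a b)

lemma LocAC.sum {ι : Type*} (s : Finset ι) {f : ι → ℝ → E} (hf : ∀ i, LocAC (f i)) :
    LocAC (fun x => ∑ i ∈ s, f i x) := by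
  classical
  induction s using Finset.induction_on with
  | empty =>
    simp only [Finset.sum_empty]
    exact fun a b => (contDiff_const (𝕜 := ℝ) (n := 1) (c := (0 : ℝ))).contDiffOn
      |>.absolutelyContinuousOnInterval |> fun h => by
        simpa [AbsolutelyContinuousOnInterval] using h
  | insert i s hi ih =>
    simp only [Finset.sum_insert hi]
    exact (hf i).add ih

lemma LocAC.mono_dist {F : Type*} [NormedAddCommGroup F] {f : ℝ → E} {g : ℝ → F} (hg : LocAC g)
    (h : ∀ x y, ‖f x - f y‖ ≤ ‖g x - g y‖) : LocAC f := by
  intro a b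
  unfold AbsolutelyContinuousOnInterval at *
  refine squeeze_zero (fun t => Finset.sum_nonneg fun _ _ => dist_nonneg) (fun t => ?_) (hg a b)
  gcongr
  rw [dist_eq_norm, dist_eq_norm]
  exact h _ _

/-- Absolute continuity of a bounded bilinear expression. -/
lemma LocAC.bilin {F G : Type*} [NormedAddCommGroup F] [NormedAddCommGroup G] {f : ℝ → E}
    {g : ℝ → F} (hf : LocAC f) (hg : LocAC g) (B : E → F → G)
    (h1 : ∀ x x' y, ‖B x y - B x' y‖ ≤ ‖x - x'‖ * ‖y‖)
    (h2 : ∀ x y y', ‖B x y - B x y'‖ ≤ ‖x‖ * ‖y - y'‖) : LocAC (fun x => B (f x) (g x)) := by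
  intro a b
  obtain ⟨C, hC⟩ := (hf a b).exists_bound
  obtain ⟨D, hD⟩ := (hg a b).exists_bound
  have hf' := hf a b
  have hg' := hg a b
  unfold AbsolutelyContinuousOnInterval at hf' hg' ⊢
  refine squeeze_zero' ?_ ?_ (by simpa using (hg'.const_mul C).add (hf'.const_mul D))
  · exact Eventually.of_forall fun _ => Finset.sum_nonneg fun i _ => dist_nonneg
  rw [eventually_inf_principal]
  filter_upwards with ⟨m, I⟩ hI
  simp only [Finset.mul_sum, ← Finset.sum_add_distrib]
  gcongr with i hi
  have hi' := hI.1 i hi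
  refine (dist_triangle _ (B (f (I i).1) (g (I i).2)) _).trans ?_
  simp only [dist_eq_norm]
  gcongr
  · exact (h2 _ _ _).trans (by gcongr; exact hC _ hi'.1)
  · exact (h1 _ _ _).trans (by rw [mul_comm]; gcongr; exact hD _ hi'.2)

lemma LocAC.of_contDiff [NormedSpace ℝ E] {f : ℝ → E} (hf : ContDiff ℝ 1 f) : LocAC f :=
  fun _ _ => hf.contDiffOn.absolutelyContinuousOnInterval

/-- The increments of `f` are dominated by those of the real primitive of `‖f'‖`, which is
absolutely continuous. -/
lemma LocAC.of_integral [NormedSpace ℝ E] {f f' : ℝ → E} (hf' : LocallyIntegrable f' volume)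
    (h : ∀ a b : ℝ, ∫ x in a..b, f' x = f b - f a) : LocAC f := by
  have hI : ∀ a b, IntervalIntegrable f' volume a b := fun a b =>
    (hf'.integrableOn_isCompact isCompact_uIcc).intervalIntegrable
  have hN : ∀ a b, IntervalIntegrable (fun x => ‖f' x‖) volume a b := fun a b => (hI a b).norm
  intro a b
  have hg := (hN a b).absolutelyContinuousOnInterval_intervalIntegral (c := a) (by simp)
  unfold AbsolutelyContinuousOnInterval at *
  refine squeeze_zero (fun t => Finset.sum_nonneg fun _ _ => dist_nonneg) (fun t => ?_) hg
  gcongr with i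
  rw [dist_eq_norm, dist_eq_norm, ← h, intervalIntegral.integral_interval_sub_left (hN _ _) (hN _ _),
    Real.norm_eq_abs]
  exact intervalIntegral.norm_integral_le_abs_integral_norm

lemma ae_hasDerivAt_of_integral [NormedSpace ℝ E] [CompleteSpace E] {f f' : ℝ → E}
    (hf' : LocallyIntegrable f' volume)
    (h : ∀ a b : ℝ, ∫ x in a..b, f' x = f b - f a) : ∀ᵐ x, HasDerivAt f (f' x) x := by
  filter_upwards [_root_.LocallyIntegrable.ae_hasDerivAt_integral hf'] with x hx
  have := (hx 0).add_const (f 0)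
  simpa [h] using this

/-- An integrable derivative gives `φ` limits at both ends; integrability of `φ` on half-lines of
infinite measure forces these limits to vanish. -/
lemma LocAC.tendsto_zero {φ φ' : ℝ → ℝ} (hφ : LocAC φ) (hφ' : ∀ᵐ x, HasDerivAt φ (φ' x) x)
    (hi : Integrable φ) (hi' : Integrable φ') :
    Tendsto φ atTop (𝓝 0) ∧ Tendsto φ atBot (𝓝 0) := by
  have hd : deriv φ =ᵐ[volume] φ' := by
    filter_upwards [hφ'] with x hx using hx.deriv
  have hint : ∀ x, φ x = φ 0 + ∫ t in (0 : ℝ)..x, φ' t := fun x => by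
    rw [← intervalIntegral.integral_congr_ae (hd.mono fun x hx _ => hx),
      (hφ 0 x).integral_deriv_eq_sub]
    ring
  constructor
  · have h1 : Tendsto φ atTop (𝓝 (φ 0 + ∫ t in Set.Ioi (0 : ℝ), φ' t)) := by
      have := (intervalIntegral_tendsto_integral_Ioi 0 hi'.integrableOn tendsto_id).const_add (φ 0)
      exact this.congr fun x => (hint x).symm
    have h2 := IntegrableAtFilter.eq_zero_of_tendsto (μ := volume) (hi.integrableAtFilter atTop)
      (fun s hs => by
        obtain ⟨a, ha⟩ := mem_atTop_sets.1 hs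
        refine top_le_iff.1 ?_
        rw [← Real.volume_Ici (a := a)]
        exact measure_mono fun x hx => ha x hx) h1
    rwa [h2] at h1
  · have h1 : Tendsto φ atBot (𝓝 (φ 0 - ∫ t in Set.Iic (0 : ℝ), φ' t)) := by
      have := (intervalIntegral_tendsto_integral_Iic 0 hi'.integrableOn tendsto_id).const_sub (φ 0)
      refine this.congr fun x => ?_
      rw [hint x, intervalIntegral.integral_symm]
      simp
    have h2 := IntegrableAtFilter.eq_zero_of_tendsto (μ := volume) (hi.integrableAtFilter atBot)
      (fun s hs => by
        obtain ⟨a, ha⟩ := mem_atBot_sets.1 hs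
        refine top_le_iff.1 ?_
        rw [← Real.volume_Iic (a := a)]
        exact measure_mono fun x hx => ha x hx) h1
    rwa [h2] at h1

/-- Integration of a differential inequality over the line. -/
lemma LocAC.integral_le {h h' f e : ℝ → ℝ} (hh : LocAC h) (hh' : ∀ᵐ x, HasDerivAt h (h' x) x)
    (hf : Integrable f) (he : Integrable e) (hle : ∀ᵐ x, f x + h' x ≤ e x)
    (htop : Tendsto h atTop (𝓝 0)) (hbot : Tendsto h atBot (𝓝 0)) : ∫ x, f x ≤ ∫ x, e x := by
  have key : ∀ R : ℝ, 0 ≤ R →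
      (∫ x in (-R)..R, f x) + (h R - h (-R)) ≤ ∫ x in (-R)..R, e x := fun R hR => by
    rw [← (hh (-R) R).integral_deriv_eq_sub, ← intervalIntegral.integral_add
      hf.intervalIntegrable (hh _ _).intervalIntegrable_deriv]
    refine intervalIntegral.integral_mono_ae (by linarith)
      (hf.intervalIntegrable.add (hh _ _).intervalIntegrable_deriv) he.intervalIntegrable ?_
    filter_upwards [hh', hle] with x hx hx'
    rw [hx.deriv]; exact hx'
  have t1 := intervalIntegral_tendsto_integral hf tendsto_neg_atTop_atBot tendsto_id
  have t2 := intervalIntegral_tendsto_integral he tendsto_neg_atTop_atBot tendsto_id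
  have t3 := htop.sub (hbot.comp tendsto_neg_atTop_atBot)
  rw [sub_zero] at t3
  have t4 := t1.add t3
  rw [add_zero] at t4
  refine le_of_tendsto_of_tendsto t4 t2 ?_
  filter_upwards [eventually_ge_atTop 0] with R hR
  exact key R hR

end AbsCont

/-! ### Absolute continuity and derivatives of vector-valued expressions -/

section Vector

variable {ι κ : Type*} [Fintype ι] [Fintype κ]

lemma LocAC.coord {f : ℝ → EuclideanSpace ℂ ι} (hf : LocAC f) (i : ι) :
    LocAC (fun x => f x i) :=
  hf.mono_dist fun x y => by simpa using PiLp.norm_apply_le (f x - f y) i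

lemma LocAC.of_coord {f : ℝ → EuclideanSpace ℂ ι} (hf : ∀ i, LocAC (fun x => f x i)) :
    LocAC f := by
  classical
  have h : f = fun x => ∑ i, (f x i) • EuclideanSpace.single i (1 : ℂ) := by
    funext x; ext j
    simp [Finset.sum_apply, Pi.single_apply]
  rw [h]
  refine LocAC.sum _ fun i => (hf i).mono_dist fun x y => ?_
  rw [← sub_smul, norm_smul]
  simp

lemma LocAC.cmul {A : ℝ → Matrix κ ι ℝ} (hA : ∀ i j, LocAC (fun x => A x i j))
    {w : ℝ → EuclideanSpace ℂ ι} (hw : LocAC w) :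
    LocAC (fun x => RelaxationShock.cmul (A x) (w x)) := by
  refine LocAC.of_coord fun i => ?_
  simp only [cmul_apply]
  refine LocAC.sum _ fun j => ?_
  refine (hA i j).bilin (hw.coord j) (fun a b => (a : ℂ) * b) (fun x x' y => ?_) fun x y y' => ?_
  · rw [← sub_mul, ← Complex.ofReal_sub, norm_mul, Complex.norm_real]
  · rw [← mul_sub, norm_mul, Complex.norm_real]

lemma LocAC.re_inner {z w : ℝ → EuclideanSpace ℂ ι} (hz : LocAC z) (hw : LocAC w) :
    LocAC (fun x => (inner ℂ (z x) (w x)).re) := by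
  refine hz.bilin hw (fun a b => (inner ℂ a b).re) (fun x x' y => ?_) fun x y y' => ?_
  · rw [← Complex.sub_re, ← inner_sub_left]
    exact (Complex.abs_re_le_norm _).trans (norm_inner_le_norm _ _)
  · rw [← Complex.sub_re, ← inner_sub_right]
    exact (Complex.abs_re_le_norm _).trans (norm_inner_le_norm _ _)

lemma hasDerivAt_coord_iff {f : ℝ → EuclideanSpace ℂ ι} {f' : EuclideanSpace ℂ ι} {x : ℝ} :
    HasDerivAt f f' x ↔ ∀ i, HasDerivAt (fun y => f y i) (f' i) x := by
  have h := ((PiLp.continuousLinearEquiv 2 ℝ (fun _ : ι => ℂ)).comp_hasFDerivAt_iff (f := f)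
    (f' := ContinuousLinearMap.smulRight (1 : ℝ →L[ℝ] ℝ) f') (x := x))
  have h2 : HasDerivAt (fun y => (f y).ofLp) f'.ofLp x ↔ HasDerivAt f f' x := by
    rw [hasDerivAt_iff_hasFDerivAt, hasDerivAt_iff_hasFDerivAt]
    refine Iff.trans ?_ h
    rfl
  rw [← h2, hasDerivAt_pi]

lemma HasDerivAt.cmul {A : ℝ → Matrix κ ι ℝ} {A' : Matrix κ ι ℝ} {x : ℝ}
    (hA : ∀ i j, HasDerivAt (fun y => A y i j) (A' i j) x)
    {w : ℝ → EuclideanSpace ℂ ι} {w' : EuclideanSpace ℂ ι} (hw : HasDerivAt w w' x) :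
    HasDerivAt (fun y => RelaxationShock.cmul (A y) (w y))
      (RelaxationShock.cmul A' (w x) + RelaxationShock.cmul (A x) w') x := by
  rw [hasDerivAt_coord_iff] at hw ⊢
  intro i
  have h := HasDerivAt.fun_sum (u := Finset.univ) fun j _ =>
    ((hA i j).ofReal_comp).mul (hw j)
  simp only [cmul_apply, PiLp.add_apply, ← Finset.sum_add_distrib]
  exact h

lemma HasDerivAt.re_inner {z w : ℝ → EuclideanSpace ℂ ι} {z' w' : EuclideanSpace ℂ ι} {x : ℝ}
    (hz : HasDerivAt z z' x) (hw : HasDerivAt w w' x) :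
    HasDerivAt (fun y => (inner ℂ (z y) (w y)).re)
      ((inner ℂ (z x) w').re + (inner ℂ z' (w x)).re) x := by
  have := (hz.inner ℂ hw)
  have h2 := Complex.reCLM.hasFDerivAt.comp_hasDerivAt x this
  simp only [Complex.reCLM_apply, Complex.add_re] at h2
  exact h2

lemma integrable_re_inner {f g : ℝ → EuclideanSpace ℂ ι} (hf : MemLp f 2 volume)
    (hg : MemLp g 2 volume) : Integrable (fun x => (inner ℂ (f x) (g x)).re) := by
  have h1 := (memLp_two_iff_integrable_sq_norm hf.1).1 hf
  have h2 := (memLp_two_iff_integrable_sq_norm hg.1).1 hg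
  have hm : AEStronglyMeasurable (fun x => (inner ℂ (f x) (g x)).re) volume :=
    Complex.continuous_re.comp_aestronglyMeasurable (hf.1.inner hg.1)
  refine (h1.add h2).mono' hm (Eventually.of_forall fun x => ?_)
  refine ((Complex.abs_re_le_norm _).trans (norm_inner_le_norm _ _)).trans ?_
  simp only [Pi.add_apply]
  nlinarith [sq_nonneg (‖f x‖ - ‖g x‖), sq_nonneg (‖f x‖ + ‖g x‖)]

end Vector

/-! ### Decay of functions in `H¹(ℝ)` -/

section H1

variable {n r : ℕ} {w : ℝ → CState n r}

lemma MemH1.locallyIntegrable_deriv (hw : MemH1 w) : LocallyIntegrable (deriv w) volume :=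
  hw.memLp_deriv.locallyIntegrable (by norm_num)

lemma MemH1.locAC (hw : MemH1 w) : LocAC w :=
  LocAC.of_integral hw.locallyIntegrable_deriv hw.integral_deriv

lemma MemH1.ae_hasDerivAt (hw : MemH1 w) : ∀ᵐ x, HasDerivAt w (deriv w x) x :=
  ae_hasDerivAt_of_integral hw.locallyIntegrable_deriv hw.integral_deriv

/-- By Cauchy-Schwarz, `|w|²` and its derivative `2 Re⟨w, w'⟩` are both integrable, so
`LocAC.tendsto_zero` applies. -/
lemma MemH1.tendsto_norm_zero (hw : MemH1 w) :
    Tendsto (fun x => ‖w x‖) atTop (𝓝 0) ∧ Tendsto (fun x => ‖w x‖) atBot (𝓝 0) := by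
  have h := LocAC.tendsto_zero (φ := fun x => (inner ℂ (w x) (w x)).re)
    (φ' := fun x => (inner ℂ (w x) (deriv w x)).re + (inner ℂ (deriv w x) (w x)).re)
    (hw.locAC.re_inner hw.locAC) (hw.ae_hasDerivAt.mono fun x hx => HasDerivAt.re_inner hx hx) ?_ ?_
  · have e : ∀ x, (inner ℂ (w x) (w x)).re = ‖w x‖ ^ 2 := fun x => by
      rw [inner_self_eq_norm_sq_to_K]; norm_cast
    simp only [e] at h
    have hs : ∀ {F : Filter ℝ}, Tendsto (fun x => ‖w x‖ ^ 2) F (𝓝 0) →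
        Tendsto (fun x => ‖w x‖) F (𝓝 0) := fun hF => by
      have := (Real.continuous_sqrt.tendsto 0).comp hF
      simpa [Function.comp_def, Real.sqrt_sq] using this
    exact ⟨hs h.1, hs h.2⟩
  · exact integrable_re_inner hw.memLp hw.memLp
  · exact (integrable_re_inner hw.memLp hw.memLp_deriv).add
      (integrable_re_inner hw.memLp_deriv hw.memLp)

end H1

/-! ### The integrated energy estimate -/

section Energy

variable {n r : ℕ}

/-- Coefficients along a profile for which the weighted energy estimate can be carried out:
`A`, `J` are the Jacobians of the flux and of the source, `qi = q₂⁻¹`, `S` is the weight,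
`a` the relaxed Jacobian, `H` the weight of the derivative terms and `p` the size of the
derivative of the profile. -/
structure IsEnergyWeight (C c ε : ℝ) (A A' J : ℝ → Matrix (Fin n ⊕ Fin r) (Fin n ⊕ Fin r) ℝ)
    (q₁ : ℝ → Matrix (Fin r) (Fin n) ℝ) (q₂ qi : ℝ → Matrix (Fin r) (Fin r) ℝ)
    (S a P' : ℝ → Matrix (Fin n) (Fin n) ℝ) (H H' : ℝ → Matrix (Fin n) (Fin n ⊕ Fin r) ℝ)
    (p : ℝ → ℝ) : Prop where
  inv : ∀ x, qi x * q₂ x = 1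
  J_fst : ∀ x, (J x).toRows₁ = 0
  J_snd : ∀ x, (J x).toRows₂ = fromCols (q₁ x) (q₂ x)
  symm : ∀ x, (S x).IsSymm
  H_eq : ∀ x, H x = S x * ((A x).toBlocks₁₂ * qi x * conormalMat (q₁ x) (qi x))
  contDiff_A : ∀ i j, ContDiff ℝ 1 fun x => A x i j
  contDiff_P : ∀ i j, ContDiff ℝ 1 fun x => (S x * a x) i j
  contDiff_H : ∀ i j, ContDiff ℝ 1 fun x => H x i j
  deriv_A : ∀ x i j, HasDerivAt (fun y => A y i j) (A' x i j) x
  deriv_P : ∀ x i j, HasDerivAt (fun y => (S y * a y) i j) (P' x i j) x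
  deriv_H : ∀ x i j, HasDerivAt (fun y => H y i j) (H' x i j) x
  P_symm : ∀ x, (S x * a x).IsSymm
  p_nonneg : ∀ x, 0 ≤ p x
  p_le : ∀ x, p x ≤ C * ε ^ 2
  p_cont : Continuous p
  A_le : ∀ x, entrySum (A x) ≤ C
  P_le : ∀ x, entrySum (S x * a x) ≤ C
  H_le : ∀ x, entrySum (H x) ≤ C
  coercive_S : ∀ x (y : Fin n → ℝ), c * (y ⬝ᵥ y) ≤ y ⬝ᵥ S x *ᵥ y
  coercive_P' : ∀ x (y : Fin n → ℝ), 2 * c * p x * (y ⬝ᵥ y) ≤ y ⬝ᵥ (-P' x) *ᵥ y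
  viscous : ∀ x (y : Fin n → ℝ), -(C * ε) * (y ⬝ᵥ y) ≤
      y ⬝ᵥ (-(H x * A x * tangentMat (q₁ x) (qi x))) *ᵥ y
  offEquilibrium : ∀ x,
    entrySum (S x * ((A x).toRows₁ * tangentMat (q₁ x) (qi x) - a x)) ≤ C * p x
  bound_B : ∀ x, 2 * entrySum (S x * ((A x).toBlocks₁₂ * qi x * qi x)) ≤ C
  bound_AB : ∀ x,
    entrySum (A x).toRows₁ * entrySum (S x * ((A x).toBlocks₁₂ * qi x * qi x)) ≤ C
  bound_HA : ∀ x, entrySum (H x * A x * inclMat n (qi x)) ≤ C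
  bound_H'A : ∀ x, entrySum (H' x) * entrySum (A x) ≤ C * p x
  resolvent : ∀ x (l : ℂ), 0 ≤ l.re → ∀ y : EuclideanSpace ℂ (Fin r),
    ‖y‖ * (1 + ‖l‖) ≤ C * ‖l • y - cmul (q₂ x) y‖
  bound_source : ∀ x,
    C * (entrySum (fromCols (q₁ x) (q₂ x)) * entrySum (A' x)) ≤ C ^ 4 * p x
  bound_source' : ∀ x, entrySum (fromCols (q₁ x) (q₂ x)) * entrySum (A x) ≤ C ^ 3
  bound_tangent : ∀ x, entrySum (tangentMat (q₁ x) (qi x)) ≤ C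
  bound_incl : ∀ x, entrySum (inclMat n (qi x)) ≤ C

lemma toRows₁_entrySum_le (A : Matrix (Fin n ⊕ Fin r) (Fin n ⊕ Fin r) ℝ) :
    entrySum A.toRows₁ ≤ entrySum A := by
  unfold entrySum
  rw [Fintype.sum_sum_type]
  exact le_add_of_nonneg_right
    (Finset.sum_nonneg fun _ _ => Finset.sum_nonneg fun _ _ => abs_nonneg _)

lemma hasDerivAt_uPart {f : ℝ → CState n r} {f' : CState n r} {x : ℝ} (h : HasDerivAt f f' x) :
    HasDerivAt (fun y => uPart (f y)) (uPart f') x :=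
  hasDerivAt_coord_iff.2 fun i => hasDerivAt_coord_iff.1 h (Sum.inl i)

lemma locAC_uPart {f : ℝ → CState n r} (h : LocAC f) : LocAC (fun y => uPart (f y)) :=
  LocAC.of_coord fun i => h.coord (Sum.inl i)

variable {C c ε : ℝ} {A A' J : ℝ → Matrix (Fin n ⊕ Fin r) (Fin n ⊕ Fin r) ℝ}
    {q₁ : ℝ → Matrix (Fin r) (Fin n) ℝ} {q₂ qi : ℝ → Matrix (Fin r) (Fin r) ℝ}
    {S a P' : ℝ → Matrix (Fin n) (Fin n) ℝ} {H H' : ℝ → Matrix (Fin n) (Fin n ⊕ Fin r) ℝ}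
    {p : ℝ → ℝ}

/-- An absolutely continuous function with continuous almost everywhere derivative is an
integral of it. -/
lemma LocAC.eq_integral_of_continuous {E : Type*} [NormedAddCommGroup E] [NormedSpace ℝ E]
    [CompleteSpace E] {z u : ℝ → E} (hz : LocAC z) (hu : Continuous u)
    (h : ∀ᵐ x, HasDerivAt z (u x) x) (a b : ℝ) : ∫ x in a..b, u x = z b - z a := by
  have hU : ∀ x, HasDerivAt (fun y => ∫ t in a..y, u t) (u x) x := fun x =>
    hu.integral_hasStrictDerivAt a x |>.hasDerivAt
  have hUc : ContDiff ℝ 1 (fun y => ∫ t in a..y, u t) := by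
    rw [contDiff_one_iff_deriv]
    refine ⟨fun x => (hU x).differentiableAt, ?_⟩
    rw [show deriv (fun y => ∫ t in a..y, u t) = u from funext fun x => (hU x).deriv]
    exact hu
  have hac : AbsolutelyContinuousOnInterval (fun y => z y - ∫ t in a..y, u t) a b :=
    (hz a b).fun_sub (LocAC.of_contDiff hUc a b)
  obtain ⟨c, hc⟩ := hac.const_of_ae_hasDerivAt_zero (h.mono fun x hx _ => by
    simpa using hx.fun_sub (hU x))
  have h1 := hc a (by simp)
  have h2 := hc b (by simp)
  rw [intervalIntegral.integral_same, sub_zero] at h1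
  rw [h1, ← h2]
  abel

/-- The primitive of the conserved part of a solution of the resolvent equation. -/
lemma IsEnergyWeight.exists_primitive (hw : IsEnergyWeight C c ε A A' J q₁ q₂ qi S a P' H H' p)
    {l : ℂ} (hl : l ≠ 0) {w : ℝ → CState n r} (hw1 : MemH1 w)
    (heq : ∀ᵐ x, l • w x + deriv (fun y => cmul (A y) (w y)) x - cmul (J x) (w x) = 0) :
    ∃ z : ℝ → EuclideanSpace ℂ (Fin n), IsIntegratedFromBot (fun x => uPart (w x)) z ∧
      MemLp z 2 volume ∧ LocAC z ∧ (∀ x, HasDerivAt z (uPart (w x)) x) ∧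
      (∀ x, l • z x + uPart (cmul (A x) (w x)) = 0) ∧
      Tendsto (fun x => ‖z x‖) atTop (𝓝 0) ∧ Tendsto (fun x => ‖z x‖) atBot (𝓝 0) := by
  have hwc := hw1.locAC.continuous
  have hAw : LocAC (fun y => cmul (A y) (w y)) :=
    LocAC.cmul (fun i j => LocAC.of_contDiff (hw.contDiff_A i j)) hw1.locAC
  -- The integrated equation `l z + (A w)_u = 0` is taken as the definition of `z`; that `z` is a
  -- primitive of `u` vanishing at `-∞` is derived from it.
  set z : ℝ → EuclideanSpace ℂ (Fin n) := fun x => (-l⁻¹) • uPart (cmul (A x) (w x)) with hz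
  have hzac : LocAC z := fun a b => (locAC_uPart hAw a b).const_smul (-l⁻¹)
  have hle : ∀ x, ‖z x‖ ≤ ‖l⁻¹‖ * C * ‖w x‖ := fun x => by
    rw [hz]
    simp only [norm_smul, norm_neg, mul_assoc]
    gcongr
    exact (norm_uPart_le _).trans ((norm_cmul_le _ _).trans (by gcongr; exact hw.A_le x))
  have huc : Continuous fun x => uPart (w x) := (locAC_uPart hw1.locAC).continuous
  have hzd : ∀ᵐ x, HasDerivAt z (uPart (w x)) x := by
    filter_upwards [heq, hw1.ae_hasDerivAt] with x hx hwx
    have hd := HasDerivAt.cmul (hw.deriv_A x) hwx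
    rw [hd.deriv] at hx
    have h1 := (hasDerivAt_uPart hd).const_smul (-l⁻¹)
    convert! h1 using 1
    have h2 := congrArg uPart hx
    rw [sub_eq_add_neg, uPart_add, uPart_add] at h2
    have h3 : uPart (-cmul (J x) (w x)) = 0 := by
      rw [← cmul_neg, uPart_cmul, hw.J_fst, zero_cmul]
    have h4 : uPart (l • w x) = l • uPart (w x) := rfl
    have h5 : uPart (0 : CState n r) = 0 := rfl
    rw [h3, h4, h5, add_zero] at h2
    rw [eq_neg_of_add_eq_zero_right h2, smul_neg, neg_smul, neg_neg, smul_smul,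
      inv_mul_cancel₀ hl, one_smul]
  have hint := hzac.eq_integral_of_continuous huc hzd
  have hlim : ∀ {F : Filter ℝ}, Tendsto (fun x => ‖w x‖) F (𝓝 0) →
      Tendsto (fun x => ‖z x‖) F (𝓝 0) := fun hF =>
    squeeze_zero (fun _ => norm_nonneg _) hle (by simpa using hF.const_mul (‖l⁻¹‖ * C))
  refine ⟨z, fun x => ?_, ?_, hzac, fun x => ?_, fun x => ?_, hlim hw1.tendsto_norm_zero.1,
    hlim hw1.tendsto_norm_zero.2⟩
  · simp only [hint]
    have := (tendsto_zero_iff_norm_tendsto_zero.2 (hlim hw1.tendsto_norm_zero.2)).const_sub (z x)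
    simpa using this
  · exact hw1.memLp.of_le_mul hzac.continuous.aestronglyMeasurable (Eventually.of_forall hle)
  -- The relation `z' = u` was obtained only almost everywhere. Since `u` is continuous, writing `z`
  -- as its integral gives the derivative at every point.
  · have h1 : z = fun y => z 0 + ∫ t in (0 : ℝ)..y, uPart (w t) := by
      funext y; rw [hint]; abel
    rw [h1]
    exact (huc.integral_hasStrictDerivAt 0 x).hasDerivAt.const_add (z 0)
  · rw [hz]
    simp only [neg_smul, smul_neg, smul_smul, mul_inv_cancel₀ hl, one_smul, neg_add_cancel]

/-- The weighted energy estimate for abstract coefficients. -/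
theorem exists_energy_estimate {C c : ℝ} (hC : 1 ≤ C) (hc : 0 < c) :
    ∃ ε₁ : ℝ, 0 < ε₁ ∧ ε₁ ≤ 1 ∧ ∃ K : ℝ, 0 < K ∧ ∀ ε : ℝ, 0 < ε → ε ≤ ε₁ →
      ∀ {n r : ℕ} {A A' J : ℝ → Matrix (Fin n ⊕ Fin r) (Fin n ⊕ Fin r) ℝ}
        {q₁ : ℝ → Matrix (Fin r) (Fin n) ℝ} {q₂ qi : ℝ → Matrix (Fin r) (Fin r) ℝ}
        {S a P' : ℝ → Matrix (Fin n) (Fin n) ℝ} {H H' : ℝ → Matrix (Fin n) (Fin n ⊕ Fin r) ℝ}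
        {p : ℝ → ℝ}, IsEnergyWeight C c ε A A' J q₁ q₂ qi S a P' H H' p →
      ∀ l : ℂ, 0 ≤ l.re → l ≠ 0 → ∀ w : ℝ → CState n r, MemH1 w →
        (∀ᵐ x, l • w x + deriv (fun y => cmul (A y) (w y)) x - cmul (J x) (w x) = 0) →
      ∃ z : ℝ → EuclideanSpace ℂ (Fin n), IsIntegratedFromBot (fun x => uPart (w x)) z ∧
        MemLp z 2 volume ∧
        l.re * (∫ x, ‖z x‖ ^ 2) + (∫ x, ‖z x‖ ^ 2 * p x) ≤
          K * (ε * (∫ x, ‖uPart (w x)‖ ^ 2) + ε⁻¹ * (∫ x, ‖deriv w x‖ ^ 2)) := by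
  have hC0 : 0 < C := by linarith
  have hCC : C ≤ C ^ 4 := by
    calc C = C ^ 1 := by ring
      _ ≤ C ^ 4 := pow_le_pow_right₀ hC (by norm_num)
  -- The constant `C ^ 4` arises because the resolvent constant `C` multiplies `(q₁, q₂) A`, which
  -- is bounded by `C ^ 3`.
  obtain ⟨ε₁, hε₁, hε₁', K, hK, habs⟩ := exists_absorption (hC.trans hCC) hc
  refine ⟨ε₁, hε₁, hε₁', 2 / c * K, by positivity, ?_⟩
  intro ε hε hεle n r A A' J q₁ q₂ qi S a P' H H' p hw l hl hl0 w hw1 heq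
  obtain ⟨z, hz1, hz2, hzac, hzd, hzeq, hztop, hzbot⟩ := hw.exists_primitive hl0 hw1 heq
  refine ⟨z, hz1, hz2, ?_⟩
  -- The quantity whose derivative collects the terms to be integrated by parts: `S a` is symmetric,
  -- so half its form differentiates to `Re⟨z, S a u⟩` plus the `P'` term, and the second summand
  -- yields `Re⟨z, H (A w)'⟩`.
  set h : ℝ → ℝ := fun x => (inner ℂ (z x) (cmul (S x * a x) (z x))).re / 2
    + (inner ℂ (z x) (cmul (H x) (cmul (A x) (w x)))).re with hh
  set h' : ℝ → ℝ := fun x => (inner ℂ (z x) (cmul (S x * a x) (uPart (w x)))).re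
    + (inner ℂ (z x) (cmul (P' x) (z x))).re / 2
    + (inner ℂ (uPart (w x)) (cmul (H x) (cmul (A x) (w x)))).re
    + (inner ℂ (z x) (cmul (H' x) (cmul (A x) (w x)))).re
    + (inner ℂ (z x) (cmul (H x) (cmul (A' x) (w x) + cmul (A x) (deriv w x)))).re with hh'
  have hAw : LocAC (fun y => cmul (A y) (w y)) :=
    LocAC.cmul (fun i j => LocAC.of_contDiff (hw.contDiff_A i j)) hw1.locAC
  have hac : LocAC h := by
    refine LocAC.add ?_ ?_
    · have := (hzac.re_inner
        (LocAC.cmul (fun i j => LocAC.of_contDiff (hw.contDiff_P i j)) hzac))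
      exact fun a b => by simpa [div_eq_inv_mul] using (this a b).const_mul 2⁻¹
    · exact hzac.re_inner (LocAC.cmul (fun i j => LocAC.of_contDiff (hw.contDiff_H i j)) hAw)
  have hder : ∀ᵐ x, HasDerivAt h (h' x) x := by
    filter_upwards [hw1.ae_hasDerivAt] with x hwx
    have d1 := HasDerivAt.re_inner (hzd x) (HasDerivAt.cmul (hw.deriv_P x) (hzd x))
    have d2 := HasDerivAt.re_inner (hzd x)
      (HasDerivAt.cmul (hw.deriv_H x) (HasDerivAt.cmul (hw.deriv_A x) hwx))
    convert! (d1.div_const 2).add d2 using 1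
    rw [hh']
    simp only [inner_add_right, Complex.add_re]
    rw [re_inner_cmul_comm (hw.P_symm x) (z x) (uPart (w x))]
    ring
  have hhle : ∀ x, ‖h x‖ ≤ C / 2 * (‖z x‖ * ‖z x‖) + C * C * (‖z x‖ * ‖w x‖) := fun x => by
    have b1 : |(inner ℂ (z x) (cmul (S x * a x) (z x))).re| ≤ ‖z x‖ * (C * ‖z x‖) :=
      ((Complex.abs_re_le_norm _).trans (norm_inner_le_norm _ _)).trans <| by
        gcongr
        exact (norm_cmul_le _ _).trans (by gcongr; exact hw.P_le x)
    have b2 : |(inner ℂ (z x) (cmul (H x) (cmul (A x) (w x)))).re| ≤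
        ‖z x‖ * (C * (C * ‖w x‖)) :=
      ((Complex.abs_re_le_norm _).trans (norm_inner_le_norm _ _)).trans <| by
        gcongr
        refine (norm_cmul_le _ _).trans (mul_le_mul (hw.H_le x) ?_ (norm_nonneg _) hC0.le)
        exact (norm_cmul_le _ _).trans (by gcongr; exact hw.A_le x)
    rw [Real.norm_eq_abs, hh]
    refine (abs_add_le _ _).trans ?_
    rw [abs_div, abs_two]
    linarith
  have hlim : ∀ {F : Filter ℝ}, Tendsto (fun x => ‖w x‖) F (𝓝 0) →
      Tendsto (fun x => ‖z x‖) F (𝓝 0) → Tendsto h F (𝓝 0) := fun hF hF' => by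
    refine squeeze_zero_norm hhle ?_
    simpa using ((hF'.mul hF').const_mul (C / 2)).add ((hF'.mul hF).const_mul (C * C))
  have hpoint : ∀ᵐ x, c / 2 * (l.re * ‖z x‖ ^ 2 + p x * ‖z x‖ ^ 2) + h' x ≤
      K * (ε * ‖uPart (w x)‖ ^ 2 + ε⁻¹ * ‖deriv w x‖ ^ 2) := by
    filter_upwards [heq, hw1.ae_hasDerivAt] with x hx hwx
    rw [(HasDerivAt.cmul (hw.deriv_A x) hwx).deriv] at hx
    have hE := energy_inequality (hw.inv x) (hw.J_fst x) (hw.J_snd x) (hw.symm x) (a := a x)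
      (P' := P' x) (H' := H' x) (hw.H_eq x) (hw.viscous x) hl hx (hzeq x)
    have hS := le_re_inner_cmul (hw.coercive_S x) (z x)
    have hP := le_re_inner_cmul (hw.coercive_P' x) (z x)
    rw [neg_cmul, inner_neg_right, Complex.neg_re] at hP
    have hg := source_resolvent (hw.J_fst x) (hw.J_snd x) hx
    rw [← hw.J_snd x] at hg
    have hsplit := cmul_splitting (q₁ := q₁ x) (hw.inv x) (w x)
    rw [← hw.J_snd x] at hsplit
    obtain ⟨g, hgdef⟩ : ∃ g, g = cmul (J x).toRows₂ (w x) := ⟨_, rfl⟩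
    rw [← hgdef] at hE hg hsplit
    have hp0 := hw.p_nonneg x
    refine habs ε hε hεle l.re ‖z x‖ ‖uPart (w x)‖ ‖g‖ ‖w x‖ ‖deriv w x‖ (p x) (h' x) hl
      (norm_nonneg _) (norm_nonneg _) (norm_nonneg _) (norm_nonneg _) (norm_nonneg _) hp0
      ?_ ?_ ?_ ?_
    · have m1 : entrySum (S x * ((A x).toRows₁ * tangentMat (q₁ x) (qi x) - a x)) *
          (‖z x‖ * ‖uPart (w x)‖) ≤ C ^ 4 * (p x * (‖z x‖ * ‖uPart (w x)‖)) := by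
        rw [← mul_assoc (C ^ 4)]
        exact mul_le_mul_of_nonneg_right ((hw.offEquilibrium x).trans (by gcongr)) (by positivity)
      have m2 : 2 * entrySum (S x * ((A x).toBlocks₁₂ * qi x * qi x)) * (l.re * ‖z x‖ * ‖g‖) ≤
          C ^ 4 * (l.re * ‖z x‖ * ‖g‖) := by
        gcongr
        exact (hw.bound_B x).trans hCC
      have m3 : entrySum (A x).toRows₁ * entrySum (S x * ((A x).toBlocks₁₂ * qi x * qi x)) *
          (‖w x‖ * ‖g‖) ≤ C ^ 4 * (‖w x‖ * ‖g‖) := by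
        gcongr
        exact (hw.bound_AB x).trans hCC
      have m4 : C * ε * ‖uPart (w x)‖ ^ 2 ≤ C ^ 4 * (ε * ‖uPart (w x)‖ ^ 2) := by
        rw [← mul_assoc]
        gcongr
      have m5 : entrySum (H x * A x * inclMat n (qi x)) * (‖uPart (w x)‖ * ‖g‖) ≤
          C ^ 4 * (‖uPart (w x)‖ * ‖g‖) := by
        gcongr
        exact (hw.bound_HA x).trans hCC
      have m6 : entrySum (H' x) * entrySum (A x) * (‖z x‖ * ‖w x‖) ≤
          C ^ 4 * (p x * (‖z x‖ * ‖w x‖)) := by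
        rw [← mul_assoc (C ^ 4)]
        exact mul_le_mul_of_nonneg_right ((hw.bound_H'A x).trans (by gcongr)) (by positivity)
      have m7 : l.re * (c * ‖z x‖ ^ 2) ≤ l.re * (inner ℂ (z x) (cmul (S x) (z x))).re := by
        gcongr
      rw [hh']
      linarith
    · have hr := hw.resolvent x l hl g
      rw [hg, norm_neg] at hr
      have hre : l.re ≤ ‖l‖ := Complex.re_le_norm l
      refine (mul_le_mul_of_nonneg_left (by linarith : 1 + l.re ≤ 1 + ‖l‖)
        (norm_nonneg g)).trans (hr.trans ?_)
      rw [hw.J_snd x, cmul_add]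
      have n0 := entrySum_nonneg (fromCols (q₁ x) (q₂ x))
      have n1 : ‖cmul (fromCols (q₁ x) (q₂ x)) (cmul (A' x) (w x))‖ ≤
          entrySum (fromCols (q₁ x) (q₂ x)) * entrySum (A' x) * ‖w x‖ := by
        rw [mul_assoc]
        exact (norm_cmul_le _ _).trans (by gcongr; exact norm_cmul_le _ _)
      have n2 : ‖cmul (fromCols (q₁ x) (q₂ x)) (cmul (A x) (deriv w x))‖ ≤
          C ^ 3 * ‖deriv w x‖ := by
        refine le_trans ?_ (mul_le_mul_of_nonneg_right (hw.bound_source' x) (norm_nonneg _))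
        rw [mul_assoc]
        exact (norm_cmul_le _ _).trans (by gcongr; exact norm_cmul_le _ _)
      have n3 := mul_le_mul_of_nonneg_right (hw.bound_source x) (norm_nonneg (w x))
      calc _ ≤ C * (entrySum (fromCols (q₁ x) (q₂ x)) * entrySum (A' x) * ‖w x‖
            + C ^ 3 * ‖deriv w x‖) := by
            gcongr
            exact (norm_add_le _ _).trans (add_le_add n1 n2)
        _ ≤ _ := by linarith
    · conv_lhs => rw [hsplit]
      have n1 : ‖cmul (tangentMat (q₁ x) (qi x)) (uPart (w x))‖ ≤ C ^ 4 * ‖uPart (w x)‖ :=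
        (norm_cmul_le _ _).trans (by gcongr; exact (hw.bound_tangent x).trans hCC)
      have n2 : ‖cmul (inclMat n (qi x)) g‖ ≤ C ^ 4 * ‖g‖ :=
        (norm_cmul_le _ _).trans (by gcongr; exact (hw.bound_incl x).trans hCC)
      rw [mul_add]
      exact (norm_add_le _ _).trans (add_le_add n1 n2)
    · exact (hw.p_le x).trans (by gcongr)
  have iz : Integrable fun x => ‖z x‖ ^ 2 := (memLp_two_iff_integrable_sq_norm hz2.1).1 hz2
  have izp : Integrable fun x => ‖z x‖ ^ 2 * p x := by
    refine iz.mul_bdd (c := C * ε ^ 2) hw.p_cont.aestronglyMeasurable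
      (Eventually.of_forall fun x => ?_)
    rw [Real.norm_of_nonneg (hw.p_nonneg x)]
    exact hw.p_le x
  have huc : Continuous fun x => uPart (w x) := (locAC_uPart hw1.locAC).continuous
  have iw : Integrable fun x => ‖deriv w x‖ ^ 2 :=
    (memLp_two_iff_integrable_sq_norm hw1.memLp_deriv.1).1 hw1.memLp_deriv
  have iu : Integrable fun x => ‖uPart (w x)‖ ^ 2 := by
    refine (memLp_two_iff_integrable_sq_norm huc.aestronglyMeasurable).1 ?_
    exact hw1.memLp.mono huc.aestronglyMeasurable
      (Eventually.of_forall fun x => norm_uPart_le _)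
  have ileft : Integrable fun x => c / 2 * (l.re * ‖z x‖ ^ 2 + p x * ‖z x‖ ^ 2) := by
    refine ((iz.const_mul l.re).add ?_).const_mul (c / 2)
    simpa only [mul_comm] using izp
  -- Since `z` and `w` vanish at both ends, so does `h`, and its derivative contributes nothing to
  -- the integral.
  have hfin := hac.integral_le hder ileft
    (((iu.const_mul ε).add (iw.const_mul ε⁻¹)).const_mul K) hpoint
    (hlim hw1.tendsto_norm_zero.1 hztop) (hlim hw1.tendsto_norm_zero.2 hzbot)
  have izp' : Integrable fun x => p x * ‖z x‖ ^ 2 := by simpa only [mul_comm] using izp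
  simp only [Pi.add_apply] at hfin
  rw [integral_const_mul, integral_const_mul, integral_add (iz.const_mul _) izp',
    integral_add (iu.const_mul _) (iw.const_mul _), integral_const_mul, integral_const_mul,
    integral_const_mul] at hfin
  have e : ∫ x, p x * ‖z x‖ ^ 2 = ∫ x, ‖z x‖ ^ 2 * p x := by simp only [mul_comm]
  rw [e] at hfin
  calc _ = 2 / c * (c / 2 * (l.re * (∫ x, ‖z x‖ ^ 2) + ∫ x, ‖z x‖ ^ 2 * p x)) := by
        field_simp
    _ ≤ 2 / c * (K * (ε * (∫ x, ‖uPart (w x)‖ ^ 2) + ε⁻¹ * (∫ x, ‖deriv w x‖ ^ 2))) := by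
        gcongr
    _ = _ := by ring

end Energy

/-! ### Continuously differentiable matrix functions -/

section MatC1

variable {X : Type*} [NormedAddCommGroup X] [NormedSpace ℝ X] {ι κ μ : Type*} [Fintype ι]
  [Fintype κ] [Fintype μ] {s : Set X}

/-- Continuous differentiability of the entries of a matrix-valued function on a set. -/
def MatC1On (f : X → Matrix κ ι ℝ) (s : Set X) : Prop :=
  ∀ i j, ContDiffOn ℝ 1 (fun x => f x i j) s

/-- The derivative of a matrix-valued function in a direction, entry by entry. -/
def dmat (f : X → Matrix κ ι ℝ) (x h : X) : Matrix κ ι ℝ :=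
  Matrix.of fun i j => fderiv ℝ (fun y => f y i j) x h

lemma MatC1On.neg {f : X → Matrix κ ι ℝ} (hf : MatC1On f s) :
    MatC1On (fun x => -f x) s := fun i j => (hf i j).neg

lemma MatC1On.const (A : Matrix κ ι ℝ) : MatC1On (fun _ : X => A) s :=
  fun _ _ => contDiffOn_const

lemma MatC1On.smul {c : X → ℝ} {f : X → Matrix κ ι ℝ} (hc : ContDiffOn ℝ 1 c s)
    (hf : MatC1On f s) : MatC1On (fun x => c x • f x) s := fun i j => hc.mul (hf i j)

lemma MatC1On.mul {f : X → Matrix κ ι ℝ} {g : X → Matrix ι μ ℝ} (hf : MatC1On f s)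
    (hg : MatC1On g s) : MatC1On (fun x => f x * g x) s := fun i k => by
  simp only [Matrix.mul_apply]
  exact ContDiffOn.sum fun j _ => (hf i j).mul (hg j k)

lemma MatC1On.submatrix {ι' κ' : Type*} [Fintype ι'] [Fintype κ'] {f : X → Matrix κ ι ℝ}
    (hf : MatC1On f s) (e : κ' → κ) (e' : ι' → ι) :
    MatC1On (fun x => (f x).submatrix e e') s := fun i j => hf (e i) (e' j)

lemma MatC1On.fromRows {f : X → Matrix κ ι ℝ} {g : X → Matrix μ ι ℝ} (hf : MatC1On f s)
    (hg : MatC1On g s) : MatC1On (fun x => Matrix.fromRows (f x) (g x)) s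
  | Sum.inl i, j => hf i j
  | Sum.inr i, j => hg i j

lemma MatC1On.fromCols {f : X → Matrix κ ι ℝ} {g : X → Matrix κ μ ℝ} (hf : MatC1On f s)
    (hg : MatC1On g s) : MatC1On (fun x => Matrix.fromCols (f x) (g x)) s
  | i, Sum.inl j => hf i j
  | i, Sum.inr j => hg i j

lemma MatC1On.mono {f : X → Matrix κ ι ℝ} {t : Set X} (hf : MatC1On f s) (h : t ⊆ s) :
    MatC1On f t := fun i j => (hf i j).mono h

lemma MatC1On.comp {Y : Type*} [NormedAddCommGroup Y] [NormedSpace ℝ Y] {f : X → Matrix κ ι ℝ}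
    (hf : MatC1On f s) {t : Set Y} {g : Y → X} (hg : ContDiffOn ℝ 1 g t) (h : Set.MapsTo g t s) :
    MatC1On (fun y => f (g y)) t := fun i j => (hf i j).comp hg h

lemma MatC1On.congr {f g : X → Matrix κ ι ℝ} (hf : MatC1On f s) (h : ∀ x ∈ s, g x = f x) :
    MatC1On g s := fun i j => (hf i j).congr fun x hx => by rw [h x hx]

lemma MatC1On.det [DecidableEq ι] {f : X → Matrix ι ι ℝ} (hf : MatC1On f s) :
    ContDiffOn ℝ 1 (fun x => (f x).det) s := by
  simp only [Matrix.det_apply]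
  refine ContDiffOn.sum fun σ _ => ContDiffOn.const_smul _ ?_
  exact contDiffOn_prod fun i _ => hf (σ i) i

lemma MatC1On.inv [DecidableEq ι] {f : X → Matrix ι ι ℝ} (hf : MatC1On f s)
    (h : ∀ x ∈ s, (f x).det ≠ 0) : MatC1On (fun x => (f x)⁻¹) s := by
  have hadj : MatC1On (fun x => (f x).adjugate) s := fun i j => by
    simp only [Matrix.adjugate_apply]
    refine MatC1On.det fun k l => ?_
    by_cases hk : k = j
    · subst hk; simpa using contDiffOn_const
    · simpa [Matrix.updateRow_ne hk] using hf k l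
  simp only [Matrix.inv_def, Ring.inverse_eq_inv']
  exact MatC1On.smul (hf.det.inv h) hadj

lemma MatC1On.hasDerivAt {f : X → Matrix κ ι ℝ} (hf : MatC1On f s) (hs : IsOpen s) {W : ℝ → X}
    {W' : X} {x : ℝ} (hW : HasDerivAt W W' x) (hx : W x ∈ s) (i : κ) (j : ι) :
    HasDerivAt (fun y => f (W y) i j) (dmat f (W x) W' i j) x := by
  have h1 := (((hf i j).contDiffAt (hs.mem_nhds hx)).differentiableAt (by norm_num)).hasFDerivAt
  exact h1.comp_hasDerivAt x hW

lemma MatC1On.comp_contDiff {f : X → Matrix κ ι ℝ} (hf : MatC1On f s) {W : ℝ → X}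
    (hW : ContDiff ℝ 1 W) (h : ∀ x, W x ∈ s) (i : κ) (j : ι) :
    ContDiff ℝ 1 fun y => f (W y) i j :=
  contDiffOn_univ.1 ((hf i j).comp hW.contDiffOn fun x _ => h x)

lemma dmat_add (f : X → Matrix κ ι ℝ) (x h h' : X) :
    dmat f x (h + h') = dmat f x h + dmat f x h' := by
  ext i j; simp [dmat]

lemma dmat_smul (f : X → Matrix κ ι ℝ) (x : X) (c : ℝ) (h : X) :
    dmat f x (c • h) = c • dmat f x h := by
  ext i j; simp [dmat]

/-- Uniform bounds of a continuously differentiable matrix function on a compact set. -/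
lemma MatC1On.exists_bound {f : X → Matrix κ ι ℝ} (hf : MatC1On f s) (hs : IsOpen s) {k : Set X}
    (hk : IsCompact k) (hks : k ⊆ s) : ∃ C : ℝ, 0 < C ∧ (∀ x ∈ k, entrySum (f x) ≤ C) ∧
      (∀ x ∈ k, ∀ h, entrySum (dmat f x h) ≤ C * ‖h‖) ∧
      ∀ x y, segment ℝ x y ⊆ k → entrySum (f y - f x) ≤ C * ‖y - x‖ := by
  have h1 : ∀ i j, ∃ B : ℝ, ∀ x ∈ k, ‖f x i j‖ ≤ B := fun i j =>
    hk.exists_bound_of_continuousOn ((hf i j).continuousOn.mono hks)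
  have h2 : ∀ i j, ∃ B : ℝ, ∀ x ∈ k, ‖fderiv ℝ (fun y => f y i j) x‖ ≤ B := fun i j =>
    hk.exists_bound_of_continuousOn
      (((hf i j).continuousOn_fderiv_of_isOpen hs le_rfl).mono hks)
  choose B hB using h1
  choose B' hB' using h2
  set M := ∑ i, ∑ j, (|B i j| + |B' i j|) with hM
  have hle : ∀ i j, |B i j| + |B' i j| ≤ M := fun i j => by
    have a1 : |B i j| + |B' i j| ≤ ∑ j, (|B i j| + |B' i j|) :=
      Finset.single_le_sum (f := fun j => |B i j| + |B' i j|) (fun _ _ => by positivity)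
        (Finset.mem_univ j)
    exact a1.trans (Finset.single_le_sum (f := fun i => ∑ j, (|B i j| + |B' i j|))
      (fun _ _ => Finset.sum_nonneg fun _ _ => by positivity) (Finset.mem_univ i))
  have hBM : ∀ i j, B i j ≤ M := fun i j =>
    (le_abs_self _).trans ((le_add_of_nonneg_right (abs_nonneg _)).trans (hle i j))
  have hBM' : ∀ i j, B' i j ≤ M := fun i j =>
    (le_abs_self _).trans ((le_add_of_nonneg_left (abs_nonneg _)).trans (hle i j))
  have hM0 : 0 ≤ M := Finset.sum_nonneg fun _ _ => Finset.sum_nonneg fun _ _ => by positivity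
  set N := (Fintype.card κ * (Fintype.card ι * M) : ℝ) with hN
  have hN0 : 0 ≤ N := by positivity
  refine ⟨N + 1, by positivity, fun x hx => ?_, fun x hx h => ?_, fun x y hxy => ?_⟩
  · exact (entrySum_le fun i j => (hB i j x hx).trans (hBM i j)).trans (by linarith)
  · have : entrySum (dmat f x h) ≤ Fintype.card κ * (Fintype.card ι * (M * ‖h‖)) :=
      entrySum_le fun i j => (ContinuousLinearMap.le_opNorm _ _).trans
        (mul_le_mul_of_nonneg_right ((hB' i j x hx).trans (hBM' i j)) (norm_nonneg _))
    refine this.trans ?_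
    have e : (Fintype.card κ * (Fintype.card ι * (M * ‖h‖)) : ℝ) = N * ‖h‖ := by rw [hN]; ring
    rw [e]; gcongr; linarith
  · have : entrySum (f y - f x) ≤ Fintype.card κ * (Fintype.card ι * (M * ‖y - x‖)) := by
      refine entrySum_le fun i j => ?_
      rw [Matrix.sub_apply, ← Real.norm_eq_abs]
      refine (convex_segment x y).norm_image_sub_le_of_norm_fderiv_le (𝕜 := ℝ)
        (f := fun y => f y i j) (fun z hz => ?_)
        (fun z hz => (hB' i j z (hxy hz)).trans (hBM' i j))
        (left_mem_segment ℝ x y) (right_mem_segment ℝ x y)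
      exact ((hf i j).contDiffAt (hs.mem_nhds (hks (hxy hz)))).differentiableAt (by norm_num)
    refine this.trans ?_
    have e : (Fintype.card κ * (Fintype.card ι * (M * ‖y - x‖)) : ℝ) = N * ‖y - x‖ := by
      rw [hN]; ring
    rw [e]; gcongr; linarith

lemma MatC1On.continuousOn_dmat {f : X → Matrix κ ι ℝ} (hf : MatC1On f s) (hs : IsOpen s)
    (i : κ) (j : ι) : ContinuousOn (fun p : X × X => dmat f p.1 p.2 i j) (s ×ˢ Set.univ) := by
  have h1 := ((hf i j).continuousOn_fderiv_of_isOpen hs le_rfl)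
  exact (h1.comp continuousOn_fst fun p hp => hp.1).clm_apply continuousOn_snd

end MatC1

/-! ### Jacobians -/

section Jacobian

variable {ι κ : Type*} [Fintype ι] [DecidableEq ι] [Fintype κ]

lemma fderiv_eq_jacobian_mulVec (G : EuclideanSpace ℝ ι → EuclideanSpace ℝ κ)
    (x h : EuclideanSpace ℝ ι) : (fderiv ℝ G x h).ofLp = jacobian G x *ᵥ h.ofLp := by
  have hh : h = ∑ j, h j • EuclideanSpace.single j (1 : ℝ) := by
    ext j; simp [Finset.sum_apply, Pi.single_apply]
  funext i
  conv_lhs => rw [hh, map_sum]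
  simp [Matrix.mulVec, dotProduct, jacobian, mul_comm]

lemma jacobian_eq_of_hasFDerivAt {G : EuclideanSpace ℝ ι → EuclideanSpace ℝ κ}
    {x : EuclideanSpace ℝ ι} {L : EuclideanSpace ℝ ι →L[ℝ] EuclideanSpace ℝ κ}
    (hG : HasFDerivAt G L x) {M : Matrix κ ι ℝ} (hL : ∀ h, (L h).ofLp = M *ᵥ h.ofLp) :
    jacobian G x = M := by
  ext i j
  rw [jacobian, of_apply, hG.fderiv, hL]
  simp [Matrix.mulVec, dotProduct]

lemma matC1On_jacobian {G : EuclideanSpace ℝ ι → EuclideanSpace ℝ κ} (hG : ContDiff ℝ 2 G) :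
    MatC1On (jacobian G) Set.univ := fun i j => by
  have h1 : ContDiff ℝ 1 (fderiv ℝ G) := hG.fderiv_right (by norm_num)
  have h2 : ContDiff ℝ 1 fun x => fderiv ℝ G x (EuclideanSpace.single j 1) :=
    h1.clm_apply contDiff_const
  exact (contDiff_euclidean.1 h2 i).contDiffOn

lemma isRoot_charpoly_of_mulVec_eq {K : Type*} [Field K] {M : Matrix ι ι K} {y : ι → K} {μ : K}
    (hy : y ≠ 0) (h : M *ᵥ y = μ • y) : M.charpoly.IsRoot μ := by
  rw [← Matrix.charpoly_toLin', ← Module.End.hasEigenvalue_iff_isRoot_charpoly]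
  exact Module.End.hasEigenvalue_of_hasEigenvector
    (Module.End.hasEigenvector_iff.2 ⟨Module.End.mem_eigenspace_iff.2 (by simpa using h), hy⟩)

/-- An eigenvector for a simple root of the characteristic polynomial spans the eigenspace. -/
lemma exists_smul_eq_of_simple {M : Matrix ι ι ℝ} {μ : ℝ} (hμ : M.charpoly.rootMultiplicity μ = 1)
    {y r : ι → ℝ} (hr : r ≠ 0) (hMr : M *ᵥ r = μ • r) (hMy : M *ᵥ y = μ • y) :
    ∃ t : ℝ, y = t • r := by
  have h1 := LinearMap.finrank_eigenspace_le (Matrix.toLin' M) μ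
  rw [Matrix.charpoly_toLin', hμ] at h1
  have hr' : r ∈ Module.End.eigenspace (Matrix.toLin' M) μ :=
    Module.End.mem_eigenspace_iff.2 (by simpa using hMr)
  have hy' : y ∈ Module.End.eigenspace (Matrix.toLin' M) μ :=
    Module.End.mem_eigenspace_iff.2 (by simpa using hMy)
  obtain ⟨v, hv⟩ := finrank_le_one_iff.1 h1
  obtain ⟨a, ha⟩ := hv ⟨r, hr'⟩
  obtain ⟨b, hb⟩ := hv ⟨y, hy'⟩
  have ha' : a • (v : ι → ℝ) = r := congrArg Subtype.val ha
  have hb' : b • (v : ι → ℝ) = y := congrArg Subtype.val hb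
  have ha0 : a ≠ 0 := by
    rintro rfl
    exact hr (by rw [← ha', zero_smul])
  refine ⟨b / a, ?_⟩
  rw [← ha', ← hb', smul_smul, div_mul_cancel₀ _ ha0]

end Jacobian

/-! ### The equilibrium manifold -/

section Equilibrium

variable {n r : ℕ}

/-- The block `q₁` of the Jacobian of the source. -/
abbrev srcU (q : State n r → EuclideanSpace ℝ (Fin r)) (w : State n r) :
    Matrix (Fin r) (Fin n) ℝ := (jacobian (source q) w).toBlocks₂₁

/-- The block `q₂` of the Jacobian of the source. -/
abbrev srcV (q : State n r → EuclideanSpace ℝ (Fin r)) (w : State n r) :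
    Matrix (Fin r) (Fin r) ℝ := (jacobian (source q) w).toBlocks₂₂

/-- The Jacobian `A₁₁ - A₁₂ q₂⁻¹ q₁` of the relaxed flux, at any state. -/
abbrev relaxedJacobian (F : State n r → State n r) (q : State n r → EuclideanSpace ℝ (Fin r))
    (w : State n r) : Matrix (Fin n) (Fin n) ℝ :=
  (jacobian F w).toRows₁ * tangentMat (srcU q w) (srcV q w)⁻¹

/-- The weight `A₁₂ q₂⁻¹ (q₂⁻¹ q₁, 1)` of the derivative terms. -/
abbrev derivWeight (F : State n r → State n r) (q : State n r → EuclideanSpace ℝ (Fin r))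
    (w : State n r) : Matrix (Fin n) (Fin n ⊕ Fin r) ℝ :=
  (jacobian F w).toBlocks₁₂ * (srcV q w)⁻¹ * conormalMat (srcU q w) (srcV q w)⁻¹

/-- The equilibrium state `(u, v^*(u))`. -/
abbrev eqState (vstar : EuclideanSpace ℝ (Fin n) → EuclideanSpace ℝ (Fin r))
    (u : EuclideanSpace ℝ (Fin n)) : State n r := mkState u (vstar u)

/-- States over `Us` at which `q₂` is invertible. -/
def regularSet (q : State n r → EuclideanSpace ℝ (Fin r)) (Us : Set (EuclideanSpace ℝ (Fin n))) :
    Set (State n r) := {w | uPart w ∈ Us ∧ (srcV q w).det ≠ 0}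

/-- The inclusion `v ↦ (0, v)`. -/
def inclV (n r : ℕ) : EuclideanSpace ℝ (Fin r) →L[ℝ] State n r :=
  LinearMap.toContinuousLinearMap
    { toFun := fun v => mkState 0 v
      map_add' := fun v v' => by ext i; rcases i with i | i <;> simp [mkState]
      map_smul' := fun c v => by ext i; rcases i with i | i <;> simp [mkState] }

/-- The projection `(u, v) ↦ u`. -/
def projU (n r : ℕ) : State n r →L[ℝ] EuclideanSpace ℝ (Fin n) :=
  LinearMap.toContinuousLinearMap
    { toFun := uPart, map_add' := fun _ _ => rfl, map_smul' := fun _ _ => rfl }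

/-- The projection `(u, v) ↦ v`. -/
def projV (n r : ℕ) : State n r →L[ℝ] EuclideanSpace ℝ (Fin r) :=
  LinearMap.toContinuousLinearMap
    { toFun := vPart, map_add' := fun _ _ => rfl, map_smul' := fun _ _ => rfl }

lemma uPart_mkState (u : EuclideanSpace ℝ (Fin n)) (v : EuclideanSpace ℝ (Fin r)) :
    uPart (mkState u v) = u := rfl

lemma vPart_mkState (u : EuclideanSpace ℝ (Fin n)) (v : EuclideanSpace ℝ (Fin r)) :
    vPart (mkState u v) = v := rfl

lemma mkState_parts (w : State n r) : mkState (uPart w) (vPart w) = w := ext_parts rfl rfl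

lemma norm_inclV (v : EuclideanSpace ℝ (Fin r)) : ‖mkState (0 : EuclideanSpace ℝ (Fin n)) v‖ = ‖v‖ := by
  have h := norm_sq_parts (mkState (0 : EuclideanSpace ℝ (Fin n)) v)
  rw [uPart_mkState, vPart_mkState, norm_zero] at h
  exact (sq_eq_sq₀ (norm_nonneg _) (norm_nonneg _)).1 (by linarith)

lemma mulVec_parts {κ : Type*} (B₁ : Matrix κ (Fin n) ℝ) (B₂ : Matrix κ (Fin r) ℝ) (h : State n r) :
    fromCols B₁ B₂ *ᵥ h.ofLp = B₁ *ᵥ (uPart h).ofLp + B₂ *ᵥ (vPart h).ofLp := by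
  rw [fromCols_mulVec]; rfl

variable {F : State n r → State n r} {q : State n r → EuclideanSpace ℝ (Fin r)}
  {vstar : EuclideanSpace ℝ (Fin n) → EuclideanSpace ℝ (Fin r)}
  {U : Set (EuclideanSpace ℝ (Fin n))} {V : Set (EuclideanSpace ℝ (Fin r))}
  {𝒲 : Set (State n r)} {Us : Set (EuclideanSpace ℝ (Fin n))}

lemma hasFDerivAt_source (hq : ContDiff ℝ 2 q) (w : State n r) :
    HasFDerivAt (source q) ((inclV n r).comp (fderiv ℝ q w)) w :=
  (inclV n r).hasFDerivAt.comp w (hq.differentiable (by norm_num) w).hasFDerivAt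

lemma contDiff_source (hq : ContDiff ℝ 2 q) : ContDiff ℝ 2 (source q) :=
  (inclV n r).contDiff.comp hq

lemma jacobian_source_toRows₁ (hq : ContDiff ℝ 2 q) (w : State n r) :
    (jacobian (source q) w).toRows₁ = 0 := by
  ext i j
  rw [toRows₁_apply, jacobian, of_apply, (hasFDerivAt_source hq w).fderiv]
  rfl

lemma jacobian_source_toRows₂ (w : State n r) :
    (jacobian (source q) w).toRows₂ = fromCols (srcU q w) (srcV q w) := by
  ext i j
  rcases j with j | j <;> rfl

lemma fderiv_q_apply (hq : ContDiff ℝ 2 q) (w h : State n r) :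
    (fderiv ℝ q w h).ofLp = srcU q w *ᵥ (uPart h).ofLp + srcV q w *ᵥ (vPart h).ofLp := by
  rw [← mulVec_parts, ← jacobian_source_toRows₂]
  have h1 := fderiv_eq_jacobian_mulVec (source q) w h
  rw [(hasFDerivAt_source hq w).fderiv] at h1
  funext i
  exact congrFun h1 (Sum.inr i)

/-- The product of `dF` with the tangent map `(1, -q₂⁻¹ q₁)` has block rows `a` and `c`, and the
conormal map combines them to `q₂⁻¹ q₁ a + c`. In this factored form the viscosity is recognized in
the energy identity. -/
lemma viscosityAt_eq (w : State n r) : viscosityAt F q w =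
    -(derivWeight F q w * jacobian F w * tangentMat (srcU q w) (srcV q w)⁻¹) := by
  have hA : jacobian F w = fromBlocks (jacobian F w).toBlocks₁₁ (jacobian F w).toBlocks₁₂
      (jacobian F w).toBlocks₂₁ (jacobian F w).toBlocks₂₂ := (fromBlocks_toBlocks _).symm
  simp only [viscosityAt]
  rw [Matrix.mul_assoc (derivWeight F q w)]
  congr 1
  have h1 : jacobian F w * tangentMat (srcU q w) (srcV q w)⁻¹ = fromRows
      ((jacobian F w).toBlocks₁₁ - (jacobian F w).toBlocks₁₂ * (srcV q w)⁻¹ * srcU q w)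
      ((jacobian F w).toBlocks₂₁ - (jacobian F w).toBlocks₂₂ * (srcV q w)⁻¹ * srcU q w) := by
    conv_lhs => rw [hA]
    rw [← fromRows_fromCols_eq_fromBlocks, fromRows_mul, fromCols_mul_fromRows,
      fromCols_mul_fromRows]
    simp only [Matrix.mul_one, Matrix.mul_neg, Matrix.mul_assoc, sub_eq_add_neg]
  rw [h1, derivWeight, Matrix.mul_assoc _ (conormalMat _ _), fromCols_mul_fromRows,
    Matrix.one_mul, add_comm ((srcV q w)⁻¹ * srcU q w * _)]

lemma relaxedJacobian_contDiff (hF : ContDiff ℝ 2 F) (hq : ContDiff ℝ 2 q) :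
    MatC1On (jacobian F) (regularSet q Us) ∧ MatC1On (srcU q) (regularSet q Us) ∧
    MatC1On (srcV q) (regularSet q Us) ∧ MatC1On (fun w => (srcV q w)⁻¹) (regularSet q Us) := by
  have hJ := (matC1On_jacobian (contDiff_source hq)).mono (Set.subset_univ (regularSet q Us))
  have h2 : MatC1On (srcV q) (regularSet q Us) := hJ.submatrix Sum.inr Sum.inr
  exact ⟨(matC1On_jacobian hF).mono (Set.subset_univ _), hJ.submatrix Sum.inr Sum.inl, h2,
    h2.inv fun w hw => hw.2⟩

lemma matC1On_tangentMat (hF : ContDiff ℝ 2 F) (hq : ContDiff ℝ 2 q) :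
    MatC1On (fun w => tangentMat (srcU q w) (srcV q w)⁻¹) (regularSet q Us) := by
  obtain ⟨-, h1, -, h3⟩ := relaxedJacobian_contDiff (Us := Us) hF hq
  exact (MatC1On.const 1).fromRows (h3.mul h1).neg

lemma matC1On_relaxedJacobian (hF : ContDiff ℝ 2 F) (hq : ContDiff ℝ 2 q) :
    MatC1On (relaxedJacobian F q) (regularSet q Us) :=
  ((relaxedJacobian_contDiff hF hq).1.submatrix Sum.inl id).mul (matC1On_tangentMat hF hq)

lemma matC1On_derivWeight (hF : ContDiff ℝ 2 F) (hq : ContDiff ℝ 2 q) :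
    MatC1On (derivWeight F q) (regularSet q Us) := by
  obtain ⟨h0, h1, -, h3⟩ := relaxedJacobian_contDiff (Us := Us) hF hq
  exact ((h0.submatrix Sum.inl Sum.inr).mul h3).mul ((h3.mul h1).fromCols (MatC1On.const 1))

lemma matC1On_viscosityAt (hF : ContDiff ℝ 2 F) (hq : ContDiff ℝ 2 q) :
    MatC1On (viscosityAt F q) (regularSet q Us) :=
  (((matC1On_derivWeight hF hq).mul (relaxedJacobian_contDiff hF hq).1).mul
    (matC1On_tangentMat hF hq)).neg.congr fun w _ => viscosityAt_eq w

lemma isOpen_regularSet (hq : ContDiff ℝ 2 q) (hUs : IsOpen Us) : IsOpen (regularSet q Us) := by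
  refine (hUs.preimage (projU n r).continuous).inter (isOpen_ne_fun ?_ continuous_const)
  have hJ := matC1On_jacobian (contDiff_source hq)
  exact continuousOn_univ.1 (MatC1On.det (hJ.submatrix Sum.inr Sum.inr)).continuousOn

namespace IsRelaxationSystem

variable (hsys : IsRelaxationSystem F q vstar U V 𝒲 Us)

include hsys

lemma q_eqState {u : EuclideanSpace ℝ (Fin n)} (hu : u ∈ Us) : q (eqState vstar u) = 0 := by
  have h := hsys.W_subset _ (hsys.graph_subset u hu)
  exact (hsys.equilibrium_iff u h.1 _ h.2).2 rfl

/-- Stability: `q₂ - λ` is injective at equilibria for `Re λ ≥ 0`. -/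
lemma eq_zero_of_cmul_srcV {u : EuclideanSpace ℝ (Fin n)} (hu : u ∈ Us) {l : ℂ} (hl : 0 ≤ l.re)
    {y : EuclideanSpace ℂ (Fin r)} (h : cmul (srcV q (eqState vstar u)) y = l • y) : y = 0 := by
  by_contra hy
  have h1 : ((srcV q (eqState vstar u)).map Complex.ofReal) *ᵥ y.ofLp = l • y.ofLp :=
    congrArg WithLp.ofLp h
  have h2 := hsys.stable u (hsys.Us_subset hu) l
    (isRoot_charpoly_of_mulVec_eq (fun h0 => hy (by ext i; exact congrFun h0 i)) h1)
  linarith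

/-- A real kernel vector of `q₂`, complexified, would be an eigenvector for the eigenvalue `0`,
whose real part is not negative. -/
lemma det_srcV_ne_zero {u : EuclideanSpace ℝ (Fin n)} (hu : u ∈ Us) :
    (srcV q (eqState vstar u)).det ≠ 0 := by
  intro h0
  obtain ⟨y, hy0, hy⟩ := Matrix.exists_mulVec_eq_zero_iff.2 h0
  set yc : EuclideanSpace ℂ (Fin r) := WithLp.toLp 2 fun i => (y i : ℂ) with hyc
  have h1 : cmul (srcV q (eqState vstar u)) yc = (0 : ℂ) • yc := by
    ext i
    rw [cmul_apply, zero_smul]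
    have := congrFun hy i
    simp only [Matrix.mulVec, dotProduct, Pi.zero_apply] at this
    simp only [hyc, ← Complex.ofReal_mul, ← Complex.ofReal_sum, this]
    rfl
  have h2 := hsys.eq_zero_of_cmul_srcV hu (by simp) h1
  apply hy0
  funext i
  have := congrArg (fun x : EuclideanSpace ℂ (Fin r) => x i) h2
  simpa [hyc] using this

lemma eqState_mem {u : EuclideanSpace ℝ (Fin n)} (hu : u ∈ Us) :
    eqState vstar u ∈ regularSet q Us := ⟨hu, hsys.det_srcV_ne_zero hu⟩

lemma contDiffOn_eqState : ContDiffOn ℝ 1 (eqState vstar) Us := by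
  rw [contDiffOn_euclidean]
  intro i
  rcases i with i | i
  · exact (contDiff_euclidean.1 contDiff_id i).contDiffOn
  · exact contDiffOn_euclidean.1 (hsys.contDiffOn_vstar.mono hsys.Us_subset) i

/-- Differentiate `q(u, v^*(u)) = 0` and solve `q₁ + q₂ dv^* = 0` for `dv^*`. -/
lemma hasFDerivAt_eqState {u : EuclideanSpace ℝ (Fin n)} (hu : u ∈ Us) :
    ∃ L : EuclideanSpace ℝ (Fin n) →L[ℝ] State n r, HasFDerivAt (eqState vstar) L u ∧
      ∀ h, (L h).ofLp = tangentMat (srcU q (eqState vstar u)) (srcV q (eqState vstar u))⁻¹ *ᵥ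
        h.ofLp := by
  have hd := ((hsys.contDiffOn_eqState.contDiffAt (hsys.isOpen_Us.mem_nhds hu)).differentiableAt
    (by norm_num)).hasFDerivAt
  set L := fderiv ℝ (eqState vstar) u
  refine ⟨L, hd, fun h => ?_⟩
  have h1 : (projU n r).comp L = ContinuousLinearMap.id ℝ _ :=
    ((projU n r).hasFDerivAt.comp u hd).unique (hasFDerivAt_id u)
  have hq := (hsys.contDiff_q.differentiable (by norm_num) (eqState vstar u)).hasFDerivAt
  have h2 : (fderiv ℝ q (eqState vstar u)).comp L = 0 := by
    refine (hq.comp u hd).unique ((hasFDerivAt_const (0 : EuclideanSpace ℝ (Fin r)) u).congr_of_eventuallyEq ?_)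
    filter_upwards [hsys.isOpen_Us.mem_nhds hu] with u' hu' using hsys.q_eqState hu'
  have h1' : uPart (L h) = h := congrArg (fun T => T h) h1
  have h2' : fderiv ℝ q (eqState vstar u) (L h) = 0 := congrArg (fun T => T h) h2
  have h3 := fderiv_q_apply hsys.contDiff_q (eqState vstar u) (L h)
  rw [h2', h1'] at h3
  have hunit : IsUnit (srcV q (eqState vstar u)).det := (hsys.det_srcV_ne_zero hu).isUnit
  have h4 : (vPart (L h)).ofLp =
      (-((srcV q (eqState vstar u))⁻¹ * srcU q (eqState vstar u))) *ᵥ h.ofLp := by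
    have := congrArg (fun y => (srcV q (eqState vstar u))⁻¹ *ᵥ y) h3
    simp only [Matrix.mulVec_add, Matrix.mulVec_mulVec, Matrix.nonsing_inv_mul _ hunit,
      Matrix.one_mulVec] at this
    rw [Matrix.neg_mulVec, eq_neg_iff_add_eq_zero, add_comm, ← this]
    simp
  rw [fromRows_mulVec, ← h4, Matrix.one_mulVec]
  funext i
  rcases i with i | i
  · exact congrArg (fun x : EuclideanSpace ℝ (Fin n) => x i) h1'
  · rfl

lemma jacobian_relaxedFlux {u : EuclideanSpace ℝ (Fin n)} (hu : u ∈ Us) :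
    jacobian (relaxedFlux F vstar) u = relaxedJacobian F q (eqState vstar u) := by
  obtain ⟨L, hL, hL'⟩ := hsys.hasFDerivAt_eqState hu
  have hF := (hsys.contDiff_F.differentiable (by norm_num) (eqState vstar u)).hasFDerivAt
  refine jacobian_eq_of_hasFDerivAt ((projU n r).hasFDerivAt.comp u (hF.comp u hL)) fun h => ?_
  have h1 := fderiv_eq_jacobian_mulVec F (eqState vstar u) (L h)
  rw [relaxedJacobian, ← Matrix.mulVec_mulVec, ← hL']
  funext i
  exact congrFun h1 (Sum.inl i)

/-- Although `v^*` is only assumed `C¹`, the Jacobian of `f^*` is again `C¹`: it is a `C¹` function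
of the state, involving no derivative of `v^*`, composed with the `C¹` map `u ↦ (u, v^*(u))`. -/
lemma matC1On_jacobian_relaxedFlux : MatC1On (jacobian (relaxedFlux F vstar)) Us :=
  ((matC1On_relaxedJacobian hsys.contDiff_F hsys.contDiff_q).comp hsys.contDiffOn_eqState
    fun _ hu => hsys.eqState_mem hu).congr fun _ hu => hsys.jacobian_relaxedFlux hu

/-- Uniform resolvent bound for `q₂` at the equilibria over a compact set. -/
lemma exists_resolvent_bound {k : Set (EuclideanSpace ℝ (Fin n))} (hk : IsCompact k)
    (hkU : k ⊆ Us) : ∃ c : ℝ, 0 < c ∧ ∀ u ∈ k, ∀ l : ℂ, 0 ≤ l.re →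
      ∀ y : EuclideanSpace ℂ (Fin r),
        c * (‖y‖ * (1 + ‖l‖)) ≤ ‖l • y - cmul (srcV q (eqState vstar u)) y‖ := by
  have hkE : IsCompact (eqState vstar '' k) :=
    hk.image_of_continuousOn (hsys.contDiffOn_eqState.continuousOn.mono hkU)
  have hsub : eqState vstar '' k ⊆ regularSet q Us := by
    rintro _ ⟨u, hu, rfl⟩; exact hsys.eqState_mem (hkU hu)
  have hC1 := (relaxedJacobian_contDiff (Us := Us) hsys.contDiff_F hsys.contDiff_q).2.2.1
  obtain ⟨B, hB, hB1, -, -⟩ := hC1.exists_bound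
    (isOpen_regularSet hsys.contDiff_q hsys.isOpen_Us) hkE hsub
  -- Bounded `l` are treated by compactness, with `y` normalized to the unit sphere; the radius is
  -- such that for larger `l` the term `l y` dominates `q₂ y`.
  set T : Set (EuclideanSpace ℝ (Fin n) × ℂ × EuclideanSpace ℂ (Fin r)) :=
    k ×ˢ ((Metric.closedBall 0 (2 * B + 1) ∩ {l : ℂ | 0 ≤ l.re}) ×ˢ Metric.sphere 0 1) with hT
  have hTc : IsCompact T := hk.prod (((isCompact_closedBall _ _).inter_right
    (isClosed_le continuous_const Complex.continuous_re)).prod (isCompact_sphere _ _))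
  have hcm : ContinuousOn (fun t : EuclideanSpace ℝ (Fin n) × ℂ × EuclideanSpace ℂ (Fin r) =>
      cmul (srcV q (eqState vstar t.1)) t.2.2) T := by
    have hent : ∀ i j, ContinuousOn (fun t : EuclideanSpace ℝ (Fin n) × ℂ ×
        EuclideanSpace ℂ (Fin r) => srcV q (eqState vstar t.1) i j) T := fun i j =>
      ((hC1 i j).continuousOn.comp hsys.contDiffOn_eqState.continuousOn
        fun u hu => hsys.eqState_mem hu).comp continuousOn_fst fun t ht => hkU ht.1
    have : ContinuousOn (fun t : EuclideanSpace ℝ (Fin n) × ℂ × EuclideanSpace ℂ (Fin r) =>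
        fun i => ∑ j, (srcV q (eqState vstar t.1) i j : ℂ) * t.2.2 j) T := by
      refine continuousOn_pi.2 fun i => continuousOn_finsetSum _ fun j _ => ?_
      refine (Complex.continuous_ofReal.comp_continuousOn (hent i j)).mul ?_
      exact (by fun_prop : Continuous fun t : EuclideanSpace ℝ (Fin n) × ℂ ×
        EuclideanSpace ℂ (Fin r) => t.2.2 j).continuousOn
    exact (PiLp.continuous_toLp 2 _).comp_continuousOn this
  have hcont : ContinuousOn (fun t : EuclideanSpace ℝ (Fin n) × ℂ × EuclideanSpace ℂ (Fin r) =>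
      ‖t.2.1 • t.2.2 - cmul (srcV q (eqState vstar t.1)) t.2.2‖) T :=
    (ContinuousOn.sub (by fun_prop) hcm).norm
  obtain ⟨c, hc, hcT⟩ := hTc.exists_forall_le' hcont (a := 0) fun t ht => by
    rw [norm_pos_iff, sub_ne_zero]
    intro h
    have h0 := hsys.eq_zero_of_cmul_srcV (hkU ht.1) ht.2.1.2 h.symm
    have h1 : ‖t.2.2‖ = 1 := by simpa using ht.2.2
    rw [h0, norm_zero] at h1
    exact zero_ne_one h1
  -- On the ball `1 + ‖l‖ ≤ 2 B + 2`; outside it `‖l‖ - B ≥ (1 + ‖l‖) / 2`, so `1 / 4` is more than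
  -- enough.
  refine ⟨min (c / (2 * B + 2)) (1 / 4), by positivity, fun u hu l hl y => ?_⟩
  rcases le_or_gt ‖l‖ (2 * B + 1) with hle | hgt
  · have hy : c * ‖y‖ ≤ ‖l • y - cmul (srcV q (eqState vstar u)) y‖ := by
      rcases eq_or_ne y 0 with rfl | hy0
      · simp
      have hy1 : 0 < ‖y‖ := norm_pos_iff.2 hy0
      set s : ℂ := ((‖y‖⁻¹ : ℝ) : ℂ) with hs
      have hsn : ‖s‖ = ‖y‖⁻¹ := by rw [hs, Complex.norm_real, Real.norm_of_nonneg (by positivity)]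
      have := hcT (u, l, s • y) ⟨hu, ⟨by simpa using hle, hl⟩, by
        simp [norm_smul, hsn, hy1.ne']⟩
      simp only at this
      rw [cmul_smul, smul_comm, ← smul_sub, norm_smul, hsn] at this
      calc c * ‖y‖ ≤ ‖y‖⁻¹ * ‖l • y - cmul (srcV q (eqState vstar u)) y‖ * ‖y‖ := by gcongr
        _ = _ := by field_simp
    calc _ ≤ c / (2 * B + 2) * (‖y‖ * (1 + (2 * B + 1))) := by
          gcongr
          exact min_le_left _ _
      _ = c * ‖y‖ := by field_simp; ring
      _ ≤ _ := hy
  · have h1 : ‖cmul (srcV q (eqState vstar u)) y‖ ≤ B * ‖y‖ :=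
      (norm_cmul_le _ _).trans (by gcongr; exact hB1 _ ⟨u, hu, rfl⟩)
    have h2 : ‖l‖ * ‖y‖ - B * ‖y‖ ≤ ‖l • y - cmul (srcV q (eqState vstar u)) y‖ := by
      have := norm_sub_norm_le (l • y) (cmul (srcV q (eqState vstar u)) y)
      rw [norm_smul] at this
      linarith
    have h3 : min (c / (2 * B + 2)) (1 / 4) * (‖y‖ * (1 + ‖l‖)) ≤ 1 / 4 * (‖y‖ * (1 + ‖l‖)) := by
      gcongr
      exact min_le_right _ _
    nlinarith [norm_nonneg y]

end IsRelaxationSystem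

end Equilibrium

/-! ### The principal characteristic -/

section Spectral

/-- Finsler's argument: `max f g` is positive on the compact set, hence at least some `c > 0`. Where
`f` is the larger, `f` alone suffices; where `g` is the larger, `g ≥ c`, and `M` is chosen to
outweigh the lower bound `-|B|` of `f`. -/
lemma exists_pos_combination {X : Type*} [TopologicalSpace X] {T : Set X} (hT : IsCompact T)
    {f g : X → ℝ} (hf : ContinuousOn f T) (hg : ContinuousOn g T)
    (hg0 : ∀ t ∈ T, 0 ≤ g t) (hfg : ∀ t ∈ T, g t = 0 → 0 < f t) :
    ∃ M c : ℝ, 0 < M ∧ 0 < c ∧ ∀ t ∈ T, c ≤ f t + M * g t := by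
  have hmax : ContinuousOn (fun t => max (f t) (g t)) T := hf.sup hg
  obtain ⟨c, hc, hcT⟩ := hT.exists_forall_le' hmax (a := 0) fun t ht => by
    rcases (hg0 t ht).eq_or_lt with h | h
    · exact lt_max_of_lt_left (hfg t ht h.symm)
    · exact lt_max_of_lt_right h
  obtain ⟨B, hB⟩ := hT.exists_bound_of_continuousOn hf
  refine ⟨(|B| + c) / c, c, by positivity, hc, fun t ht => ?_⟩
  have hfB : -|B| ≤ f t :=
    (neg_le_neg ((hB t ht).trans (le_abs_self B))).trans (neg_le_of_abs_le le_rfl)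
  rcases le_total (g t) (f t) with h | h
  · have h1 := hcT t ht
    rw [max_eq_left h] at h1
    have : 0 ≤ (|B| + c) / c * g t := mul_nonneg (by positivity) (hg0 t ht)
    linarith
  · have h1 := hcT t ht
    rw [max_eq_right h] at h1
    have : |B| + c ≤ (|B| + c) / c * g t := by
      calc |B| + c = (|B| + c) / c * c := by field_simp
        _ ≤ _ := by gcongr
    linarith

lemma continuousOn_mulVec {X ι κ : Type*} [TopologicalSpace X] [Fintype ι] {T : Set X}
    {A : X → Matrix κ ι ℝ} {y : X → ι → ℝ} (hA : ∀ i j, ContinuousOn (fun t => A t i j) T)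
    (hy : ∀ j, ContinuousOn (fun t => y t j) T) : ContinuousOn (fun t => A t *ᵥ y t) T := by
  refine continuousOn_pi.2 fun i => ?_
  simp only [Matrix.mulVec, dotProduct]
  exact continuousOn_finsetSum _ fun j _ => (hA i j).mul (hy j)

lemma continuousOn_dotProduct {X ι : Type*} [TopologicalSpace X] [Fintype ι] {T : Set X}
    {x y : X → ι → ℝ} (hx : ∀ j, ContinuousOn (fun t => x t j) T)
    (hy : ∀ j, ContinuousOn (fun t => y t j) T) : ContinuousOn (fun t => x t ⬝ᵥ y t) T := by
  simp only [dotProduct]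
  exact continuousOn_finsetSum _ fun j _ => (hx j).mul (hy j)

lemma dotProduct_self_ofLp {ι : Type*} [Fintype ι] (y : EuclideanSpace ℝ ι) :
    y.ofLp ⬝ᵥ y.ofLp = ‖y‖ ^ 2 := by
  rw [EuclideanSpace.norm_sq_eq]
  simp [dotProduct, sq]

variable {n r : ℕ} {F : State n r → State n r} {q : State n r → EuclideanSpace ℝ (Fin r)}
  {vstar : EuclideanSpace ℝ (Fin n) → EuclideanSpace ℝ (Fin r)}
  {U : Set (EuclideanSpace ℝ (Fin n))} {V : Set (EuclideanSpace ℝ (Fin r))}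
  {𝒲 : Set (State n r)} {Us : Set (EuclideanSpace ℝ (Fin n))}
  {a₀ : EuclideanSpace ℝ (Fin n) → Matrix (Fin n) (Fin n) ℝ} {c₀ : ℝ}
  {α₀ : EuclideanSpace ℝ (Fin n) → ℝ}
  {r₀ : EuclideanSpace ℝ (Fin n) → EuclideanSpace ℝ (Fin n)}

namespace AssumptionB3

variable (hB3 : AssumptionB3 F vstar Us c₀ α₀ r₀) {u : EuclideanSpace ℝ (Fin n)} (hu : u ∈ Us)

include hB3 hu

/-- The spectral gap: no eigenvalue other than `α₀` lies in `|μ| < 2 c₀`. It identifies limits of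
principal eigenvalues, and a zero eigenvalue, with `α₀` without assuming continuity of `α₀`. -/
lemma eigenvalue_eq {y : Fin n → ℝ} (hy : y ≠ 0) {μ : ℝ}
    (h : jacobian (relaxedFlux F vstar) u *ᵥ y = μ • y) (hμ : |μ| < 2 * c₀) : μ = α₀ u := by
  by_contra hne
  have h1 := isRoot_charpoly_of_mulVec_eq hy h
  have h2 := h1.map (f := Complex.ofRealHom)
  have h3 : ((jacobian (relaxedFlux F vstar) u).map Complex.ofReal).charpoly =
      (jacobian (relaxedFlux F vstar) u).charpoly.map Complex.ofRealHom :=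
    Matrix.charpoly_map _ Complex.ofRealHom
  have h4 := hB3.others u hu (μ : ℂ) (by rw [h3]; exact h2) (by exact_mod_cast hne)
  rw [Complex.norm_real, Real.norm_eq_abs] at h4
  linarith

lemma r₀_ne_zero : (r₀ u).ofLp ≠ 0 := by
  intro h
  have h1 := hB3.unit u hu
  have h2 : r₀ u = 0 := by ext i; exact congrFun h i
  rw [h2, norm_zero] at h1
  exact zero_ne_one h1

lemma eigenvector_eq {y : Fin n → ℝ}
    (h : jacobian (relaxedFlux F vstar) u *ᵥ y = α₀ u • y) : ∃ t : ℝ, y = t • (r₀ u).ofLp :=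
  exists_smul_eq_of_simple (hB3.simple u hu) (hB3.r₀_ne_zero hu) (hB3.eigenvector u hu) h

/-- At a point of nondifferentiability `fderiv` is `0` by convention, and then `η` would vanish.
Thus genuine nonlinearity carries the regularity of `α₀`. -/
lemma differentiableAt_α₀ : DifferentiableAt ℝ α₀ u := by
  by_contra h
  exact hB3.genuinelyNonlinear u hu (by rw [gnl, fderiv_zero_of_not_differentiableAt h]; rfl)

end AssumptionB3

/-- The derivative of the principal eigenvalue through the symmetrized eigenvalue problem. -/
lemma fderiv_α₀_eq (hsys : IsRelaxationSystem F q vstar U V 𝒲 Us)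
    (hB1 : AssumptionB1 F q vstar Us a₀) (hB3 : AssumptionB3 F vstar Us c₀ α₀ r₀)
    {u : EuclideanSpace ℝ (Fin n)} (hu : u ∈ Us) (h : EuclideanSpace ℝ (Fin n)) :
    (r₀ u).ofLp ⬝ᵥ dmat (fun u => a₀ u * jacobian (relaxedFlux F vstar) u) u h *ᵥ (r₀ u).ofLp =
      fderiv ℝ α₀ u h * ((r₀ u).ofLp ⬝ᵥ a₀ u *ᵥ (r₀ u).ofLp)
        + α₀ u * ((r₀ u).ofLp ⬝ᵥ dmat a₀ u h *ᵥ (r₀ u).ofLp) := by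
  have hC := hsys.matC1On_jacobian_relaxedFlux
  have hC0 : MatC1On a₀ Us := hB1.contDiffOn
  set a := jacobian (relaxedFlux F vstar) with ha
  have hC1 : MatC1On (fun u => a₀ u * a u) Us := hC0.mul hC
  have hd0 := hB3.differentiableAt_α₀ hu
  -- `G = a₀ a - α₀ a₀` is symmetric and annihilates `r₀`. Its derivative, tested with `r₀`, yields
  -- the identity without differentiating `r₀`.
  set G : EuclideanSpace ℝ (Fin n) → Matrix (Fin n) (Fin n) ℝ :=
    fun x => a₀ x * a x - α₀ x • a₀ x with hG
  set G' : Matrix (Fin n) (Fin n) ℝ := dmat (fun u => a₀ u * a u) u h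
    - (fderiv ℝ α₀ u h • a₀ u + α₀ u • dmat a₀ u h) with hG'
  have hline : HasDerivAt (fun t : ℝ => u + t • h) h 0 := by
    simpa using ((hasDerivAt_id (0 : ℝ)).smul_const h).const_add u
  have hline0 : u + (0 : ℝ) • h = u := by simp
  have hGd : ∀ i j, HasDerivAt (fun t : ℝ => G (u + t • h) i j) (G' i j) 0 := fun i j => by
    have e1 := hC1.hasDerivAt hsys.isOpen_Us hline (by simpa using hu) i j
    have e2 := hC0.hasDerivAt hsys.isOpen_Us hline (by simpa using hu) i j
    have e3 : HasDerivAt (fun t : ℝ => α₀ (u + t • h)) (fderiv ℝ α₀ u h) 0 := by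
      have : HasFDerivAt α₀ (fderiv ℝ α₀ u) ((fun t : ℝ => u + t • h) 0) := by
        simpa only [hline0] using hd0.hasFDerivAt
      exact this.comp_hasDerivAt 0 hline
    rw [hline0] at e1 e2
    have := e1.sub (e3.mul e2)
    simp only [zero_smul, add_zero] at this
    exact this
  set t : ℕ → ℝ := fun m => 1 / ((m : ℝ) + 1) with ht
  have ht0 : Tendsto t atTop (𝓝 0) := tendsto_one_div_add_atTop_nhds_zero_nat
  have htne : ∀ m, t m ≠ 0 := fun m => by rw [ht]; positivity
  have ht0' : Tendsto t atTop (𝓝[≠] 0) :=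
    tendsto_nhdsWithin_iff.2 ⟨ht0, Eventually.of_forall htne⟩
  have hx : Tendsto (fun m => u + t m • h) atTop (𝓝 u) := by
    have := (ht0.smul_const h).const_add u
    simpa using this
  have hxU : ∀ᶠ m in atTop, u + t m • h ∈ Us := hx (hsys.isOpen_Us.mem_nhds hu)
  -- The eigenvector field `r₀` need not be continuous. Along a subsequence it converges to a unit
  -- eigenvector `ρ` at `u`, which by simplicity is a nonzero multiple of `r₀ u`.
  obtain ⟨ρ, hρ, φ, hφ, hlim⟩ := (isCompact_sphere (0 : EuclideanSpace ℝ (Fin n)) 1).tendsto_subseq'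
    (x := fun m => r₀ (u + t m • h)) (hxU.mono fun m hm => by simpa using hB3.unit _ hm).frequently
  have hlimi : ∀ j, Tendsto (fun m => r₀ (u + t (φ m) • h) j) atTop (𝓝 (ρ j)) := fun j =>
    ((by fun_prop : Continuous fun y : EuclideanSpace ℝ (Fin n) => y j).tendsto ρ).comp hlim
  have hxφ := hx.comp hφ.tendsto_atTop
  have hxUφ := hφ.tendsto_atTop.eventually hxU
  have hρeig : a u *ᵥ ρ.ofLp = α₀ u • ρ.ofLp := by
    funext i
    have l1 : Tendsto (fun m => (a (u + t (φ m) • h) *ᵥ (r₀ (u + t (φ m) • h)).ofLp) i) atTop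
        (𝓝 ((a u *ᵥ ρ.ofLp) i)) := by
      simp only [Matrix.mulVec, dotProduct]
      refine tendsto_finsetSum _ fun j _ => Tendsto.mul ?_ (hlimi j)
      exact (((hC i j).continuousOn.continuousAt (hsys.isOpen_Us.mem_nhds hu)).tendsto).comp hxφ
    have l2 : Tendsto (fun m => α₀ (u + t (φ m) • h) * r₀ (u + t (φ m) • h) i) atTop
        (𝓝 (α₀ u * ρ i)) := (hd0.continuousAt.tendsto.comp hxφ).mul (hlimi i)
    refine tendsto_nhds_unique (l1.congr' ?_) l2
    filter_upwards [hxUφ] with m hm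
    have := congrFun (hB3.eigenvector _ hm) i
    simpa using this
  obtain ⟨s, hs⟩ := hB3.eigenvector_eq hu hρeig
  have hs0 : s ≠ 0 := by
    rintro rfl
    have h1 : ‖ρ‖ = 1 := by simpa using hρ
    have h2 : ρ = 0 := by ext i; simpa using congrFun hs i
    rw [h2, norm_zero] at h1
    exact zero_ne_one h1
  have hGsymm : (G u).IsSymm := by
    refine (hB1.isSymm u hu).sub (IsSymm.smul ?_ _)
    have := (hB1.posDef u hu).isHermitian
    rwa [Matrix.IsHermitian, conjTranspose_eq_transpose_of_trivial] at this
  have hGr : ∀ x ∈ Us, G x *ᵥ (r₀ x).ofLp = 0 := fun x hx => by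
    rw [hG]
    simp only
    rw [Matrix.sub_mulVec, ← Matrix.mulVec_mulVec, hB3.eigenvector x hx, Matrix.smul_mulVec]
    simp [Matrix.mulVec_smul]
  have hrG : (r₀ u).ofLp ᵥ* G u = 0 := by
    rw [← Matrix.mulVec_transpose, hGsymm.eq, hGr u hu]
  -- In the difference quotient of `G`, the right factor is killed by `G` at the moving point, and
  -- the left factor `r₀ u` by `G u` through symmetry; only the limit `r₀ᵀ G' ρ = 0` remains.
  have hzero : (r₀ u).ofLp ⬝ᵥ G' *ᵥ ρ.ofLp = 0 := by
    have l1 : Tendsto (fun m => (r₀ u).ofLp ⬝ᵥ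
        ((t (φ m))⁻¹ • (G (u + t (φ m) • h) - G u)) *ᵥ (r₀ (u + t (φ m) • h)).ofLp) atTop
        (𝓝 ((r₀ u).ofLp ⬝ᵥ G' *ᵥ ρ.ofLp)) := by
      simp only [Matrix.mulVec, dotProduct]
      refine tendsto_finsetSum _ fun i _ => Tendsto.const_mul _ ?_
      refine tendsto_finsetSum _ fun j _ => Tendsto.mul ?_ (hlimi j)
      have := ((hGd i j).tendsto_slope_zero).comp (ht0'.comp hφ.tendsto_atTop)
      simpa [Function.comp_def] using this
    refine tendsto_nhds_unique (l1.congr' ?_) tendsto_const_nhds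
    filter_upwards [hxUφ] with m hm
    rw [Matrix.smul_mulVec, Matrix.sub_mulVec, hGr _ hm, zero_sub, smul_neg, dotProduct_neg,
      dotProduct_smul, Matrix.dotProduct_mulVec, hrG]
    simp
  rw [hs, Matrix.mulVec_smul, dotProduct_smul, smul_eq_zero, or_iff_right hs0, hG',
    Matrix.sub_mulVec, Matrix.add_mulVec, Matrix.smul_mulVec, Matrix.smul_mulVec, dotProduct_sub,
    dotProduct_add, dotProduct_smul, dotProduct_smul, sub_eq_zero] at hzero
  exact hzero

/-- The direction of the profile, `-sgn(η) r₀`. -/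
def shockDir (α₀ : EuclideanSpace ℝ (Fin n) → ℝ)
    (r₀ : EuclideanSpace ℝ (Fin n) → EuclideanSpace ℝ (Fin n))
    (u : EuclideanSpace ℝ (Fin n)) : EuclideanSpace ℝ (Fin n) :=
  -(Real.sign (gnl α₀ r₀ u) • r₀ u)

lemma fderiv_shockDir (u : EuclideanSpace ℝ (Fin n)) :
    fderiv ℝ α₀ u (shockDir α₀ r₀ u) = -|gnl α₀ r₀ u| := by
  rw [shockDir, map_neg, map_smul, smul_eq_mul, ← gnl]
  rcases lt_trichotomy (gnl α₀ r₀ u) 0 with h | h | h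
  · rw [Real.sign_of_neg h, abs_of_neg h]; ring
  · rw [h]; simp
  · rw [Real.sign_of_pos h, abs_of_pos h]; ring

variable (F vstar a₀) in
/-- The quadratic form of the derivative of the symmetrized eigenvalue problem. -/
def dEig (ξ : EuclideanSpace ℝ (Fin n)) (α : ℝ) (u : EuclideanSpace ℝ (Fin n)) : ℝ :=
  ξ.ofLp ⬝ᵥ dmat (fun u => a₀ u * jacobian (relaxedFlux F vstar) u) u ξ *ᵥ ξ.ofLp
    - α * (ξ.ofLp ⬝ᵥ dmat a₀ u ξ *ᵥ ξ.ofLp)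

variable (F vstar a₀ c₀) in
/-- Triples of a state, a characteristic direction of decreasing principal eigenvalue, and the
eigenvalue. -/
def charSet (k : Set (EuclideanSpace ℝ (Fin n))) :
    Set (EuclideanSpace ℝ (Fin n) × EuclideanSpace ℝ (Fin n) × ℝ) :=
  {t | t ∈ k ×ˢ (Metric.sphere 0 1 ×ˢ Metric.closedBall 0 c₀) ∧
    jacobian (relaxedFlux F vstar) t.1 *ᵥ t.2.1.ofLp - t.2.2 • t.2.1.ofLp = 0 ∧
    dEig F vstar a₀ t.2.1 t.2.2 t.1 ≤ 0}

section

variable (hsys : IsRelaxationSystem F q vstar U V 𝒲 Us)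
  (hB1 : AssumptionB1 F q vstar Us a₀) (hB3 : AssumptionB3 F vstar Us c₀ α₀ r₀)
  {k : Set (EuclideanSpace ℝ (Fin n))} (hk : IsCompact k) (hkU : k ⊆ Us)

include hsys hB1 hkU

lemma continuousOn_dEig :
    ContinuousOn (fun t : EuclideanSpace ℝ (Fin n) × EuclideanSpace ℝ (Fin n) × ℝ =>
      dEig F vstar a₀ t.2.1 t.2.2 t.1)
      (k ×ˢ (Metric.sphere 0 1 ×ˢ Metric.closedBall 0 c₀)) := by
  have hC := hsys.matC1On_jacobian_relaxedFlux
  have hC0 : MatC1On a₀ Us := hB1.contDiffOn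
  have hC1 := hC0.mul hC
  have hpair : ContinuousOn (fun t : EuclideanSpace ℝ (Fin n) × EuclideanSpace ℝ (Fin n) × ℝ =>
      (t.1, t.2.1)) (k ×ˢ (Metric.sphere 0 1 ×ˢ Metric.closedBall 0 c₀)) := by fun_prop
  have hξ : ∀ j, ContinuousOn (fun t : EuclideanSpace ℝ (Fin n) × EuclideanSpace ℝ (Fin n) × ℝ =>
      t.2.1.ofLp j) (k ×ˢ (Metric.sphere 0 1 ×ˢ Metric.closedBall 0 c₀)) := fun j => by fun_prop
  have hmaps : Set.MapsTo (fun t : EuclideanSpace ℝ (Fin n) × EuclideanSpace ℝ (Fin n) × ℝ =>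
      (t.1, t.2.1)) (k ×ˢ (Metric.sphere 0 1 ×ˢ Metric.closedBall 0 c₀)) (Us ×ˢ Set.univ) :=
    fun t ht => ⟨hkU ht.1, trivial⟩
  refine ContinuousOn.sub (continuousOn_dotProduct hξ ?_)
    (ContinuousOn.mul (by fun_prop) (continuousOn_dotProduct hξ ?_))
  · exact continuousOn_pi.1 (continuousOn_mulVec (fun i j =>
      (hC1.continuousOn_dmat hsys.isOpen_Us i j).comp hpair hmaps) hξ)
  · exact continuousOn_pi.1 (continuousOn_mulVec (fun i j =>
      (hC0.continuousOn_dmat hsys.isOpen_Us i j).comp hpair hmaps) hξ)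

-- All defining conditions are closed and involve neither `r₀` nor `α₀`, which are not assumed
-- continuous. Replacing them by a unit eigenvector and an eigenvalue as free variables makes
-- compactness arguments available.
include hk in
lemma isCompact_charSet : IsCompact (charSet F vstar a₀ c₀ k) := by
  have hC := hsys.matC1On_jacobian_relaxedFlux
  have hP : IsCompact (k ×ˢ ((Metric.sphere (0 : EuclideanSpace ℝ (Fin n)) 1) ×ˢ
      Metric.closedBall (0 : ℝ) c₀)) :=
    hk.prod ((isCompact_sphere _ _).prod (isCompact_closedBall _ _))
  have hξ : ∀ j, ContinuousOn (fun t : EuclideanSpace ℝ (Fin n) × EuclideanSpace ℝ (Fin n) × ℝ =>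
      t.2.1.ofLp j) (k ×ˢ (Metric.sphere 0 1 ×ˢ Metric.closedBall 0 c₀)) := fun j => by fun_prop
  have h1 : ContinuousOn (fun t : EuclideanSpace ℝ (Fin n) × EuclideanSpace ℝ (Fin n) × ℝ =>
      jacobian (relaxedFlux F vstar) t.1 *ᵥ t.2.1.ofLp - t.2.2 • t.2.1.ofLp)
      (k ×ˢ (Metric.sphere 0 1 ×ˢ Metric.closedBall 0 c₀)) := by
    refine ContinuousOn.sub (continuousOn_mulVec (fun i j => ?_) hξ) (by fun_prop)
    exact (hC i j).continuousOn.comp continuousOn_fst fun t ht => hkU ht.1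
  have h2 := continuousOn_dEig (c₀ := c₀) hsys hB1 hkU
  have h3 := (h1.prodMk h2).preimage_isClosed_of_isClosed hP.isClosed
    ((isClosed_singleton (x := (0 : Fin n → ℝ))).prod (isClosed_Iic (a := (0 : ℝ))))
  exact hP.of_isClosed_subset (t := charSet F vstar a₀ c₀ k) h3 fun t ht => ht.1

include hB3

/-- The gap gives `α = α₀` and simplicity gives `ξ = s r₀`, so that `dEig` equals `s³ η ⟨r₀, a₀
r₀⟩`, which is nonzero. The closed condition `dEig ≤ 0` is therefore automatically strict. -/
lemma charSet_spec {t : EuclideanSpace ℝ (Fin n) × EuclideanSpace ℝ (Fin n) × ℝ}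
    (ht : t ∈ charSet F vstar a₀ c₀ k) : t.2.2 = α₀ t.1 ∧
      (∃ s : ℝ, t.2.1 = s • r₀ t.1) ∧ dEig F vstar a₀ t.2.1 t.2.2 t.1 < 0 := by
  obtain ⟨u, ξ, α⟩ := t
  obtain ⟨⟨hu, hξ, hα⟩, heig, hd⟩ := ht
  simp only at *
  have hξ1 : ‖ξ‖ = 1 := by simpa using hξ
  have hξ0 : ξ.ofLp ≠ 0 := fun h => by
    have : ξ = 0 := by ext i; exact congrFun h i
    rw [this, norm_zero] at hξ1
    exact zero_ne_one hξ1
  have hα' : |α| ≤ c₀ := by simpa using hα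
  have hαe := hB3.eigenvalue_eq (hkU hu) hξ0 (sub_eq_zero.1 heig)
    (by linarith [hB3.c₀_pos])
  obtain ⟨s, hs⟩ := hB3.eigenvector_eq (hkU hu) (by rw [← hαe]; exact sub_eq_zero.1 heig)
  have hs' : ξ = s • r₀ u := by ext i; exact congrFun hs i
  refine ⟨hαe, ⟨s, hs'⟩, lt_of_le_of_ne hd ?_⟩
  have hs0 : s ≠ 0 := by
    rintro rfl
    rw [zero_smul] at hs
    exact hξ0 hs
  have hid := fderiv_α₀_eq hsys hB1 hB3 (hkU hu) ξ
  have hpos : 0 < (r₀ u).ofLp ⬝ᵥ a₀ u *ᵥ (r₀ u).ofLp := by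
    have := (hB1.posDef u (hkU hu)).dotProduct_mulVec_pos (hB3.r₀_ne_zero (hkU hu))
    simpa using this
  have hval : dEig F vstar a₀ ξ α u =
      s ^ 2 * (fderiv ℝ α₀ u ξ * ((r₀ u).ofLp ⬝ᵥ a₀ u *ᵥ (r₀ u).ofLp)) := by
    have e : ∀ M : Matrix (Fin n) (Fin n) ℝ, ξ.ofLp ⬝ᵥ M *ᵥ ξ.ofLp =
        s ^ 2 * ((r₀ u).ofLp ⬝ᵥ M *ᵥ (r₀ u).ofLp) := fun M => by
      rw [hs, Matrix.mulVec_smul, dotProduct_smul, smul_dotProduct]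
      simp only [smul_eq_mul]; ring
    rw [dEig, e, e, hid, hαe]; ring
  have hfd : fderiv ℝ α₀ u ξ = s * gnl α₀ r₀ u := by rw [hs', map_smul, gnl, smul_eq_mul]
  rw [hval, hfd]
  exact mul_ne_zero (pow_ne_zero _ hs0) (mul_ne_zero
    (mul_ne_zero hs0 (hB3.genuinelyNonlinear u (hkU hu))) hpos.ne')

/-- The quadratic forms do not see the sign in `ξ = -sgn(η) r₀`, whereas `dα₀(ξ) = -|η|`. This
places the shock direction in the compact set on which bounds are uniform. -/
lemma shockDir_spec {u : EuclideanSpace ℝ (Fin n)} (hu : u ∈ k) :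
    (u, shockDir α₀ r₀ u, α₀ u) ∈ charSet F vstar a₀ c₀ k ∧ ‖shockDir α₀ r₀ u‖ = 1 ∧
      dEig F vstar a₀ (shockDir α₀ r₀ u) (α₀ u) u =
        -|gnl α₀ r₀ u| * ((r₀ u).ofLp ⬝ᵥ a₀ u *ᵥ (r₀ u).ofLp) := by
  have hg := hB3.genuinelyNonlinear u (hkU hu)
  set σ := Real.sign (gnl α₀ r₀ u) with hσ
  have hσ2 : σ ^ 2 = 1 := by
    rcases hg.lt_or_gt with h | h
    · rw [hσ, Real.sign_of_neg h]; norm_num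
    · rw [hσ, Real.sign_of_pos h]; norm_num
  have hσn : |σ| = 1 := by
    rw [← sq_abs] at hσ2
    exact (pow_eq_one_iff_of_nonneg (abs_nonneg σ) two_ne_zero).1 hσ2
  have hξ : shockDir α₀ r₀ u = (-σ) • r₀ u := by rw [shockDir, neg_smul]
  have hn : ‖shockDir α₀ r₀ u‖ = 1 := by
    rw [hξ, norm_smul, norm_neg, Real.norm_eq_abs, hσn, hB3.unit u (hkU hu), one_mul]
  have hval : dEig F vstar a₀ (shockDir α₀ r₀ u) (α₀ u) u =
      -|gnl α₀ r₀ u| * ((r₀ u).ofLp ⬝ᵥ a₀ u *ᵥ (r₀ u).ofLp) := by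
    have hid := fderiv_α₀_eq hsys hB1 hB3 (hkU hu) (shockDir α₀ r₀ u)
    have e : ∀ M : Matrix (Fin n) (Fin n) ℝ, (shockDir α₀ r₀ u).ofLp ⬝ᵥ M *ᵥ
        (shockDir α₀ r₀ u).ofLp = (r₀ u).ofLp ⬝ᵥ M *ᵥ (r₀ u).ofLp := fun M => by
      have e1 : (shockDir α₀ r₀ u).ofLp = (-σ) • (r₀ u).ofLp := by rw [hξ]; rfl
      rw [e1, Matrix.mulVec_smul, dotProduct_smul, smul_dotProduct, smul_eq_mul, smul_eq_mul,
        ← mul_assoc, ← sq, neg_sq, hσ2, one_mul]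
    rw [dEig, e, e, hid, fderiv_shockDir]; ring
  have hpos : 0 < (r₀ u).ofLp ⬝ᵥ a₀ u *ᵥ (r₀ u).ofLp := by
    have := (hB1.posDef u (hkU hu)).dotProduct_mulVec_pos (hB3.r₀_ne_zero (hkU hu))
    simpa using this
  refine ⟨⟨⟨hu, by simpa using hn, by simpa using (hB3.abs_lt u (hkU hu)).le⟩, ?_, ?_⟩, hn, hval⟩
  · have e1 : (shockDir α₀ r₀ u).ofLp = (-σ) • (r₀ u).ofLp := by rw [hξ]; rfl
    simp only
    rw [e1, Matrix.mulVec_smul, hB3.eigenvector u (hkU hu), smul_comm (α₀ u)]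
    exact sub_self _
  · simp only
    rw [hval]
    nlinarith [abs_nonneg (gnl α₀ r₀ u)]

include hk

/-- Uniform genuine nonlinearity on compact sets. -/
lemma exists_gnl_bound : ∃ c : ℝ, 0 < c ∧ ∀ u ∈ k, c ≤ |gnl α₀ r₀ u| := by
  have hC0 : MatC1On a₀ Us := hB1.contDiffOn
  obtain ⟨B, hB, hB1', -, -⟩ := hC0.exists_bound hsys.isOpen_Us hk hkU
  have hcont : ContinuousOn (fun t : EuclideanSpace ℝ (Fin n) × EuclideanSpace ℝ (Fin n) × ℝ =>
      dEig F vstar a₀ t.2.1 t.2.2 t.1) (charSet F vstar a₀ c₀ k) :=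
    (continuousOn_dEig (c₀ := c₀) hsys hB1 hkU).mono fun t ht => ht.1
  -- `-dEig` has a positive minimum on the compact set; in the shock direction it equals `|η| ⟨r₀,
  -- a₀ r₀⟩`, and `a₀` is bounded.
  obtain ⟨c, hc, hcT⟩ := (isCompact_charSet (c₀ := c₀) hsys hB1 hk hkU).exists_forall_le'
    hcont.neg (a := 0) fun t ht => neg_pos.2 (charSet_spec hsys hB1 hB3 hkU ht).2.2
  refine ⟨c / B, by positivity, fun u hu => ?_⟩
  obtain ⟨h1, -, h3⟩ := shockDir_spec hsys hB1 hB3 hkU hu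
  have h4 : c ≤ -dEig F vstar a₀ (shockDir α₀ r₀ u) (α₀ u) u := hcT _ h1
  rw [h3] at h4
  have h5 := le_of_abs_le (abs_dotProduct_mulVec_le (a₀ u) (r₀ u).ofLp)
  rw [dotProduct_self_ofLp, hB3.unit u (hkU hu), one_pow, mul_one] at h5
  have h6 := h5.trans (hB1' u hu)
  rw [div_le_iff₀ hB]
  have : |gnl α₀ r₀ u| * ((r₀ u).ofLp ⬝ᵥ a₀ u *ᵥ (r₀ u).ofLp) ≤ |gnl α₀ r₀ u| * B := by gcongr
  linarith

/-- Compression in the characteristic direction, and control of the other directions through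
the relaxed Jacobian. -/
lemma exists_compression : ∃ M c : ℝ, 0 < M ∧ 0 < c ∧ ∀ u ∈ k, ∀ y : Fin n → ℝ,
    c * (y ⬝ᵥ y) ≤
      -(y ⬝ᵥ dmat (fun u => a₀ u * jacobian (relaxedFlux F vstar) u) u
          (shockDir α₀ r₀ u) *ᵥ y) / 2
        + M * ((jacobian (relaxedFlux F vstar) u *ᵥ y) ⬝ᵥ
            (jacobian (relaxedFlux F vstar) u *ᵥ y)) := by
  have hC := hsys.matC1On_jacobian_relaxedFlux
  have hC0 : MatC1On a₀ Us := hB1.contDiffOn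
  have hC1 := hC0.mul hC
  set T := charSet F vstar a₀ c₀ k ×ˢ Metric.sphere (0 : EuclideanSpace ℝ (Fin n)) 1 with hT
  have hTc : IsCompact T :=
    (isCompact_charSet (c₀ := c₀) hsys hB1 hk hkU).prod (isCompact_sphere _ _)
  have hy : ∀ j, ContinuousOn (fun t : (EuclideanSpace ℝ (Fin n) × EuclideanSpace ℝ (Fin n) × ℝ) ×
      EuclideanSpace ℝ (Fin n) => t.2.ofLp j) T := fun j => by fun_prop
  have hf : ContinuousOn (fun t : (EuclideanSpace ℝ (Fin n) × EuclideanSpace ℝ (Fin n) × ℝ) ×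
      EuclideanSpace ℝ (Fin n) => -(t.2.ofLp ⬝ᵥ dmat (fun u => a₀ u *
        jacobian (relaxedFlux F vstar) u) t.1.1 t.1.2.1 *ᵥ t.2.ofLp) / 2) T := by
    refine (ContinuousOn.neg (continuousOn_dotProduct hy ?_)).div_const 2
    refine continuousOn_pi.1 (continuousOn_mulVec (fun i j => ?_) hy)
    exact (hC1.continuousOn_dmat hsys.isOpen_Us i j).comp (f := fun t :
      (EuclideanSpace ℝ (Fin n) × EuclideanSpace ℝ (Fin n) × ℝ) × EuclideanSpace ℝ (Fin n) =>
        (t.1.1, t.1.2.1)) (by fun_prop) fun t ht => ⟨hkU ht.1.1.1, trivial⟩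
  have hay : ∀ i, ContinuousOn (fun t : (EuclideanSpace ℝ (Fin n) × EuclideanSpace ℝ (Fin n) × ℝ) ×
      EuclideanSpace ℝ (Fin n) => (jacobian (relaxedFlux F vstar) t.1.1 *ᵥ t.2.ofLp) i) T := by
    refine continuousOn_pi.1 (continuousOn_mulVec (fun i j => ?_) hy)
    exact (hC i j).continuousOn.comp (f := fun t :
      (EuclideanSpace ℝ (Fin n) × EuclideanSpace ℝ (Fin n) × ℝ) × EuclideanSpace ℝ (Fin n) =>
        t.1.1) (by fun_prop) fun t ht => hkU ht.1.1.1
  obtain ⟨M, c, hM, hc, hTle⟩ := exists_pos_combination hTc hf (continuousOn_dotProduct hay hay)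
    (fun t _ => Finset.sum_nonneg fun i _ => mul_self_nonneg _) (by
      rintro ⟨⟨u, ξ, α⟩, y⟩ ⟨ht, hy1⟩ h0
      obtain ⟨hα, ⟨s, hs⟩, hneg⟩ := charSet_spec hsys hB1 hB3 hkU ht
      simp only at *
      have hu := hkU ht.1.1
      have hyn : ‖y‖ = 1 := by simpa using hy1
      -- Where the second form vanishes, `y` is a null vector of `a`. Hence `α₀ = 0` and `y` is
      -- parallel to `ξ`, so the first form is a positive multiple of `-dEig`.
      have hay0 : jacobian (relaxedFlux F vstar) u *ᵥ y.ofLp = 0 := dotProduct_self_eq_zero.1 h0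
      have hy0 : y.ofLp ≠ 0 := fun h => by
        have : y = 0 := by ext i; exact congrFun h i
        rw [this, norm_zero] at hyn
        exact zero_ne_one hyn
      have hα0 := hB3.eigenvalue_eq hu hy0 (μ := 0) (by rw [hay0, zero_smul])
        (by rw [abs_zero]; linarith [hB3.c₀_pos])
      obtain ⟨τ, hτ⟩ := hB3.eigenvector_eq hu (y := y.ofLp) (by rw [← hα0, hay0, zero_smul])
      have hs0 : s ≠ 0 := by
        rintro rfl
        have : ‖ξ‖ = 1 := by simpa using ht.1.2.1
        rw [hs, zero_smul, norm_zero] at this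
        exact zero_ne_one this
      have hτ0 : τ ≠ 0 := by
        rintro rfl
        rw [zero_smul] at hτ
        exact hy0 hτ
      have hyξ : y.ofLp = (τ / s) • ξ.ofLp := by
        have : ξ.ofLp = s • (r₀ u).ofLp := by rw [hs]; rfl
        rw [this, smul_smul, div_mul_cancel₀ _ hs0, hτ]
      rw [dEig, hα, ← hα0, zero_mul, sub_zero] at hneg
      rw [hyξ, Matrix.mulVec_smul, dotProduct_smul, smul_dotProduct, smul_eq_mul, smul_eq_mul,
        ← mul_assoc]
      have h2 : 0 < τ / s * (τ / s) := mul_self_pos.2 (div_ne_zero hτ0 hs0)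
      have := mul_neg_of_pos_of_neg h2 hneg
      linarith)
  refine ⟨M, c, hM, hc, fun u hu y => ?_⟩
  rcases eq_or_ne y 0 with rfl | hy0
  · simp
  set ye : EuclideanSpace ℝ (Fin n) := WithLp.toLp 2 y with hye
  have hyn : 0 < ‖ye‖ := norm_pos_iff.2 fun h => hy0 (by
    have := congrArg WithLp.ofLp h
    simpa [hye] using this)
  have h1 := hTle ((u, shockDir α₀ r₀ u, α₀ u), ‖ye‖⁻¹ • ye)
    ⟨(shockDir_spec hsys hB1 hB3 hkU hu).1, by simp [norm_smul, hyn.ne']⟩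
  simp only at h1
  have e1 : (‖ye‖⁻¹ • ye).ofLp = ‖ye‖⁻¹ • y := rfl
  rw [e1, Matrix.mulVec_smul, Matrix.mulVec_smul, dotProduct_smul, smul_dotProduct,
    dotProduct_smul, smul_dotProduct] at h1
  simp only [smul_eq_mul] at h1
  have e2 : y ⬝ᵥ y = ‖ye‖ ^ 2 := dotProduct_self_ofLp ye
  rw [e2]
  have h2 := mul_le_mul_of_nonneg_right h1 (sq_nonneg ‖ye‖)
  refine h2.trans (le_of_eq ?_)
  field_simp

end

end Spectral

/-! ### Small-amplitude profiles -/

section Profile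

lemma norm_toLp_ofReal {ι : Type*} [Fintype ι] (z : EuclideanSpace ℝ ι) :
    ‖(WithLp.toLp 2 fun i => (z i : ℂ) : EuclideanSpace ℂ ι)‖ = ‖z‖ := by
  rw [EuclideanSpace.norm_eq, EuclideanSpace.norm_eq]
  simp

lemma norm_le_of_ofLp_eq_mulVec {ι κ : Type*} [Fintype ι] [Fintype κ] {M : Matrix κ ι ℝ}
    {x : EuclideanSpace ℝ κ} {y : EuclideanSpace ℝ ι} (h : x.ofLp = M *ᵥ y.ofLp) :
    ‖x‖ ≤ entrySum M * ‖y‖ := by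
  rw [← norm_toLp_ofReal x, ← norm_toLp_ofReal y]
  refine le_trans (le_of_eq ?_) (norm_cmul_le M _)
  congr 1
  ext i
  have := congrFun h i
  simp only [Matrix.mulVec, dotProduct] at this
  rw [cmul_apply]
  simp only [this, Complex.ofReal_sum, Complex.ofReal_mul]

variable {n r : ℕ} {F : State n r → State n r} {q : State n r → EuclideanSpace ℝ (Fin r)}
  {vstar : EuclideanSpace ℝ (Fin n) → EuclideanSpace ℝ (Fin r)}
  {U : Set (EuclideanSpace ℝ (Fin n))} {V : Set (EuclideanSpace ℝ (Fin r))}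
  {𝒲 : Set (State n r)} {Us : Set (EuclideanSpace ℝ (Fin n))}
  {a₀ : EuclideanSpace ℝ (Fin n) → Matrix (Fin n) (Fin n) ℝ} {c₀ : ℝ}
  {α₀ : EuclideanSpace ℝ (Fin n) → ℝ}
  {r₀ : EuclideanSpace ℝ (Fin n) → EuclideanSpace ℝ (Fin n)}

/-- Uniform positivity of the symmetrizer on compact sets. -/
lemma AssumptionB1.exists_coercive (hB1 : AssumptionB1 F q vstar Us a₀)
    {k : Set (EuclideanSpace ℝ (Fin n))} (hk : IsCompact k) (hkU : k ⊆ Us) :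
    ∃ m : ℝ, 0 < m ∧ ∀ u ∈ k, ∀ y : Fin n → ℝ, m * (y ⬝ᵥ y) ≤ y ⬝ᵥ a₀ u *ᵥ y := by
  have hC0 : MatC1On a₀ Us := hB1.contDiffOn
  set T := k ×ˢ Metric.sphere (0 : EuclideanSpace ℝ (Fin n)) 1 with hT
  have hTc : IsCompact T := hk.prod (isCompact_sphere _ _)
  have hy : ∀ j, ContinuousOn (fun t : EuclideanSpace ℝ (Fin n) × EuclideanSpace ℝ (Fin n) =>
      t.2.ofLp j) T := fun j => by fun_prop
  have hf : ContinuousOn (fun t : EuclideanSpace ℝ (Fin n) × EuclideanSpace ℝ (Fin n) =>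
      t.2.ofLp ⬝ᵥ a₀ t.1 *ᵥ t.2.ofLp) T := by
    refine continuousOn_dotProduct hy (continuousOn_pi.1 (continuousOn_mulVec (fun i j => ?_) hy))
    exact (hC0 i j).continuousOn.comp continuousOn_fst fun t ht => hkU ht.1
  have hne : ∀ y : EuclideanSpace ℝ (Fin n), y ≠ 0 → y.ofLp ≠ 0 := fun y hy h =>
    hy (by ext i; exact congrFun h i)
  obtain ⟨m, hm, hmT⟩ := hTc.exists_forall_le' hf (a := 0) fun t ht => by
    have h1 : ‖t.2‖ = 1 := by simpa using ht.2
    have h2 : t.2 ≠ 0 := fun h => by rw [h, norm_zero] at h1; exact zero_ne_one h1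
    have := (hB1.posDef t.1 (hkU ht.1)).dotProduct_mulVec_pos (hne _ h2)
    simpa using this
  refine ⟨m, hm, fun u hu y => ?_⟩
  rcases eq_or_ne y 0 with rfl | hy0
  · simp
  set ye : EuclideanSpace ℝ (Fin n) := WithLp.toLp 2 y with hye
  have hyn : 0 < ‖ye‖ := norm_pos_iff.2 fun h => hy0 (by
    have := congrArg WithLp.ofLp h
    simpa [hye] using this)
  have h1 := hmT (u, ‖ye‖⁻¹ • ye) ⟨hu, by simp [norm_smul, hyn.ne']⟩
  simp only at h1
  have e1 : (‖ye‖⁻¹ • ye).ofLp = ‖ye‖⁻¹ • y := rfl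
  rw [e1, Matrix.mulVec_smul, dotProduct_smul, smul_dotProduct] at h1
  simp only [smul_eq_mul] at h1
  have e2 : y ⬝ᵥ y = ‖ye‖ ^ 2 := dotProduct_self_ofLp ye
  rw [e2]
  refine (mul_le_mul_of_nonneg_right h1 (sq_nonneg ‖ye‖)).trans (le_of_eq ?_)
  field_simp

/-- The principal eigenvalue is Lipschitz at small distances on compact sets. -/
lemma exists_lipschitz_α₀ (hsys : IsRelaxationSystem F q vstar U V 𝒲 Us)
    (hB1 : AssumptionB1 F q vstar Us a₀) (hB3 : AssumptionB3 F vstar Us c₀ α₀ r₀)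
    {k : Set (EuclideanSpace ℝ (Fin n))} (hk : IsCompact k) (hkU : k ⊆ Us) :
    ∃ L δ : ℝ, 0 < L ∧ 0 < δ ∧ (∀ u ∈ k, ∀ h, |fderiv ℝ α₀ u h| ≤ L * ‖h‖) ∧
      ∀ u ∈ k, ∀ u', ‖u' - u‖ ≤ δ → |α₀ u' - α₀ u| ≤ L * ‖u' - u‖ := by
  -- The mean value inequality needs a convex domain, whereas `k` is arbitrary; balls around points
  -- of `k` stay inside a compact thickening in `Us`.
  obtain ⟨δ, hδ, hδU⟩ := hk.exists_cthickening_subset_open hsys.isOpen_Us hkU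
  have hk' : IsCompact (Metric.cthickening δ k) := hk.cthickening
  obtain ⟨m, hm, hm'⟩ := hB1.exists_coercive hk' hδU
  have hC0 : MatC1On a₀ Us := hB1.contDiffOn
  have hC1 := hC0.mul hsys.matC1On_jacobian_relaxedFlux
  obtain ⟨B, hB, -, hB', -⟩ := hC1.exists_bound hsys.isOpen_Us hk' hδU
  obtain ⟨D, hD, -, hD', -⟩ := hC0.exists_bound hsys.isOpen_Us hk' hδU
  have hc0 := hB3.c₀_pos
  -- The derivative of `α₀` is solved from the identity `fderiv_α₀_eq`, dividing by `⟨r₀, a₀ r₀⟩ ≥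
  -- m`.
  have hder : ∀ u ∈ Metric.cthickening δ k, ∀ h, |fderiv ℝ α₀ u h| ≤ (B + c₀ * D) / m * ‖h‖ := by
    intro u hu h
    have hid := fderiv_α₀_eq hsys hB1 hB3 (hδU hu) h
    have hr : (r₀ u).ofLp ⬝ᵥ (r₀ u).ofLp = 1 := by
      rw [dotProduct_self_ofLp, hB3.unit u (hδU hu), one_pow]
    have h1 := abs_dotProduct_mulVec_le (dmat (fun u => a₀ u *
      jacobian (relaxedFlux F vstar) u) u h) (r₀ u).ofLp
    have h2 := abs_dotProduct_mulVec_le (dmat a₀ u h) (r₀ u).ofLp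
    rw [hr, mul_one] at h1 h2
    have h3 := h1.trans (hB' u hu h)
    have h4 := h2.trans (hD' u hu h)
    have h5 := hm' u hu (r₀ u).ofLp
    rw [hr, mul_one] at h5
    have h6 : |α₀ u * ((r₀ u).ofLp ⬝ᵥ dmat a₀ u h *ᵥ (r₀ u).ofLp)| ≤ c₀ * (D * ‖h‖) := by
      rw [abs_mul]
      exact mul_le_mul (hB3.abs_lt u (hδU hu)).le h4 (abs_nonneg _) hc0.le
    have h7 : |fderiv ℝ α₀ u h| * m ≤ B * ‖h‖ + c₀ * (D * ‖h‖) := by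
      calc |fderiv ℝ α₀ u h| * m ≤ |fderiv ℝ α₀ u h| * ((r₀ u).ofLp ⬝ᵥ a₀ u *ᵥ (r₀ u).ofLp) := by
            gcongr
        _ = |fderiv ℝ α₀ u h * ((r₀ u).ofLp ⬝ᵥ a₀ u *ᵥ (r₀ u).ofLp)| := by
            rw [abs_mul, abs_of_pos (hm.trans_le h5)]
        _ ≤ _ := by
            rw [eq_sub_iff_add_eq.2 hid.symm]
            exact (abs_sub _ _).trans (add_le_add h3 h6)
    calc |fderiv ℝ α₀ u h| = |fderiv ℝ α₀ u h| * m / m := by field_simp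
      _ ≤ (B * ‖h‖ + c₀ * (D * ‖h‖)) / m := by gcongr
      _ = _ := by ring
  refine ⟨(B + c₀ * D) / m, δ, by positivity, hδ, fun u hu =>
    hder u (Metric.self_subset_cthickening k hu), fun u hu u' hu' => ?_⟩
  have hball : Metric.closedBall u δ ⊆ Metric.cthickening δ k :=
    Metric.closedBall_subset_cthickening hu δ
  refine (convex_closedBall u δ).norm_image_sub_le_of_norm_fderiv_le (𝕜 := ℝ) (f := α₀)
    (fun z hz => hB3.differentiableAt_α₀ (hδU (hball hz))) (fun z hz => ?_)
    (Metric.mem_closedBall_self hδ.le) (by simpa [dist_eq_norm] using hu')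
  exact ContinuousLinearMap.opNorm_le_bound _ (by positivity) fun h => hder z (hball hz) h

/-- Near-equilibrium: a small source term controls the distance to the equilibrium manifold. -/
lemma IsRelaxationSystem.exists_near_equilibrium (hsys : IsRelaxationSystem F q vstar U V 𝒲 Us)
    {K : Set (State n r)} (hK : IsCompact K) (hKW : K ⊆ 𝒲) (hKU : ∀ w ∈ K, uPart w ∈ Us) :
    ∃ C κ : ℝ, 0 < C ∧ 0 < κ ∧ ∀ w ∈ K, ‖q w‖ ≤ κ →
      ‖w - eqState vstar (uPart w)‖ ≤ C * ‖q w‖ := by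
  have hk : IsCompact (uPart '' K) := hK.image (projU n r).continuous
  have hkU : uPart '' K ⊆ Us := by rintro _ ⟨w, hw, rfl⟩; exact hKU w hw
  have hkE : IsCompact (eqState vstar '' (uPart '' K)) :=
    hk.image_of_continuousOn (hsys.contDiffOn_eqState.continuousOn.mono hkU)
  have hsub : eqState vstar '' (uPart '' K) ⊆ regularSet q Us := by
    rintro _ ⟨u, hu, rfl⟩; exact hsys.eqState_mem (hkU hu)
  obtain ⟨B, hB, hB', -, -⟩ := (relaxedJacobian_contDiff (Us := Us) hsys.contDiff_F
    hsys.contDiff_q).2.2.2.exists_bound (isOpen_regularSet hsys.contDiff_q hsys.isOpen_Us) hkE hsub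
  -- The equilibrium projections of `K` need not lie in `K`, nor need the segments joining them to
  -- `K`; a large ball contains everything.
  obtain ⟨R, hR⟩ := (hK.union hkE).isBounded.subset_closedBall (0 : State n r)
  have hq1 : ContDiff ℝ 1 (fderiv ℝ q) := hsys.contDiff_q.fderiv_right (by norm_num)
  obtain ⟨L, hL⟩ := (hq1.contDiffOn (s := Metric.closedBall (0 : State n r) R)).exists_lipschitzOnWith
    (by norm_num) (convex_closedBall _ _) (isCompact_closedBall _ _)
  -- Taylor expansion of `q` at the equilibrium `e` over the same `u`: `q(e) = 0`, the increment `w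
  -- - e` has no `u`-part, and `q₂` is invertible at `e`.
  have hquad : ∀ w ∈ K, ‖w - eqState vstar (uPart w)‖ ≤
      B * (‖q w‖ + L * ‖w - eqState vstar (uPart w)‖ ^ 2) := fun w hw => by
    set e := eqState vstar (uPart w) with he
    have heE : e ∈ eqState vstar '' (uPart '' K) := ⟨_, ⟨w, hw, rfl⟩, rfl⟩
    have hwR : w ∈ Metric.closedBall (0 : State n r) R := hR (Or.inl hw)
    have heR : e ∈ Metric.closedBall (0 : State n r) R := hR (Or.inr heE)
    have hseg : segment ℝ e w ⊆ Metric.closedBall (0 : State n r) R :=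
      (convex_closedBall _ _).segment_subset heR hwR
    have hu0 : uPart (w - e) = 0 := by
      have : uPart (w - e) = uPart w - uPart e := rfl
      rw [this, he, eqState, uPart_mkState, sub_self]
    have h1 : ‖q w - q e - fderiv ℝ q e (w - e)‖ ≤ (L * ‖w - e‖) * ‖w - e‖ := by
      refine (convex_segment e w).norm_image_sub_le_of_norm_fderiv_le' (𝕜 := ℝ)
        (fun z _ => hsys.contDiff_q.differentiable (by norm_num) z) (fun z hz => ?_)
        (left_mem_segment ℝ e w) (right_mem_segment ℝ e w)
      refine (hL.norm_sub_le (hseg hz) heR).trans ?_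
      gcongr
      exact norm_sub_le_of_mem_segment hz
    rw [hsys.q_eqState (hkU ⟨w, hw, rfl⟩), sub_zero] at h1
    have h2 : ‖fderiv ℝ q e (w - e)‖ ≤ ‖q w‖ + L * ‖w - e‖ ^ 2 := by
      have := norm_sub_norm_le (fderiv ℝ q e (w - e)) (q w)
      rw [norm_sub_rev] at this
      nlinarith
    have h3 := fderiv_q_apply hsys.contDiff_q e (w - e)
    rw [hu0] at h3
    have hunit : IsUnit (srcV q e).det := (hsub heE).2.isUnit
    have h4 : (vPart (w - e)).ofLp = (srcV q e)⁻¹ *ᵥ (fderiv ℝ q e (w - e)).ofLp := by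
      rw [h3, Matrix.mulVec_add, Matrix.mulVec_mulVec, Matrix.mulVec_mulVec,
        Matrix.nonsing_inv_mul _ hunit, Matrix.one_mulVec]
      simp
    have h5 := norm_le_of_ofLp_eq_mulVec h4
    have h6 := norm_le_parts (w - e)
    rw [hu0, norm_zero, zero_add] at h6
    calc ‖w - e‖ ≤ entrySum (srcV q e)⁻¹ * ‖fderiv ℝ q e (w - e)‖ := h6.trans h5
      _ ≤ B * (‖q w‖ + L * ‖w - e‖ ^ 2) := by
          gcongr
          exact hB' e heE
  -- Below this distance the quadratic remainder is at most half the distance and can be absorbed;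
  -- `L + 1` guards against `L = 0`.
  set δ : ℝ := 1 / (2 * B * (L + 1)) with hδ
  have hδ0 : 0 < δ := by positivity
  have hd : ContinuousOn (fun w => ‖w - eqState vstar (uPart w)‖) K :=
    (continuousOn_id.sub (hsys.contDiffOn_eqState.continuousOn.comp
      (projU n r).continuous.continuousOn fun w hw => hKU w hw)).norm
  have hS : IsCompact (K ∩ (fun w => ‖w - eqState vstar (uPart w)‖) ⁻¹' Set.Ici δ) :=
    hK.of_isClosed_subset (hd.preimage_isClosed_of_isClosed hK.isClosed isClosed_Ici)
      Set.inter_subset_left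
  -- At distance at least `δ` there are no zeros of `q` in `K`, by the characterization of
  -- equilibria in `U × V`. Compactness then bounds `‖q‖` from below, so a smaller source forces the
  -- distance below `δ`.
  obtain ⟨κ, hκ, hκS⟩ := hS.exists_forall_le' (f := fun w => ‖q w‖)
    (hsys.contDiff_q.continuous.norm.continuousOn) (a := 0) fun w hw => by
      rw [norm_pos_iff]
      intro h0
      have hUV := hsys.W_subset w (hKW hw.1)
      have h1 := (hsys.equilibrium_iff _ hUV.1 _ hUV.2).1 (by rw [mkState_parts]; exact h0)
      have h2 : w = eqState vstar (uPart w) := ext_parts rfl h1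
      have h3 : δ ≤ ‖w - eqState vstar (uPart w)‖ := hw.2
      rw [← h2, sub_self, norm_zero] at h3
      linarith
  refine ⟨2 * B, κ / 2, by positivity, by positivity, fun w hw hqw => ?_⟩
  have hlt : ‖w - eqState vstar (uPart w)‖ < δ := by
    by_contra h
    have := hκS w ⟨hw, not_lt.1 h⟩
    linarith
  have h1 := hquad w hw
  set d := ‖w - eqState vstar (uPart w)‖ with hd'
  have hd0 : 0 ≤ d := norm_nonneg _
  have h2 : B * (L * d ^ 2) ≤ d / 2 := by
    calc B * (L * d ^ 2) ≤ B * ((L + 1) * (δ * d)) := by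
          gcongr
          · linarith
          · nlinarith
      _ = d / 2 := by rw [hδ]; field_simp
  linarith

/-- Quantitative consequences of the assumptions on a profile of small amplitude. -/
structure IsTame (vstar : EuclideanSpace ℝ (Fin n) → EuclideanSpace ℝ (Fin r))
    (α₀ : EuclideanSpace ℝ (Fin n) → ℝ)
    (r₀ : EuclideanSpace ℝ (Fin n) → EuclideanSpace ℝ (Fin n)) (C ε : ℝ)
    (W : ℝ → State n r) : Prop where
  deriv_le : ∀ x, ‖deriv W x‖ ≤ C * ε ^ 2
  equilibrium : ∀ x, ‖W x - eqState vstar (uPart (W x))‖ ≤ C * ‖deriv W x‖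
  deriv_le_uPart : ∀ x, ‖deriv W x‖ ≤ C * ‖uPart (deriv W x)‖
  direction : ∀ x, ‖uPart (deriv W x) - ‖uPart (deriv W x)‖ • shockDir α₀ r₀ (uPart (W x))‖ ≤
    C * ε ^ 2 * ‖uPart (deriv W x)‖
  variation : ∀ x y, x ≤ y → ∫ t in x..y, ‖uPart (deriv W t)‖ ≤ C * ε

end Profile

/-! ### Consequences of assumption C at small amplitude -/

section Tame

variable {n r : ℕ} {F : State n r → State n r} {q : State n r → EuclideanSpace ℝ (Fin r)}
  {vstar : EuclideanSpace ℝ (Fin n) → EuclideanSpace ℝ (Fin r)}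
  {U : Set (EuclideanSpace ℝ (Fin n))} {V : Set (EuclideanSpace ℝ (Fin r))}
  {𝒲 : Set (State n r)} {Us : Set (EuclideanSpace ℝ (Fin n))}
  {a₀ : EuclideanSpace ℝ (Fin n) → Matrix (Fin n) (Fin n) ℝ} {c₀ : ℝ}
  {α₀ : EuclideanSpace ℝ (Fin n) → ℝ}
  {r₀ : EuclideanSpace ℝ (Fin n) → EuclideanSpace ℝ (Fin n)}
  {K : Set (State n r)} {W : ℝ → State n r} {Wm Wp : State n r}

/-- Smallness requirements are collected as eventual statements at `0`, and turned into a single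
explicit threshold only at the very end. -/
lemma exists_threshold {p : ℝ → Prop} (h : ∀ᶠ ε in 𝓝 (0 : ℝ), p ε) :
    ∃ ε₀ : ℝ, 0 < ε₀ ∧ ε₀ ≤ 1 ∧ ∀ ε, 0 ≤ ε → ε ≤ ε₀ → p ε := by
  obtain ⟨δ, hδ, h⟩ := Metric.eventually_nhds_iff.1 h
  refine ⟨min 1 (δ / 2), by positivity, min_le_left _ _, fun ε h0 hε => h ?_⟩
  rw [dist_zero_right, Real.norm_of_nonneg h0]
  linarith [hε.trans (min_le_right _ _)]

lemma eventually_le_of_continuous {f : ℝ → ℝ} (hf : Continuous f) (h0 : f 0 = 0) {c : ℝ}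
    (hc : 0 < c) : ∀ᶠ ε in 𝓝 (0 : ℝ), f ε ≤ c :=
  ((hf.tendsto' 0 0 h0).eventually_lt_const hc).mono fun _ h => h.le

namespace IsRelaxationShock

variable (hW : IsRelaxationShock F q vstar K W Wm Wp)

include hW

lemma hasDerivAt (x : ℝ) : HasDerivAt W (deriv W x) x :=
  (hW.contDiff.differentiable (by norm_num) x).hasDerivAt

lemma contDiff_deriv : ContDiff ℝ 1 (deriv W) :=
  have h : ContDiff ℝ (1 + 1) W := by rw [one_add_one_eq_two]; exact hW.contDiff
  (contDiff_succ_iff_deriv.1 h).2.2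

lemma hasDerivAt_deriv (x : ℝ) : HasDerivAt (deriv W) (deriv (deriv W) x) x :=
  (hW.contDiff_deriv.differentiable (by norm_num) x).hasDerivAt

lemma hasDerivAt_uPart (x : ℝ) :
    HasDerivAt (fun y => uPart (W y)) (uPart (deriv W x)) x :=
  (projU n r).hasFDerivAt.comp_hasDerivAt x (hW.hasDerivAt x)

lemma continuous_norm_deriv : Continuous fun x => ‖uPart (deriv W x)‖ :=
  ((projU n r).continuous.comp hW.contDiff_deriv.continuous).norm

lemma source_eq (hF : ContDiff ℝ 2 F) (x : ℝ) :
    source q (W x) = fderiv ℝ F (W x) (deriv W x) := by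
  rw [← hW.profile x]
  exact ((hF.differentiable (by norm_num) (W x)).hasFDerivAt.comp_hasDerivAt x
    (hW.hasDerivAt x)).deriv

/-- This is the `v`-component of the differentiated profile equation. Its right side is `O(ε |W'|)`
under assumption C, which slaves `V'` to `U'`. -/
lemma fderiv_q_eq (hF : ContDiff ℝ 2 F) (hq : ContDiff ℝ 2 q) (x : ℝ) :
    fderiv ℝ q (W x) (deriv W x) = vPart (fderiv ℝ (fderiv ℝ F) (W x) (deriv W x) (deriv W x)
      + fderiv ℝ F (W x) (deriv (deriv W) x)) := by
  have hF1 : ContDiff ℝ 1 (fderiv ℝ F) := hF.fderiv_right (by norm_num)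
  have h1 := ((hF1.differentiable (by norm_num) (W x)).hasFDerivAt.comp_hasDerivAt x
    (hW.hasDerivAt x)).clm_apply (hW.hasDerivAt_deriv x)
  have h2 := (projV n r).hasFDerivAt.comp_hasDerivAt x h1
  have h3 := (hq.differentiable (by norm_num) (W x)).hasFDerivAt.comp_hasDerivAt x
    (hW.hasDerivAt x)
  refine h3.unique (h2.congr_of_eventuallyEq (Eventually.of_forall fun y => ?_))
  change q (W y) = vPart (fderiv ℝ F (W y) (deriv W y))
  rw [← hW.source_eq hF y]
  rfl

end IsRelaxationShock

/-- Multiplying the direction estimate by `|U'|` removes the inverse; at points with `U' = 0` both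
sides vanish. -/
lemma AssumptionC.direction_le {C₁ : ℝ} (h : AssumptionC α₀ r₀ C₁ W Wm Wp) (x : ℝ) :
    ‖uPart (deriv W x) - ‖uPart (deriv W x)‖ • shockDir α₀ r₀ (uPart (W x))‖ ≤
      C₁ * ‖Wp - Wm‖ ^ 2 * ‖uPart (deriv W x)‖ := by
  rcases eq_or_ne (uPart (deriv W x)) 0 with h0 | h0
  · simp [h0]
  have hp : 0 < ‖uPart (deriv W x)‖ := norm_pos_iff.2 h0
  have h1 : uPart (deriv W x) - ‖uPart (deriv W x)‖ • shockDir α₀ r₀ (uPart (W x)) =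
      ‖uPart (deriv W x)‖ • (‖uPart (deriv W x)‖⁻¹ • uPart (deriv W x)
        + Real.sign (gnl α₀ r₀ (uPart (W x))) • r₀ (uPart (W x))) := by
    rw [smul_add, smul_smul, mul_inv_cancel₀ hp.ne', one_smul, shockDir, smul_neg, sub_neg_eq_add]
  rw [h1, norm_smul, norm_norm, mul_comm]
  exact mul_le_mul_of_nonneg_right (h.direction x) hp.le

/-- The variation of the profile is controlled by that of the principal eigenvalue. -/
lemma exists_variation_bound (hsys : IsRelaxationSystem F q vstar U V 𝒲 Us)
    (hB1 : AssumptionB1 F q vstar Us a₀) (hB3 : AssumptionB3 F vstar Us c₀ α₀ r₀)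
    (hK : IsCompact K) (hKU : ∀ w ∈ K, uPart w ∈ Us) (C₁ : ℝ) :
    ∃ C, 0 < C ∧ ∀ᶠ ε in 𝓝 (0 : ℝ), ∀ W Wm Wp, IsRelaxationShock F q vstar K W Wm Wp →
      AssumptionC α₀ r₀ C₁ W Wm Wp → ‖Wp - Wm‖ = ε →
      ∀ x y, x ≤ y → ∫ t in x..y, ‖uPart (deriv W t)‖ ≤ C * ε := by
  have hk : IsCompact (uPart '' K) := hK.image (projU n r).continuous
  have hkU : uPart '' K ⊆ Us := by rintro _ ⟨w, hw, rfl⟩; exact hKU w hw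
  obtain ⟨c, hc, hgnl⟩ := exists_gnl_bound hsys hB1 hB3 hk hkU
  obtain ⟨L, δ, hL, hδ, hfd, hlip⟩ := exists_lipschitz_α₀ hsys hB1 hB3 hk hkU
  refine ⟨2 / c * L, by positivity, ?_⟩
  filter_upwards [eventually_le_of_continuous (f := fun ε => ε) (by fun_prop) rfl hδ,
    eventually_le_of_continuous (f := fun ε => L * (C₁ * ε ^ 2)) (by fun_prop) (by simp)
      (half_pos hc)] with ε h1 h2 W Wm Wp hW hC hε x y hxy
  have hm : ∀ x, uPart (W x) ∈ uPart '' K := fun x => ⟨_, hW.mem x, rfl⟩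
  have hWm : Wm ∈ K := hK.isClosed.mem_of_tendsto hW.tendsto_atBot (Eventually.of_forall hW.mem)
  have hWp : Wp ∈ K := hK.isClosed.mem_of_tendsto hW.tendsto_atTop (Eventually.of_forall hW.mem)
  set g : ℝ → ℝ := fun x => α₀ (uPart (W x)) with hg
  have hgd : ∀ x, HasDerivAt g (fderiv ℝ α₀ (uPart (W x)) (uPart (deriv W x))) x := fun x =>
    (hB3.differentiableAt_α₀ (hkU (hm x))).hasFDerivAt.comp_hasDerivAt x (hW.hasDerivAt_uPart x)
  -- Along the profile `(α₀(U))' ≈ |U'| dα₀(ξ) = -|η| |U'|`; the error in the direction costs at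
  -- most half of the lower bound `c` of `|η|`.
  have hg' : ∀ x, fderiv ℝ α₀ (uPart (W x)) (uPart (deriv W x)) ≤
      -(c / 2) * ‖uPart (deriv W x)‖ := fun x => by
    have e : uPart (deriv W x) = ‖uPart (deriv W x)‖ • shockDir α₀ r₀ (uPart (W x))
        + (uPart (deriv W x) - ‖uPart (deriv W x)‖ • shockDir α₀ r₀ (uPart (W x))) := by abel
    have h3 := (abs_le.1 (hfd _ (hm x) (uPart (deriv W x)
      - ‖uPart (deriv W x)‖ • shockDir α₀ r₀ (uPart (W x))))).2
    have h4 := hC.direction_le x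
    rw [hε] at h4
    conv_lhs => rw [e, map_add, map_smul, fderiv_shockDir, smul_eq_mul]
    have h5 := hgnl _ (hm x)
    have h6 : L * (C₁ * ε ^ 2 * ‖uPart (deriv W x)‖) ≤ c / 2 * ‖uPart (deriv W x)‖ := by
      rw [← mul_assoc]; gcongr
    have h7 := mul_le_mul_of_nonneg_left h4 hL.le
    have h8 := mul_le_mul_of_nonneg_left h5 (norm_nonneg (uPart (deriv W x)))
    linarith
  have hId : ∀ x, HasDerivAt (fun y => ∫ t in (0 : ℝ)..y, ‖uPart (deriv W t)‖)
      ‖uPart (deriv W x)‖ x := fun x =>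
    (hW.continuous_norm_deriv.integral_hasStrictDerivAt 0 x).hasDerivAt
  have hanti : Antitone fun x => g x + c / 2 * ∫ t in (0 : ℝ)..x, ‖uPart (deriv W t)‖ := by
    refine antitone_of_deriv_nonpos
      (fun x => ((hgd x).fun_add ((hId x).const_mul (c / 2))).differentiableAt) fun x => ?_
    rw [HasDerivAt.deriv ((hgd x).fun_add ((hId x).const_mul (c / 2)))]
    linarith [hg' x]
  have hganti : Antitone g := by
    refine antitone_of_deriv_nonpos (fun x => (hgd x).differentiableAt) fun x => ?_
    rw [(hgd x).deriv]
    nlinarith [hg' x, norm_nonneg (uPart (deriv W x))]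
  have hlim : ∀ {l : Filter ℝ} {w : State n r}, w ∈ K → Tendsto W l (𝓝 w) →
      Tendsto g l (𝓝 (α₀ (uPart w))) := fun hw hl =>
    (hB3.differentiableAt_α₀ (hKU _ hw)).continuousAt.tendsto.comp
      (((projU n r).continuous.tendsto _).comp hl)
  have h3 := hganti.ge_of_tendsto (hlim hWm hW.tendsto_atBot) x
  have h4 := hganti.le_of_tendsto (hlim hWp hW.tendsto_atTop) y
  have h5 : ‖uPart Wm - uPart Wp‖ ≤ ε := by
    rw [← hε, norm_sub_rev Wp]
    exact norm_uPart_le (Wm - Wp)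
  -- The whole length is paid for by the drop of `α₀` between the end states, and this drop is at
  -- most `L ε`.
  have h6 := (abs_le.1 (hlip (uPart Wp) ⟨_, hWp, rfl⟩ (uPart Wm) (h5.trans h1))).2
  have h7 : L * ‖uPart Wm - uPart Wp‖ ≤ L * ε := by gcongr
  have h8 := hanti hxy
  simp only at h8
  have h9 : ∫ t in x..y, ‖uPart (deriv W t)‖ = (∫ t in (0 : ℝ)..y, ‖uPart (deriv W t)‖)
      - ∫ t in (0 : ℝ)..x, ‖uPart (deriv W t)‖ :=
    (intervalIntegral.integral_interval_sub_left
      (hW.continuous_norm_deriv.intervalIntegrable _ _)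
      (hW.continuous_norm_deriv.intervalIntegrable _ _)).symm
  have h10 : c / 2 * ∫ t in x..y, ‖uPart (deriv W t)‖ ≤ L * ε := by
    rw [h9]; linarith
  calc ∫ t in x..y, ‖uPart (deriv W t)‖
      = 2 / c * (c / 2 * ∫ t in x..y, ‖uPart (deriv W t)‖) := by field_simp
    _ ≤ 2 / c * (L * ε) := by gcongr
    _ = _ := by ring

/-- Small profiles stay close to equilibrium, and are driven by their conserved part. -/
lemma exists_profile_bound (hsys : IsRelaxationSystem F q vstar U V 𝒲 Us)
    (hK : IsCompact K) (hKW : K ⊆ 𝒲) (hKU : ∀ w ∈ K, uPart w ∈ Us) (C₁ : ℝ) :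
    ∃ C, 0 < C ∧ ∀ᶠ ε in 𝓝 (0 : ℝ), ∀ W Wm Wp, IsRelaxationShock F q vstar K W Wm Wp →
      AssumptionC α₀ r₀ C₁ W Wm Wp → ‖Wp - Wm‖ = ε →
      ∀ x, ‖W x - eqState vstar (uPart (W x))‖ ≤ C * ‖deriv W x‖ ∧
        ‖deriv W x‖ ≤ C * ‖uPart (deriv W x)‖ := by
  have hF1 : ContDiff ℝ 1 (fderiv ℝ F) := hsys.contDiff_F.fderiv_right (by norm_num)
  have hF2 : Continuous fun w => ‖fderiv ℝ (fderiv ℝ F) w‖ :=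
    continuous_norm.comp (hF1.fderiv_right (m := 0) (by norm_num)).continuous
  obtain ⟨B₁, hB₁⟩ := hK.exists_bound_of_continuousOn hF1.continuous.continuousOn
  obtain ⟨B₂, hB₂⟩ := hK.exists_bound_of_continuousOn hF2.continuousOn
  set B := |B₁| + |B₂| + 1 with hB
  have hB0 : 0 < B := by positivity
  have hB₁' : ∀ w ∈ K, ‖fderiv ℝ F w‖ ≤ B := fun w hw => by
    linarith [hB₁ w hw, le_abs_self B₁, abs_nonneg B₂]
  have hB₂' : ∀ w ∈ K, ‖fderiv ℝ (fderiv ℝ F) w‖ ≤ B := fun w hw => by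
    have := le_of_abs_le (hB₂ w hw)
    linarith [le_abs_self B₂, abs_nonneg B₁]
  obtain ⟨C₂, κ, hC₂, hκ, hnear⟩ := hsys.exists_near_equilibrium hK hKW hKU
  have hkE : IsCompact (eqState vstar '' (uPart '' K)) :=
    (hK.image (projU n r).continuous).image_of_continuousOn
      (hsys.contDiffOn_eqState.continuousOn.mono (by rintro _ ⟨w, hw, rfl⟩; exact hKU w hw))
  have hreg := isOpen_regularSet hsys.contDiff_q hsys.isOpen_Us
  obtain ⟨δ, hδ, hδE⟩ := hkE.exists_cthickening_subset_open hreg (by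
    rintro _ ⟨_, ⟨w, hw, rfl⟩, rfl⟩; exact hsys.eqState_mem (hKU w hw))
  obtain ⟨-, hC1, -, hCi⟩ := relaxedJacobian_contDiff (Us := Us) hsys.contDiff_F hsys.contDiff_q
  obtain ⟨D₁, hD₁, hD₁', -, -⟩ := hC1.exists_bound hreg hkE.cthickening hδE
  obtain ⟨D, hD, hD', -, -⟩ := hCi.exists_bound hreg hkE.cthickening hδE
  refine ⟨max (C₂ * B) (2 * (1 + D * D₁)), by positivity, ?_⟩
  filter_upwards [eventually_le_of_continuous (f := fun ε => B * (C₁ * ε ^ 2)) (by fun_prop)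
      (by simp) hκ,
    eventually_le_of_continuous (f := fun ε => C₂ * (B * (C₁ * ε ^ 2))) (by fun_prop)
      (by simp) hδ,
    eventually_le_of_continuous (f := fun ε => D * (B * (C₁ * ε ^ 2 + C₁ * ε))) (by fun_prop)
      (by simp) (half_pos one_pos)] with ε h1 h2 h3 W Wm Wp hW hC hε x
  have hd1 := hC.deriv_le x
  have hd2 := hC.deriv2_le x
  rw [hε] at hd1 hd2
  -- The profile equation reads `Q(W) = dF(W) W'`, so the source is bounded by `|W'|`.
  have hq : ‖q (W x)‖ ≤ B * ‖deriv W x‖ := by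
    rw [← norm_inclV (n := n), show mkState 0 (q (W x)) = source q (W x) from rfl,
      hW.source_eq hsys.contDiff_F]
    exact (ContinuousLinearMap.le_opNorm _ _).trans (by gcongr; exact hB₁' _ (hW.mem x))
  have hq' : B * ‖deriv W x‖ ≤ B * (C₁ * ε ^ 2) := by gcongr
  have hne : ‖W x - eqState vstar (uPart (W x))‖ ≤ C₂ * (B * ‖deriv W x‖) :=
    (hnear _ (hW.mem x) ((hq.trans hq').trans h1)).trans (by gcongr)
  refine ⟨hne.trans ?_, ?_⟩
  · rw [← mul_assoc]
    gcongr
    exact le_max_left _ _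
  have hWmem : W x ∈ Metric.cthickening δ (eqState vstar '' (uPart '' K)) := by
    have hm : eqState vstar (uPart (W x)) ∈ eqState vstar '' (uPart '' K) :=
      ⟨_, ⟨_, hW.mem x, rfl⟩, rfl⟩
    refine Metric.closedBall_subset_cthickening hm δ ?_
    rw [mem_closedBall_iff_norm]
    exact hne.trans (le_trans (by gcongr) h2)
  have hDq : ‖fderiv ℝ q (W x) (deriv W x)‖ ≤ B * (C₁ * ε ^ 2 + C₁ * ε) * ‖deriv W x‖ := by
    rw [hW.fderiv_q_eq hsys.contDiff_F hsys.contDiff_q]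
    refine (norm_vPart_le _).trans ((norm_add_le _ _).trans ?_)
    have e1 : ‖fderiv ℝ (fderiv ℝ F) (W x) (deriv W x) (deriv W x)‖ ≤
        B * (C₁ * ε ^ 2) * ‖deriv W x‖ := by
      refine (ContinuousLinearMap.le_opNorm _ _).trans ?_
      gcongr
      refine (ContinuousLinearMap.le_opNorm _ _).trans ?_
      gcongr
      exact hB₂' _ (hW.mem x)
    have e2 : ‖fderiv ℝ F (W x) (deriv (deriv W) x)‖ ≤ B * (C₁ * ε * ‖deriv W x‖) := by
      refine (ContinuousLinearMap.le_opNorm _ _).trans ?_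
      gcongr
      exact hB₁' _ (hW.mem x)
    linarith
  have hq2 := fderiv_q_apply hsys.contDiff_q (W x) (deriv W x)
  have hunit : IsUnit (srcV q (W x)).det := (hδE hWmem).2.isUnit
  set y : EuclideanSpace ℝ (Fin r) := WithLp.toLp 2 (srcU q (W x) *ᵥ (uPart (deriv W x)).ofLp)
    with hy
  have hyn : ‖y‖ ≤ D₁ * ‖uPart (deriv W x)‖ :=
    (norm_le_of_ofLp_eq_mulVec (x := y) rfl).trans (by gcongr; exact hD₁' _ hWmem)
  -- Solve `q₁ U' + q₂ V' = O(ε |W'|)` for `V'`. The part proportional to `|W'|` has coefficient at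
  -- most `1/2` and is absorbed below.
  have hV : (vPart (deriv W x)).ofLp =
      (srcV q (W x))⁻¹ *ᵥ (fderiv ℝ q (W x) (deriv W x) - y).ofLp := by
    rw [WithLp.ofLp_sub, hq2, hy, add_sub_cancel_left, Matrix.mulVec_mulVec,
      Matrix.nonsing_inv_mul _ hunit, Matrix.one_mulVec]
  have hVn : ‖vPart (deriv W x)‖ ≤ D * (B * (C₁ * ε ^ 2 + C₁ * ε) * ‖deriv W x‖
      + D₁ * ‖uPart (deriv W x)‖) := by
    refine (norm_le_of_ofLp_eq_mulVec hV).trans ?_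
    gcongr
    · exact hD' _ hWmem
    · exact (norm_sub_le _ _).trans (add_le_add hDq hyn)
  have h4 := norm_le_parts (deriv W x)
  have h5 : D * (B * (C₁ * ε ^ 2 + C₁ * ε)) * ‖deriv W x‖ ≤ 1 / 2 * ‖deriv W x‖ := by gcongr
  calc ‖deriv W x‖ ≤ 2 * (1 + D * D₁) * ‖uPart (deriv W x)‖ := by linarith
    _ ≤ _ := by gcongr; exact le_max_right _ _

lemma exists_isTame (hsys : IsRelaxationSystem F q vstar U V 𝒲 Us)
    (hB1 : AssumptionB1 F q vstar Us a₀) (hB3 : AssumptionB3 F vstar Us c₀ α₀ r₀)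
    (hK : IsCompact K) (hKW : K ⊆ 𝒲) (hKU : ∀ w ∈ K, uPart w ∈ Us) {C₁ : ℝ} (hC₁ : 0 < C₁) :
    ∃ C, 0 < C ∧ ∀ᶠ ε in 𝓝 (0 : ℝ), ∀ W Wm Wp, IsRelaxationShock F q vstar K W Wm Wp →
      AssumptionC α₀ r₀ C₁ W Wm Wp → ‖Wp - Wm‖ = ε → IsTame vstar α₀ r₀ C ε W := by
  obtain ⟨D, hD, h1⟩ := exists_variation_bound hsys hB1 hB3 hK hKU C₁
  obtain ⟨E, hE, h2⟩ := exists_profile_bound (α₀ := α₀) (r₀ := r₀) hsys hK hKW hKU C₁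
  refine ⟨C₁ + D + E, by positivity, ?_⟩
  filter_upwards [h1, h2] with ε h1 h2 W Wm Wp hW hC hε
  have h1 := h1 W Wm Wp hW hC hε
  have h2 := h2 W Wm Wp hW hC hε
  have hε0 : 0 ≤ ε := hε ▸ norm_nonneg _
  refine ⟨fun x => (hC.deriv_le x).trans ?_, fun x => (h2 x).1.trans ?_,
    fun x => (h2 x).2.trans ?_, fun x => (hC.direction_le x).trans ?_,
    fun x y hxy => (h1 x y hxy).trans ?_⟩
  all_goals first | rw [hε] | skip
  all_goals gcongr; linarith

end Tame

/-! ### The weight along a profile -/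

section Weight

section Curve

variable {X : Type*} [NormedAddCommGroup X] [NormedSpace ℝ X] {κ ι : Type*} [Fintype κ] [Fintype ι]

/-- Uniform bounds, with constant `D`, for a matrix function and its derivative on `k`. -/
structure BoundedC1On (D : ℝ) (f : X → Matrix κ ι ℝ) (k : Set X) : Prop where
  le : ∀ x ∈ k, entrySum (f x) ≤ D
  dmat_le : ∀ x ∈ k, ∀ h, entrySum (dmat f x h) ≤ D * ‖h‖
  sub_le : ∀ x y, segment ℝ x y ⊆ k → entrySum (f y - f x) ≤ D * ‖y - x‖

lemma MatC1On.eventually_bounded {f : X → Matrix κ ι ℝ} {s k : Set X} (hf : MatC1On f s)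
    (hs : IsOpen s) (hk : IsCompact k) (hks : k ⊆ s) : ∀ᶠ D in atTop, BoundedC1On D f k := by
  obtain ⟨C, -, h1, h2, h3⟩ := hf.exists_bound hs hk hks
  filter_upwards [eventually_ge_atTop C] with D hD
  exact ⟨fun x hx => (h1 x hx).trans hD, fun x hx h => (h2 x hx h).trans (by gcongr),
    fun x y h => (h3 x y h).trans (by gcongr)⟩

/-- The derivative of `f - θ g` along a curve. -/
def dcurve (f g : X → Matrix κ ι ℝ) (γ γ' : X) (θ θ' : ℝ) : Matrix κ ι ℝ :=
  dmat f γ γ' - (θ' • g γ + θ • dmat g γ γ')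

variable {f g : X → Matrix κ ι ℝ} {s k : Set X} {γ : ℝ → X} {θ : ℝ → ℝ}

lemma contDiff_curve (hf : MatC1On f s) (hg : MatC1On g s) (hγ : ContDiff ℝ 1 γ)
    (hγs : ∀ x, γ x ∈ s) (hθ : ContDiff ℝ 1 θ) (i : κ) (j : ι) :
    ContDiff ℝ 1 fun x => (f (γ x) - θ x • g (γ x)) i j :=
  (hf.comp_contDiff hγ hγs i j).sub (hθ.mul (hg.comp_contDiff hγ hγs i j))

lemma hasDerivAt_curve (hf : MatC1On f s) (hg : MatC1On g s) (hs : IsOpen s) {x θ' : ℝ} {γ' : X}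
    (hγ : HasDerivAt γ γ' x) (hγs : γ x ∈ s) (hθ : HasDerivAt θ θ' x) (i : κ) (j : ι) :
    HasDerivAt (fun y => (f (γ y) - θ y • g (γ y)) i j)
      (dcurve f g (γ x) γ' (θ x) θ' i j) x :=
  (hf.hasDerivAt hs hγ hγs i j).sub (hθ.mul (hg.hasDerivAt hs hγ hγs i j))

lemma entrySum_curve_le {D t : ℝ} (ht : |t| ≤ 1) (hf : BoundedC1On D f k)
    (hg : BoundedC1On D g k) {x : X} (hx : x ∈ k) : entrySum (f x - t • g x) ≤ 2 * D := by
  refine (entrySum_sub_le _ _).trans ?_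
  rw [entrySum_smul]
  have h1 := hf.le x hx
  have h2 : |t| * entrySum (g x) ≤ 1 * D :=
    mul_le_mul ht (hg.le x hx) (entrySum_nonneg _) zero_le_one
  linarith

lemma entrySum_dcurve_le {D t t' : ℝ} (ht : |t| ≤ 1) (hf : BoundedC1On D f k)
    (hg : BoundedC1On D g k) {x h : X} (hx : x ∈ k) :
    entrySum (dcurve f g x h t t') ≤ 2 * D * ‖h‖ + |t'| * D := by
  refine (entrySum_sub_le _ _).trans ?_
  have h1 := hf.dmat_le x hx h
  have h2 : |t| * entrySum (dmat g x h) ≤ 1 * (D * ‖h‖) :=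
    mul_le_mul ht (hg.dmat_le x hx h) (entrySum_nonneg _) zero_le_one
  have h3 : |t'| * entrySum (g x) ≤ |t'| * D := by gcongr; exact hg.le x hx
  have h4 := entrySum_add_le (t' • g x) (t • dmat g x h)
  rw [entrySum_smul, entrySum_smul] at h4
  linarith

end Curve

variable {n r : ℕ} {vstar : EuclideanSpace ℝ (Fin n) → EuclideanSpace ℝ (Fin r)}
  {α₀ : EuclideanSpace ℝ (Fin n) → ℝ}
  {r₀ : EuclideanSpace ℝ (Fin n) → EuclideanSpace ℝ (Fin n)} {W : ℝ → State n r}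

lemma dotProduct_self_nonneg_real {ι : Type*} [Fintype ι] (y : ι → ℝ) : 0 ≤ y ⬝ᵥ y :=
  Finset.sum_nonneg fun i _ => mul_self_nonneg (y i)

/-- The length of the conserved part of a small profile is small. -/
lemma IsTame.abs_length_le {C ε : ℝ} (h : IsTame vstar α₀ r₀ C ε W) (x : ℝ) :
    |∫ t in (0 : ℝ)..x, ‖uPart (deriv W t)‖| ≤ C * ε := by
  rcases le_total 0 x with hx | hx
  · rw [abs_of_nonneg (intervalIntegral.integral_nonneg hx fun t _ => norm_nonneg _)]
    exact h.variation 0 x hx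
  · rw [intervalIntegral.integral_symm, abs_neg,
      abs_of_nonneg (intervalIntegral.integral_nonneg hx fun t _ => norm_nonneg _)]
    exact h.variation x 0 hx

/-- A symmetrized square is symmetric. -/
lemma isSymm_mul_mul {ι : Type*} [Fintype ι] {S a : Matrix ι ι ℝ} (hS : S.IsSymm)
    (hSa : (S * a).IsSymm) : (S * a * a).IsSymm := by
  have h1 : aᵀ * S = S * a := by
    have := hSa.eq
    rwa [Matrix.transpose_mul, hS.eq] at this
  rw [Matrix.IsSymm, Matrix.transpose_mul, hSa.eq, ← Matrix.mul_assoc, h1]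

/-- The quadratic form of a symmetrized square. -/
lemma dotProduct_mul_mul_mulVec {ι : Type*} [Fintype ι] {S a : Matrix ι ι ℝ} (hS : S.IsSymm)
    (hSa : (S * a).IsSymm) (y : ι → ℝ) :
    y ⬝ᵥ (S * a * a) *ᵥ y = (a *ᵥ y) ⬝ᵥ S *ᵥ (a *ᵥ y) := by
  have h1 : aᵀ * S = S * a := by
    have := hSa.eq
    rwa [Matrix.transpose_mul, hS.eq] at this
  rw [← h1, ← Matrix.mulVec_mulVec, ← Matrix.mulVec_mulVec, Matrix.dotProduct_mulVec,
    Matrix.vecMul_transpose]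

/-- Coercivity of the derivative of the weighted symmetrizer in the compressive direction. -/
lemma coercive_dcurve {a₀ a : EuclideanSpace ℝ (Fin n) → Matrix (Fin n) (Fin n) ℝ}
    {u h ξ : EuclideanSpace ℝ (Fin n)} {k : Set (EuclideanSpace ℝ (Fin n))} (hu : u ∈ k)
    {M c m D t s : ℝ} (hm : 0 < m) (hD : 0 ≤ D) (hS : (a₀ u).IsSymm) (hSa : (a₀ u * a u).IsSymm)
    (hpos : ∀ y : Fin n → ℝ, m * (y ⬝ᵥ y) ≤ y ⬝ᵥ a₀ u *ᵥ y)
    (hc : ∀ y : Fin n → ℝ, c * (y ⬝ᵥ y) ≤ -(y ⬝ᵥ dmat (fun u => a₀ u * a u) u ξ *ᵥ y) / 2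
      + M * ((a u *ᵥ y) ⬝ᵥ (a u *ᵥ y)))
    (hM : 0 < M) (h1 : BoundedC1On D (fun u => a₀ u * a u) k)
    (h2 : BoundedC1On D (fun u => a₀ u * a u * a u) k)
    (hξ : ‖h - ‖h‖ • ξ‖ ≤ s * ‖h‖) (hs : D * s + |t| * D ≤ c) (y : Fin n → ℝ) :
    c * ‖h‖ * (y ⬝ᵥ y) ≤ y ⬝ᵥ (-dcurve (fun u => a₀ u * a u) (fun u => a₀ u * a u * a u) u h t
      (2 * M / m * ‖h‖)) *ᵥ y := by
  have hy := dotProduct_self_nonneg_real y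
  -- The derivative is linear in the direction: `U'` is split into its component along the shock
  -- direction, which compresses, and a small remainder.
  have e : dmat (fun u => a₀ u * a u) u h = ‖h‖ • dmat (fun u => a₀ u * a u) u ξ
      + dmat (fun u => a₀ u * a u) u (h - ‖h‖ • ξ) := by
    rw [← dmat_smul, ← dmat_add, add_sub_cancel]
  have b1 := (abs_dotProduct_mulVec_le (dmat (fun u => a₀ u * a u) u (h - ‖h‖ • ξ)) y).trans
    (mul_le_mul_of_nonneg_right ((h1.dmat_le u hu _).trans
      (mul_le_mul_of_nonneg_left hξ hD)) hy)
  have b2 := (abs_dotProduct_mulVec_le (dmat (fun u => a₀ u * a u * a u) u h) y).trans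
    (mul_le_mul_of_nonneg_right (h2.dmat_le u hu _) hy)
  have b3 := dotProduct_mul_mul_mulVec hS hSa y
  have b4 := hpos (a u *ᵥ y)
  have b5 := mul_le_mul_of_nonneg_left (hc y) (norm_nonneg h)
  -- The rate `θ' = 2 M / m * |U'|` is calibrated here: coercivity of `a₀` turns `θ' ⟨a y, a₀ a y⟩`
  -- into at least `2 M |U'| |a y|²`, as required by the compression estimate.
  have b6 : 2 * M / m * ‖h‖ * (m * ((a u *ᵥ y) ⬝ᵥ (a u *ᵥ y))) ≤
      2 * M / m * ‖h‖ * ((a u *ᵥ y) ⬝ᵥ a₀ u *ᵥ (a u *ᵥ y)) := by gcongr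
  have b7 : 2 * M / m * ‖h‖ * (m * ((a u *ᵥ y) ⬝ᵥ (a u *ᵥ y))) =
      2 * (‖h‖ * (M * ((a u *ᵥ y) ⬝ᵥ (a u *ᵥ y)))) := by field_simp
  have b8 : |t * (y ⬝ᵥ dmat (fun u => a₀ u * a u * a u) u h *ᵥ y)| ≤
      |t| * (D * ‖h‖ * (y ⬝ᵥ y)) := by
    rw [abs_mul]; gcongr
  have b9 : (D * s + |t| * D) * (‖h‖ * (y ⬝ᵥ y)) ≤ c * (‖h‖ * (y ⬝ᵥ y)) := by
    gcongr
  have b10 := (abs_le.1 b1).2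
  have b11 := (abs_le.1 b8).1
  rw [dcurve, e]
  simp only [Matrix.neg_mulVec, Matrix.sub_mulVec, Matrix.add_mulVec, Matrix.smul_mulVec,
    dotProduct_neg, dotProduct_sub, dotProduct_add, dotProduct_smul, smul_eq_mul]
  rw [b3]
  linarith

end Weight

/-! ### Construction of the Goodman weight and verification of its bounds -/

section Weight

variable {n r : ℕ} {F : State n r → State n r} {q : State n r → EuclideanSpace ℝ (Fin r)}
  {vstar : EuclideanSpace ℝ (Fin n) → EuclideanSpace ℝ (Fin r)}
  {U : Set (EuclideanSpace ℝ (Fin n))} {V : Set (EuclideanSpace ℝ (Fin r))}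
  {𝒲 : Set (State n r)} {Us : Set (EuclideanSpace ℝ (Fin n))}
  {a₀ : EuclideanSpace ℝ (Fin n) → Matrix (Fin n) (Fin n) ℝ} {c₀ : ℝ}
  {α₀ : EuclideanSpace ℝ (Fin n) → ℝ}
  {r₀ : EuclideanSpace ℝ (Fin n) → EuclideanSpace ℝ (Fin n)}
  {K : Set (State n r)}

/-- A resolvent bound is stable under small perturbations of the matrix. -/
lemma resolvent_perturb {B B' : Matrix (Fin r) (Fin r) ℝ} {c C : ℝ} {l : ℂ}
    {y : EuclideanSpace ℂ (Fin r)} (hc : 0 < c) (hC : 2 / c ≤ C)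
    (h : c * (‖y‖ * (1 + ‖l‖)) ≤ ‖l • y - cmul B y‖) (hB : entrySum (B' - B) ≤ c / 2) :
    ‖y‖ * (1 + ‖l‖) ≤ C * ‖l • y - cmul B' y‖ := by
  have h1 : ‖cmul (B' - B) y‖ ≤ c / 2 * ‖y‖ := (norm_cmul_le _ _).trans (by gcongr)
  have h2 : l • y - cmul B y = (l • y - cmul B' y) + cmul (B' - B) y := by
    rw [sub_cmul]; abel
  have h3 := norm_add_le (l • y - cmul B' y) (cmul (B' - B) y)
  rw [← h2] at h3
  have h4 : c / 2 * ‖y‖ ≤ c / 2 * (‖y‖ * (1 + ‖l‖)) := by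
    gcongr
    exact le_mul_of_one_le_right (norm_nonneg _) (by linarith [norm_nonneg l])
  calc ‖y‖ * (1 + ‖l‖) = 2 / c * (c / 2 * (‖y‖ * (1 + ‖l‖))) := by field_simp
    _ ≤ 2 / c * ‖l • y - cmul B' y‖ := by
        gcongr
        linarith
    _ ≤ _ := by gcongr

/-- Quadratic forms of a perturbed matrix `B - t M`. -/
lemma le_dotProduct_sub_smul {ι : Type*} [Fintype ι] {B M : Matrix ι ι ℝ} {m d t : ℝ} {y : ι → ℝ}
    (hB : m * (y ⬝ᵥ y) ≤ y ⬝ᵥ B *ᵥ y) (hM : |t| * entrySum M ≤ d) :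
    (m - d) * (y ⬝ᵥ y) ≤ y ⬝ᵥ (B - t • M) *ᵥ y := by
  have hy := dotProduct_self_nonneg_real y
  have h1 := (abs_le.1 (abs_dotProduct_mulVec_le (t • M) y)).2
  rw [entrySum_smul] at h1
  have h2 := mul_le_mul_of_nonneg_right hM hy
  rw [Matrix.sub_mulVec, dotProduct_sub]
  linarith

lemma exists_isEnergyWeight (hsys : IsRelaxationSystem F q vstar U V 𝒲 Us)
    (hB1 : AssumptionB1 F q vstar Us a₀) (hB3 : AssumptionB3 F vstar Us c₀ α₀ r₀)
    (hK : IsCompact K) (hKU : ∀ w ∈ K, uPart w ∈ Us) (T : ℝ) :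
    ∃ C c : ℝ, 1 ≤ C ∧ 0 < c ∧ ∀ᶠ ε in 𝓝 (0 : ℝ), 0 < ε → ∀ W Wm Wp,
      IsRelaxationShock F q vstar K W Wm Wp → IsTame vstar α₀ r₀ T ε W →
      ∃ S a P' H H', IsEnergyWeight C c ε (fun x => jacobian F (W x))
        (fun x => dmat (jacobian F) (W x) (deriv W x)) (fun x => jacobian (source q) (W x))
        (fun x => srcU q (W x)) (fun x => srcV q (W x)) (fun x => (srcV q (W x))⁻¹)
        S a P' H H' (fun x => ‖deriv W x‖) := by
  have hk : IsCompact (uPart '' K) := hK.image (projU n r).continuous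
  have hkU : uPart '' K ⊆ Us := by rintro _ ⟨w, hw, rfl⟩; exact hKU w hw
  have hkE : IsCompact (eqState vstar '' (uPart '' K)) :=
    hk.image_of_continuousOn (hsys.contDiffOn_eqState.continuousOn.mono hkU)
  have hreg := isOpen_regularSet hsys.contDiff_q hsys.isOpen_Us
  obtain ⟨δ, hδ, hδE⟩ := hkE.exists_cthickening_subset_open hreg (by
    rintro _ ⟨_, ⟨w, hw, rfl⟩, rfl⟩; exact hsys.eqState_mem (hKU w hw))
  obtain ⟨m, hm, hm'⟩ := hB1.exists_coercive hk hkU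
  obtain ⟨M, c, hM, hc, hcomp⟩ := exists_compression hsys hB1 hB3 hk hkU
  obtain ⟨ρ, hρ, hres⟩ := hsys.exists_resolvent_bound hk hkU
  set ja := jacobian (relaxedFlux F vstar) with hja
  have ca : MatC1On ja Us := hsys.matC1On_jacobian_relaxedFlux
  have ca₀ : MatC1On a₀ Us := hB1.contDiffOn
  have cg1 : MatC1On (fun u => a₀ u * ja u) Us := ca₀.mul ca
  have cg2 : MatC1On (fun u => a₀ u * ja u * ja u) Us := cg1.mul ca
  have hproj : ContDiffOn ℝ 1 (uPart : State n r → _) (regularSet q Us) :=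
    (projU n r).contDiff.contDiffOn
  have hmaps : Set.MapsTo (uPart : State n r → _) (regularSet q Us) Us := fun w hw => hw.1
  have cb1 : MatC1On (fun w : State n r => a₀ (uPart w)) (regularSet q Us) := ca₀.comp hproj hmaps
  have cb2 : MatC1On (fun w : State n r => a₀ (uPart w) * ja (uPart w)) (regularSet q Us) :=
    cg1.comp hproj hmaps
  obtain ⟨cA, cq1, cq2, cqi⟩ :=
    relaxedJacobian_contDiff (Us := Us) hsys.contDiff_F hsys.contDiff_q
  have cN := matC1On_derivWeight (Us := Us) hsys.contDiff_F hsys.contDiff_q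
  have cv := matC1On_viscosityAt (Us := Us) hsys.contDiff_F hsys.contDiff_q
  have ev : ∀ {κ ι : Type} [Fintype κ] [Fintype ι] {f : State n r → Matrix κ ι ℝ},
      MatC1On f (regularSet q Us) → ∀ᶠ D in atTop, BoundedC1On D f
        (Metric.cthickening δ (eqState vstar '' (uPart '' K))) := fun hf =>
    hf.eventually_bounded hreg hkE.cthickening hδE
  -- Each bound holds for all large constants, so one `D` serves for all coefficient functions
  -- simultaneously.
  obtain ⟨D, ⟨hD1, hTD, hMD, hρD⟩, ⟨bg1, bg2, bb1, bb2⟩, ⟨bA, bq2, brel, bsrc⟩,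
      ⟨btan, bincl, bN1, bN2⟩, bv1, bv2, bB⟩ :=
    (((eventually_ge_atTop (1 : ℝ)).and ((eventually_ge_atTop T).and
      ((eventually_ge_atTop (2 * M / m)).and (eventually_ge_atTop (2 / ρ))))).and
    (((cg1.eventually_bounded hsys.isOpen_Us hk hkU).and
      ((cg2.eventually_bounded hsys.isOpen_Us hk hkU).and ((ev cb1).and (ev cb2)))).and
    (((ev cA).and ((ev cq2).and
      ((ev (matC1On_relaxedJacobian hsys.contDiff_F hsys.contDiff_q)).and
        (ev (cq1.fromCols cq2))))).and
    (((ev (matC1On_tangentMat hsys.contDiff_F hsys.contDiff_q)).and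
      ((ev ((MatC1On.const (0 : Matrix (Fin n) (Fin r) ℝ)).fromRows cqi)).and
        ((ev (cb1.mul cN)).and (ev (cb2.mul cN))))).and
    ((ev (cb1.mul cv)).and ((ev (cb2.mul cv)).and
      (ev (((cA.submatrix Sum.inl Sum.inr).mul cqi).mul cqi)))))))).exists
  have hD0 : 0 < D := by linarith
  have hDD : D ≤ D ^ 2 := le_self_pow₀ hD1 (by norm_num)
  have hDDD : D ^ 2 ≤ D ^ 3 := pow_le_pow_right₀ hD1 (by norm_num)
  -- `8 D³` dominates every product of coefficient bounds that occurs. `m / 2` is the coercivity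
  -- left to `S`, and `c / (2 D)` accounts for `|W'| ≤ D |U'|` in the coercivity of `-P'`.
  refine ⟨8 * D ^ 3, min (m / 2) (c / (2 * D)), by linarith, by positivity, ?_⟩
  filter_upwards [eventually_le_of_continuous (f := fun ε => D * (D * ε ^ 2)) (by fun_prop)
      (by simp) hδ,
    eventually_le_of_continuous (f := fun ε => D * (D * ε)) (by fun_prop) (by simp) one_pos,
    eventually_le_of_continuous (f := fun ε => D * (D * ε) * D) (by fun_prop) (by simp)
      (half_pos hm),
    eventually_le_of_continuous (f := fun ε => D * (D * ε ^ 2) + D * (D * ε) * D) (by fun_prop)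
      (by simp) hc,
    eventually_le_of_continuous (f := fun ε => D * (D * (D * ε ^ 2))) (by fun_prop)
      (by simp) (half_pos hρ)] with ε e1 e2 e3 e4 e5 hε W Wm Wp hW hTame
  -- A multiple of the signed arc length of `U`. It is `O(ε)` uniformly in `x`, although its
  -- derivative is comparable to `|U'|`.
  set θ : ℝ → ℝ := fun x => 2 * M / m * ∫ t in (0 : ℝ)..x, ‖uPart (deriv W t)‖ with hθ
  have hθd : ∀ x, HasDerivAt θ (2 * M / m * ‖uPart (deriv W x)‖) x := fun x =>
    ((hW.continuous_norm_deriv.integral_hasStrictDerivAt 0 x).hasDerivAt).const_mul _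
  have hθC : ContDiff ℝ 1 θ := by
    rw [contDiff_one_iff_deriv]
    refine ⟨fun x => (hθd x).differentiableAt, ?_⟩
    rw [show deriv θ = fun x => 2 * M / m * ‖uPart (deriv W x)‖ from funext fun x => (hθd x).deriv]
    exact hW.continuous_norm_deriv.const_mul _
  have hMm : 0 < 2 * M / m := by positivity
  have hθle : ∀ x, |θ x| ≤ D * (D * ε) := fun x => by
    rw [hθ]
    simp only
    rw [abs_mul, abs_of_pos hMm]
    exact mul_le_mul hMD ((hTame.abs_length_le x).trans (by gcongr)) (abs_nonneg _) hD0.le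
  have hθ1 : ∀ x, |θ x| ≤ 1 := fun x => (hθle x).trans e2
  have hp : ∀ x, ‖deriv W x‖ ≤ D * ε ^ 2 := fun x => (hTame.deriv_le x).trans (by gcongr)
  have hΓ : ∀ x, ‖W x - eqState vstar (uPart (W x))‖ ≤ D * ‖deriv W x‖ := fun x =>
    (hTame.equilibrium x).trans (by gcongr)
  have hU : ∀ x, uPart (W x) ∈ uPart '' K := fun x => ⟨_, hW.mem x, rfl⟩
  have hUs : ∀ x, uPart (W x) ∈ Us := fun x => hkU (hU x)
  -- The whole segment from the equilibrium to `W x` stays where `q₂` is invertible, so coefficient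
  -- differences are bounded by `D |W'|` through the mean value inequality.
  have hseg : ∀ x, segment ℝ (eqState vstar (uPart (W x))) (W x) ⊆
      Metric.cthickening δ (eqState vstar '' (uPart '' K)) := fun x => by
    have hmem : eqState vstar (uPart (W x)) ∈ eqState vstar '' (uPart '' K) := ⟨_, hU x, rfl⟩
    refine ((convex_closedBall _ δ).segment_subset (Metric.mem_closedBall_self hδ.le) ?_).trans
      (Metric.closedBall_subset_cthickening hmem δ)
    rw [mem_closedBall_iff_norm]
    exact (hΓ x).trans ((mul_le_mul_of_nonneg_left (hp x) hD0.le).trans e1)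
  have hWk : ∀ x, W x ∈ Metric.cthickening δ (eqState vstar '' (uPart '' K)) := fun x =>
    hseg x (right_mem_segment _ _ _)
  have hWreg : ∀ x, W x ∈ regularSet q Us := fun x => hδE (hWk x)
  have hW1 : ContDiff ℝ 1 W := hW.contDiff.of_le (by norm_num)
  have hU1 : ContDiff ℝ 1 fun x => uPart (W x) := (projU n r).contDiff.comp hW1
  have hS₀ : ∀ x, (a₀ (uPart (W x))).IsSymm := fun x => by
    have := (hB1.posDef _ (hUs x)).isHermitian
    rwa [Matrix.IsHermitian, conjTranspose_eq_transpose_of_trivial] at this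
  have hSa₀ : ∀ x, (a₀ (uPart (W x)) * ja (uPart (W x))).IsSymm := fun x => hB1.isSymm _ (hUs x)
  set S : ℝ → Matrix (Fin n) (Fin n) ℝ := fun x =>
    a₀ (uPart (W x)) - θ x • (a₀ (uPart (W x)) * ja (uPart (W x))) with hS
  have hSle : ∀ x, entrySum (S x) ≤ 2 * D := fun x => entrySum_curve_le (hθ1 x) bb1 bb2 (hWk x)
  have hSmul : ∀ {κ : Type} (x : ℝ) (B : Matrix (Fin n) κ ℝ), S x * B = a₀ (uPart (W x)) * B
      - θ x • (a₀ (uPart (W x)) * ja (uPart (W x)) * B) := fun x B => by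
    rw [hS]; simp only [Matrix.sub_mul, Matrix.smul_mul]
  have hA0 : ∀ x, entrySum (jacobian F (W x)) ≤ D := fun x => bA.le _ (hWk x)
  have hB0 : ∀ x, entrySum (S x * ((jacobian F (W x)).toBlocks₁₂ * (srcV q (W x))⁻¹
      * (srcV q (W x))⁻¹)) ≤ 2 * D * D := fun x =>
    (entrySum_mul_le _ _).trans
      (mul_le_mul (hSle x) (bB.le _ (hWk x)) (entrySum_nonneg _) (by positivity))
  have hH0 : ∀ x, entrySum (S x * derivWeight F q (W x)) ≤ 2 * D := fun x => by
    rw [hSmul]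
    exact entrySum_curve_le (hθ1 x) bN1 bN2 (hWk x)
  -- `S` and `a` are evaluated at the equilibrium over `U`, so that `S a` is exactly symmetric; `H`
  -- keeps the coefficients at `W`, as the energy identity requires. The mismatch is the bound
  -- `offEquilibrium`.
  refine ⟨S, fun x => ja (uPart (W x)),
    fun x => dcurve (fun u => a₀ u * ja u) (fun u => a₀ u * ja u * ja u) (uPart (W x))
      (uPart (deriv W x)) (θ x) (2 * M / m * ‖uPart (deriv W x)‖),
    fun x => S x * derivWeight F q (W x),
    fun x => dcurve (fun w => a₀ (uPart w) * derivWeight F q w)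
      (fun w => a₀ (uPart w) * ja (uPart w) * derivWeight F q w) (W x)
      (deriv W x) (θ x) (2 * M / m * ‖uPart (deriv W x)‖), ?_⟩
  constructor
  case inv => exact fun x => Matrix.nonsing_inv_mul _ (hWreg x).2.isUnit
  case J_fst => exact fun x => jacobian_source_toRows₁ hsys.contDiff_q _
  case J_snd => exact fun x => jacobian_source_toRows₂ _
  case symm => exact fun x => (hS₀ x).sub ((hSa₀ x).smul _)
  case H_eq => exact fun x => rfl
  case contDiff_A => exact fun i j => cA.comp_contDiff hW1 hWreg i j
  case contDiff_P =>
    intro i j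
    simp only [hSmul]
    exact contDiff_curve cg1 cg2 hU1 hUs hθC i j
  case contDiff_H =>
    intro i j
    simp only [hSmul]
    exact contDiff_curve (cb1.mul cN) (cb2.mul cN) hW1 hWreg hθC i j
  case deriv_A => exact fun x i j => cA.hasDerivAt hreg (hW.hasDerivAt x) (hWreg x) i j
  case deriv_P =>
    intro x i j
    simp only [hSmul]
    exact hasDerivAt_curve cg1 cg2 hsys.isOpen_Us (hW.hasDerivAt_uPart x) (hUs x) (hθd x) i j
  case deriv_H =>
    intro x i j
    simp only [hSmul]
    exact hasDerivAt_curve (cb1.mul cN) (cb2.mul cN) hreg (hW.hasDerivAt x) (hWreg x) (hθd x) i j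
  case P_symm =>
    intro x
    simp only [hSmul]
    exact (hSa₀ x).sub ((isSymm_mul_mul (hS₀ x) (hSa₀ x)).smul _)
  case p_nonneg => exact fun x => norm_nonneg _
  case p_le =>
    intro x
    refine (hp x).trans ?_
    gcongr
    linarith
  case p_cont => exact hW.contDiff_deriv.continuous.norm
  case A_le => exact fun x => (hA0 x).trans (by linarith)
  case P_le =>
    intro x
    rw [hSmul]
    exact (entrySum_curve_le (hθ1 x) bg1 bg2 (hU x)).trans (by linarith)
  case H_le => exact fun x => (hH0 x).trans (by linarith)
  case coercive_S =>
    intro x y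
    have hy := dotProduct_self_nonneg_real y
    refine le_trans ?_ (le_dotProduct_sub_smul (hm' _ (hU x) y) (d := m / 2) ?_)
    · gcongr
      linarith [min_le_left (m / 2) (c / (2 * D))]
    · exact (mul_le_mul (hθle x) (bb2.le _ (hWk x)) (entrySum_nonneg _) (by positivity)).trans e3
  case coercive_P' =>
    intro x y
    have hy := dotProduct_self_nonneg_real y
    refine le_trans ?_ (coercive_dcurve (hU x) (s := D * ε ^ 2) (D := D) (c := c) hm hD0.le (hS₀ x)
      (hSa₀ x) (hm' _ (hU x)) (hcomp _ (hU x)) hM bg1 bg2 ((hTame.direction x).trans ?_) ?_ y)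
    · refine mul_le_mul_of_nonneg_right ?_ hy
      calc 2 * min (m / 2) (c / (2 * D)) * ‖deriv W x‖
          ≤ 2 * (c / (2 * D)) * (D * ‖uPart (deriv W x)‖) := by
            gcongr
            · exact min_le_right _ _
            · exact (hTame.deriv_le_uPart x).trans (by gcongr)
        _ = _ := by field_simp
    · gcongr
    · refine le_trans ?_ e4
      gcongr
      exact hθle x
  -- At equilibrium B1 makes the form of `a₀ b₀` nonnegative. Moving to `W` and adding the `θ`
  -- correction each cost at most `D³ ε`.
  case viscous =>
    intro x y
    have hy := dotProduct_self_nonneg_real y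
    have h0 : -(S x * derivWeight F q (W x) * jacobian F (W x) * tangentMat (srcU q (W x))
        (srcV q (W x))⁻¹) = a₀ (uPart (W x)) * viscosityAt F q (W x)
          - θ x • (a₀ (uPart (W x)) * ja (uPart (W x)) * viscosityAt F q (W x)) := by
      rw [← hSmul, viscosityAt_eq, Matrix.mul_neg]
      simp only [Matrix.mul_assoc]
    have h1 : 0 ≤ y ⬝ᵥ (a₀ (uPart (W x)) *
        viscosityAt F q (eqState vstar (uPart (W x)))) *ᵥ y := hB1.nonneg _ (hUs x) y
    have h2 := bv1.sub_le _ _ (hseg x)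
    have h3 : entrySum (a₀ (uPart (W x)) * viscosityAt F q (W x)
        - a₀ (uPart (W x)) * viscosityAt F q (eqState vstar (uPart (W x)))) ≤ D ^ 3 * ε := by
      refine h2.trans ?_
      calc D * ‖W x - eqState vstar (uPart (W x))‖ ≤ D * (D * (D * ε ^ 2)) := by
            gcongr
            exact (hΓ x).trans (by gcongr; exact hp x)
        _ = D * ε * (D * (D * ε)) := by ring
        _ ≤ D * ε * 1 := by gcongr
        _ ≤ D ^ 3 * ε := by rw [mul_one]; gcongr; linarith
    have h4 := (abs_le.1 ((abs_dotProduct_mulVec_le _ y).trans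
      (mul_le_mul_of_nonneg_right h3 hy))).1
    rw [Matrix.sub_mulVec, dotProduct_sub] at h4
    rw [h0]
    refine le_trans ?_ (le_dotProduct_sub_smul (m := -(D ^ 3 * ε)) (d := D ^ 3 * ε)
      (by linarith) ?_)
    · gcongr
      have : 0 ≤ D ^ 3 * ε := by positivity
      linarith
    · refine (mul_le_mul (hθle x) (bv2.le _ (hWk x)) (entrySum_nonneg _) (by positivity)).trans
        (le_of_eq (by ring))
  case offEquilibrium =>
    intro x
    have h2 := brel.sub_le _ _ (hseg x)
    have h3 : ja (uPart (W x)) = relaxedJacobian F q (eqState vstar (uPart (W x))) :=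
      hsys.jacobian_relaxedFlux (hUs x)
    rw [h3]
    refine (entrySum_mul_le _ _).trans ?_
    calc _ ≤ 2 * D * (D * (D * ‖deriv W x‖)) := by
          refine mul_le_mul (hSle x) (h2.trans ?_) (entrySum_nonneg _) (by positivity)
          gcongr
          exact hΓ x
      _ = 2 * D ^ 3 * ‖deriv W x‖ := by ring
      _ ≤ _ := by gcongr; norm_num
  case bound_B =>
    intro x
    have := hB0 x
    nlinarith
  case bound_AB =>
    intro x
    refine (mul_le_mul ((toRows₁_entrySum_le _).trans (hA0 x)) (hB0 x) (entrySum_nonneg _)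
      hD0.le).trans ?_
    nlinarith [pow_pos hD0 3]
  case bound_HA =>
    intro x
    refine (entrySum_mul_le _ _).trans ((mul_le_mul ((entrySum_mul_le _ _).trans
      (mul_le_mul (hH0 x) (hA0 x) (entrySum_nonneg _) (by positivity)))
      (bincl.le _ (hWk x)) (entrySum_nonneg _) (by positivity)).trans ?_)
    nlinarith [pow_pos hD0 3]
  case bound_H'A =>
    intro x
    have h1 := entrySum_dcurve_le (t' := 2 * M / m * ‖uPart (deriv W x)‖) (h := deriv W x)
      (hθ1 x) bN1 bN2 (hWk x)
    have h2 : |2 * M / m * ‖uPart (deriv W x)‖| * D ≤ D * ‖deriv W x‖ * D := by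
      rw [abs_of_nonneg (by positivity)]
      gcongr
      exact norm_uPart_le _
    have h3 : 2 * D * ‖deriv W x‖ + D * ‖deriv W x‖ * D ≤ 3 * D ^ 2 * ‖deriv W x‖ := by
      have := mul_le_mul_of_nonneg_right hDD (norm_nonneg (deriv W x))
      linarith
    calc _ ≤ 3 * D ^ 2 * ‖deriv W x‖ * D :=
          mul_le_mul (by linarith) (hA0 x) (entrySum_nonneg _) (by positivity)
      _ = 3 * D ^ 3 * ‖deriv W x‖ := by ring
      _ ≤ _ := by gcongr; norm_num
  -- Stability is assumed only at equilibria; `W` is within `O(ε²)` of one, which perturbs `q₂` by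
  -- at most half the resolvent constant.
  case resolvent =>
    intro x l hl y
    refine resolvent_perturb hρ (by linarith) (hres _ (hU x) l hl y) ?_
    refine (bq2.sub_le _ _ (hseg x)).trans (le_trans ?_ e5)
    gcongr
    exact (hΓ x).trans (by gcongr; exact hp x)
  case bound_source =>
    intro x
    have h1 : entrySum (fromCols (srcU q (W x)) (srcV q (W x))) *
        entrySum (dmat (jacobian F) (W x) (deriv W x)) ≤ D * (D * ‖deriv W x‖) :=
      mul_le_mul (bsrc.le _ (hWk x)) (bA.dmat_le _ (hWk x) _) (entrySum_nonneg _) hD0.le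
    have h2 : (1 : ℝ) ≤ 8 * D ^ 3 := by linarith
    calc _ ≤ 8 * D ^ 3 * (D * (D * ‖deriv W x‖)) := by gcongr
      _ = 8 * D ^ 3 * D ^ 2 * ‖deriv W x‖ := by ring
      _ ≤ 8 * D ^ 3 * (8 * D ^ 3) ^ 3 * ‖deriv W x‖ := by
          gcongr
          exact (by linarith : D ^ 2 ≤ 8 * D ^ 3).trans (le_self_pow₀ h2 (by norm_num))
      _ = _ := by ring
  case bound_source' =>
    intro x
    have h2 : (1 : ℝ) ≤ 8 * D ^ 3 := by linarith
    calc _ ≤ D * D := mul_le_mul (bsrc.le _ (hWk x)) (hA0 x) (entrySum_nonneg _) hD0.le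
      _ = D ^ 2 := by ring
      _ ≤ _ := (by linarith : D ^ 2 ≤ 8 * D ^ 3).trans (le_self_pow₀ h2 (by norm_num))
  case bound_tangent => exact fun x => (btan.le _ (hWk x)).trans (by linarith)
  case bound_incl => exact fun x => (bincl.le _ (hWk x)).trans (by linarith)

end Weight

end RelaxationShock

end

/-! ### The Goodman estimate -/

theorem mainTheorem4 {n r : ℕ}
    (F : RelaxationShock.State n r → RelaxationShock.State n r)
    (q : RelaxationShock.State n r → EuclideanSpace ℝ (Fin r))
    (vstar : EuclideanSpace ℝ (Fin n) → EuclideanSpace ℝ (Fin r))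
    (U : Set (EuclideanSpace ℝ (Fin n))) (V : Set (EuclideanSpace ℝ (Fin r)))
    (𝒲 : Set (RelaxationShock.State n r)) (Us : Set (EuclideanSpace ℝ (Fin n)))
    (hsys : RelaxationShock.IsRelaxationSystem F q vstar U V 𝒲 Us)
    (a₀ k : EuclideanSpace ℝ (Fin n) → Matrix (Fin n) (Fin n) ℝ)
    (hB1 : RelaxationShock.AssumptionB1 F q vstar Us a₀)
    (hB2 : RelaxationShock.AssumptionB2 F q vstar Us a₀ k)
    (c₀ : ℝ) (α₀ : EuclideanSpace ℝ (Fin n) → ℝ)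
    (r₀ : EuclideanSpace ℝ (Fin n) → EuclideanSpace ℝ (Fin n))
    (hB3 : RelaxationShock.AssumptionB3 F vstar Us c₀ α₀ r₀)
    -- the compact set of states in which the profiles take their values
    (K : Set (RelaxationShock.State n r)) (hK : IsCompact K) (hKW : K ⊆ 𝒲)
    (hKU : ∀ w ∈ K, RelaxationShock.uPart w ∈ Us)
    (C₁ : ℝ) (hC₁ : 0 < C₁) :
    ∃ ε₀ : ℝ, 0 < ε₀ ∧ ∃ C : ℝ, 0 < C ∧
      ∀ (W : ℝ → RelaxationShock.State n r) (Wm Wp : RelaxationShock.State n r),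
        RelaxationShock.IsRelaxationShock F q vstar K W Wm Wp →
        RelaxationShock.AssumptionC α₀ r₀ C₁ W Wm Wp →
        ∀ ε : ℝ, ε = ‖Wp - Wm‖ → ε ≤ ε₀ →
        ∀ l : ℂ, 0 ≤ l.re → l ≠ 0 →
        ∀ w : ℝ → RelaxationShock.CState n r, RelaxationShock.MemH1 w →
          RelaxationShock.SolvesResolvent F q W l w →
        ∃ z : ℝ → EuclideanSpace ℂ (Fin n),
          RelaxationShock.IsIntegratedFromBot (fun x => RelaxationShock.uPart (w x)) z ∧
          MemLp z 2 volume ∧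
          l.re * (∫ x, ‖z x‖ ^ 2) + (∫ x, ‖z x‖ ^ 2 * ‖deriv W x‖) ≤
            C * (ε * (∫ x, ‖RelaxationShock.uPart (w x)‖ ^ 2)
              + ε * (∫ x, ‖RelaxationShock.cmul
                  (RelaxationShock.jacobian (RelaxationShock.source q) Wp
                    + RelaxationShock.jacobian (RelaxationShock.source q) Wm) (w x)‖ ^ 2)
              + ε⁻¹ * (∫ x, ‖deriv w x‖ ^ 2)) := by
  obtain ⟨T, hT, hTame⟩ := RelaxationShock.exists_isTame hsys hB1 hB3 hK hKW hKU hC₁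
  obtain ⟨C, c, hC, hc, hweight⟩ := RelaxationShock.exists_isEnergyWeight (α₀ := α₀) (r₀ := r₀)
    hsys hB1 hB3 hK hKU T
  obtain ⟨ε₁, hε₁, -, M, hM, henergy⟩ := RelaxationShock.exists_energy_estimate hC hc
  obtain ⟨ε₂, hε₂, -, hsmall⟩ := RelaxationShock.exists_threshold (hTame.and hweight)
  refine ⟨min ε₁ ε₂, lt_min hε₁ hε₂, M, hM, ?_⟩
  intro W Wm Wp hW hprofile ε hε hεle l hl hl0 w hw heq
  -- The end states are distinct, so `ε` is positive and `ε⁻¹` is a genuine inverse.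
  have hε0 : 0 < ε := hε ▸ norm_pos_iff.2 (sub_ne_zero.2 hW.ne.symm)
  obtain ⟨h1, h2⟩ := hsmall ε hε0.le (hεle.trans (min_le_right _ _))
  obtain ⟨S, a, P', H, H', hEW⟩ := h2 hε0 W Wm Wp hW (h1 W Wm Wp hW hprofile hε.symm)
  obtain ⟨z, hz1, hz2, hz3⟩ :=
    henergy ε hε0 (hεle.trans (min_le_left _ _)) hEW l hl hl0 w hw heq
  refine ⟨z, hz1, hz2, hz3.trans (mul_le_mul_of_nonneg_left ?_ hM.le)⟩
  -- The energy estimate already holds without the `Πw` term; this nonnegative quantity is simply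
  -- added on the right.
  have h3 : 0 ≤ ε * ∫ x, ‖RelaxationShock.cmul
      (RelaxationShock.jacobian (RelaxationShock.source q) Wp
        + RelaxationShock.jacobian (RelaxationShock.source q) Wm) (w x)‖ ^ 2 :=
    mul_nonneg hε0.le (MeasureTheory.integral_nonneg fun x => sq_nonneg _)
  linarith
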